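/- Let $K$ be a field of characteristic $0$, let $\mu=(\mu_4,\mu_6,\mu_8,\mu_{10},\mu_{12},\mu_{14})$ be indeterminates, and consider the genus-3 curve $y^2=f(x)$, $f(x)=x^7+\mu_4x^5+\mu_6x^4+\mu_8x^3+\mu_{10}x^2+\mu_{12}x+\mu_{14}$ over $K[\mu]$. *Operators.* Let $V=(V_{ji})_{0\le i,j\le 5}$ be the symmetric matrix over $K[\mu]$ such that $\sum_iV_{ji}x^{5-i}$ is the remainder modulo $f'$ of $f(x)\,B_j(x)$, where $\sum_jB_j(x)z^{5-j}=2\,\frac{f'(x)-f'(z)}{x-z}$. Let $L_{2j}=\sum_iV_{ji}\,\partial/\partial\mu_{2i+4}$ ($0\le j\le5$); these are tangent to the discriminant $\Delta$ of $f$, with $L_{2j}\Delta=c_j\Delta$, $(c_0,\dots,c_5)=(84,0,40\mu_4,24\mu_6,12\mu_8,4\mu_{10})$. Let $\Gamma_{2j}=\begin{pmatrix}-\beta_{2j}&\alpha_{2j}\\-\gamma_{2j}&{}^t\!\beta_{2j}\end{pmatrix}$, with $\alpha_{2j},\gamma_{2j}$ symmetric, be the matrix of the action of $L_{2j}$ on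 the first cohomology of the curve (differentials modulo exact ones) in the basis $h(x)\,dx/2y$ with $h=1,\ x,\ x^2,\ 5x^5+3\mu_4x^3+2\mu_6x^2+\mu_8x,\ 3x^4+\mu_4x^2,\ x^3$. With $u={}^t(u_5,u_3,u_1)$ put $$H_{2j}=\tfrac12\sum_{a,b}(\alpha_{2j})_{ab}\partial_{u_a}\partial_{u_b}+\sum_{a,b}(\beta_{2j})_{ab}u_b\partial_{u_a}+\tfrac12\sum_{a,b}(\gamma_{2j})_{ab}u_au_b+\tfrac12\operatorname{Tr}\beta_{2j}-\tfrac18c_j .$$ *Notation.* For $I=(\ell,m,n)$ with $n=(n_4,n_6,\dots,n_{14})$, all in $\mathbb Z$, let $W(I)=4n_4+6n_6+\dots+14n_{14}$ (the $\mu$-weight) and $k=k(I)=6-5\ell-3m+W(I)$. Call $I$ admissible if $k,\ell,m,n_4,\dots,n_{14}\ge0$. All families $b=(b(I))$ in $K$ below vanish at non-admissible $I$. Put $$\sigma_b=\sum_{I}b(\ell,m,n)\,\mu_4^{n_4}\cdots\mu_{14}^{n_{14}}\frac{u_5^\ell}{\ell!}\frac{u_3^m}{m!}\frac{u_1^k}{k!}\in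 K[\mu][[u_5,u_3,u_1]].$$ **Theorem.** (a) $\varphi\in K[\mu][[u]]$ satisfies $(L_0-H_0)\varphi=0$ if and only if $\varphi=\sigma_b$ for a (unique) family $b$. (b) For a family $b$, the equation $(L_{2j}-H_{2j})\sigma_b=0$ with $j=1,\dots,5$ is equivalent to the recurrence $P_2,P_4,P_6,P_8,P_{10}$ respectively, required for all admissible $(\ell,m,n)$ with $k\ge2,4,6,8,10$ respectively, where $$\begin{aligned} P_2:&\quad b(\ell,m,n)=2(2-k)\,b(\ell,m+1,n)-6m\,b(\ell+1,m-1,n)+\text{l.w.t.},\\ P_4:&\quad b(\ell,m+1,n)=-(k'-1)\,b(\ell+1,m,n)+\text{l.w.t.},\qquad k'=k(\ell,m+1,n),\\ P_6:&\quad b(\ell,m+2,n)+2\,b(\ell+1,m,n)=\text{l.w.t.},\\ P_8:&\quad b(\ell+1,m+1,n)=\text{l.w.t.},\\ P_{10}:&\quad b(\ell+2,m,n)=\text{l.w.t.}, \end{aligned}$$ and l.w.t. ("lower weight terms") are explicit finite linear combinations of values of $b$ whose coefficients are polynomials of degree at most $2$ in $\ell,m,n_4,\dots,n_{14}$, times integers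 or rational numbers with denominator $7$; the relations have $20,20,24,24,19$ terms in total. For $P_2$ the values of $b$ in l.w.t. have $\mu$-weight between $W-12$ and $W-2$, where $W=W(I)$; in the other recurrences they have $\mu$-weight less than $W$. (c) Consider the following two recursion schemes for $b$. In both, $b(\ell,m,n)=0$ if $\min\{k,\ell,m,n_4,\dots,n_{14}\}<0$ and $b(1,0,\dots,0)=1$. In the other cases $b(\ell,m,n)$ is given by the right hand side of the recurrence named below, translated so that its left hand side is $b(\ell,m,n)$; here $P_6^{(a)}$ and $P_6^{(b)}$ are $P_6$ solved for $b(\ell,m,n)$ as its first and its second term, $b(\ell,m,n)=-2b(\ell+1,m-2,n)+\text{l.w.t.}$ and $2b(\ell,m,n)=-b(\ell-1,m+2,n)+\text{l.w.t.}$ Scheme 1: $P_2$ if $k>1$; $P_4$ if $k=1,m>0$; $P_6^{(a)}$ if $k=0,m>1$; $P_8$ if $k=0,m=1$; $P_{10}$ if $k\le1,m=0$. Scheme 2: $P_{10}$ if $\ell>1$; $P_8$ if $\ell=1,m>0$; $P_6^{(b)}$ if $\ell=1,m=0$; $P_4$ if $\ell=0,m>0,k>0$; $P_6^{(a)}$ if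 $\ell=0,m>0,k=0$; $P_2$ if $\ell=m=0$. Call $I\to J$ a step of a scheme if $I,J$ are admissible, $I\ne(1,0,\dots,0)$ and the scheme computes $b(I)$ by an expression in which $b(J)$ has a nonzero coefficient. Along steps the $\mu$-weight never increases. In Scheme 1 it decreases strictly along any chain of more than $\max(k(I),1)$ steps starting at $I$; in Scheme 2 it decreases strictly along any chain of at least $5$ steps. (d) Each of the two schemes has exactly one solution $b$, and it is the same for both. For this $b$ the Hurwitz series $\sigma_b$ spans over $K$ the space of all $\varphi\in K[\mu][[u_5,u_3,u_1]]$ with $(L_{2j}-H_{2j})\varphi=0$ for $j=0,\dots,5$. In particular this space is one-dimensional. -/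

import Mathlib

namespace HyperellipticSigma

noncomputable section

variable {K : Type*} [Field K]

/-! ## The curve and the vector fields tangent to its discriminant -/

/-- The ring `K[μ₄, μ₆, μ₈, μ₁₀, μ₁₂, μ₁₄]` of parameters; the variable of index `i` is
`μ_{2i+4}`. -/
abbrev Params (K : Type*) [Field K] : Type _ := MvPolynomial (Fin 6) K

abbrev μ₄ : Params K := MvPolynomial.X 0
abbrev μ₆ : Params K := MvPolynomial.X 1
abbrev μ₈ : Params K := MvPolynomial.X 2
abbrev μ₁₀ : Params K := MvPolynomial.X 3
abbrev μ₁₂ : Params K := MvPolynomial.X 4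
abbrev μ₁₄ : Params K := MvPolynomial.X 5

/-- A polynomial in `x` of degree at most `7` over the parameter ring, given by its
coefficients. -/
def xPoly (c : Fin 8 → Params K) : Polynomial (Params K) :=
  ∑ i, Polynomial.C (c i) * Polynomial.X ^ (i : ℕ)

/-- The coefficients of `f(x) = x⁷ + μ₄x⁵ + μ₆x⁴ + μ₈x³ + μ₁₀x² + μ₁₂x + μ₁₄`, the right hand
side of the equation `y² = f(x)` of the curve. -/
def curveCoeff : Fin 8 → Params K := ![μ₁₄, μ₁₂, μ₁₀, μ₈, μ₆, μ₄, 0, 1]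

open MvPolynomial (C)

/-- The symmetric matrix `V`.  Writing `V⁽ⁱ⁾(x)` for the polynomial with the entries of row `i`
as coefficients of `x⁵, x⁴, …, 1`, it is the remainder modulo `f'` of the product of `f` with row
`i` of the Bezoutian of `f'`, see `IsTangent`. -/
def V : Matrix (Fin 6) (Fin 6) (Params K) :=
  !![4 * μ₄, 6 * μ₆, 8 * μ₈, 10 * μ₁₀, 12 * μ₁₂, 14 * μ₁₄;
    6 * μ₆, 8 * μ₈ - C (20 / 7) * μ₄ ^ 2, 10 * μ₁₀ - C (16 / 7) * μ₄ * μ₆,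
      12 * μ₁₂ - C (12 / 7) * μ₄ * μ₈, 14 * μ₁₄ - C (8 / 7) * μ₄ * μ₁₀, -(C (4 / 7) * μ₄ * μ₁₂);
    8 * μ₈, 10 * μ₁₀ - C (16 / 7) * μ₄ * μ₆, 12 * μ₁₂ + 4 * μ₄ * μ₈ - C (24 / 7) * μ₆ ^ 2,
      14 * μ₁₄ + 6 * μ₄ * μ₁₀ - C (18 / 7) * μ₆ * μ₈, 8 * μ₄ * μ₁₂ - C (12 / 7) * μ₆ * μ₁₀,
      10 * μ₄ * μ₁₄ - C (6 / 7) * μ₆ * μ₁₂;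
    10 * μ₁₀, 12 * μ₁₂ - C (12 / 7) * μ₄ * μ₈, 14 * μ₁₄ + 6 * μ₄ * μ₁₀ - C (18 / 7) * μ₆ * μ₈,
      8 * μ₄ * μ₁₂ + 4 * μ₆ * μ₁₀ - C (24 / 7) * μ₈ ^ 2,
      10 * μ₄ * μ₁₄ + 6 * μ₆ * μ₁₂ - C (16 / 7) * μ₈ * μ₁₀, 8 * μ₆ * μ₁₄ - C (8 / 7) * μ₈ * μ₁₂;
    12 * μ₁₂, 14 * μ₁₄ - C (8 / 7) * μ₄ * μ₁₀, 8 * μ₄ * μ₁₂ - C (12 / 7) * μ₆ * μ₁₀,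
      10 * μ₄ * μ₁₄ + 6 * μ₆ * μ₁₂ - C (16 / 7) * μ₈ * μ₁₀,
      8 * μ₆ * μ₁₄ + 4 * μ₈ * μ₁₂ - C (20 / 7) * μ₁₀ ^ 2, 6 * μ₈ * μ₁₄ - C (10 / 7) * μ₁₀ * μ₁₂;
    14 * μ₁₄, -(C (4 / 7) * μ₄ * μ₁₂), 10 * μ₄ * μ₁₄ - C (6 / 7) * μ₆ * μ₁₂,
      8 * μ₆ * μ₁₄ - C (8 / 7) * μ₈ * μ₁₂, 6 * μ₈ * μ₁₄ - C (10 / 7) * μ₁₀ * μ₁₂,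
      4 * μ₁₀ * μ₁₄ - C (12 / 7) * μ₁₂ ^ 2]

/-- The vector field `L_{2j} = ∑ᵢ V_{ji} ∂/∂μ_{2i+4}` on the parameter space, for
`j = 0, …, 5`, that is, the derivation that maps `μ_{2i+4}` to `V_{ji}`. -/
def L (j : Fin 6) : Derivation K (Params K) (Params K) :=
  MvPolynomial.mkDerivation K (V j)

/-- The factors `c_j = L_{2j}(Δ) / Δ`, where `Δ` is the discriminant of `f`. -/
def discFactor : Fin 6 → Params K :=
  ![84, 0, 40 * μ₄, 24 * μ₆, 12 * μ₈, 4 * μ₁₀]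

/-! ## The action of the vector fields on the first cohomology -/

/-- The numerators `h` (as coefficient vectors) of the symplectic basis
`ω₅, ω₃, ω₁, η₋₅, η₋₃, η₋₁` of differential forms `h(x) dx / (2y)` on the curve:
`1`, `x`, `x²`, `5x⁵ + 3μ₄x³ + 2μ₆x² + μ₈x`, `3x⁴ + μ₄x²`, `x³`. -/
def formCoeff : Fin 3 ⊕ Fin 3 → Fin 8 → Params K :=
  Sum.elim
    ![![1, 0, 0, 0, 0, 0, 0, 0], ![0, 1, 0, 0, 0, 0, 0, 0], ![0, 0, 1, 0, 0, 0, 0, 0]]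
    ![![0, μ₈, 2 * μ₆, 3 * μ₄, 0, 5, 0, 0], ![0, 0, μ₄, 0, 3, 0, 0, 0],
      ![0, 0, 0, 1, 0, 0, 0, 0]]

/-- The blocks `α_{2j}` of the matrices `Γ_{2j}` of the vector fields `L_{2j}`. -/
def α (j : Fin 6) : Matrix (Fin 3) (Fin 3) (Params K) :=
  ![!![0, 0, 0;
      0, 0, 0;
      0, 0, 0],
    !![0, 0, 0;
      0, 0, 0;
      0, 0, 1],
    !![0, 0, 0;
      0, 0, 1;
      0, 1, 0],
    !![0, 0, 1;
      0, 1, 0;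
      1, 0, 0],
    !![0, 1, 0;
      1, 0, 0;
      0, 0, 0],
    !![1, 0, 0;
      0, 0, 0;
      0, 0, 0]] j

/-- The blocks `β_{2j}` of the matrices `Γ_{2j}` of the vector fields `L_{2j}`. -/
def β (j : Fin 6) : Matrix (Fin 3) (Fin 3) (Params K) :=
  ![!![5, 0, 0;
      0, 3, 0;
      0, 0, 1],
    !![0, 3, 0;
      -(C (4 / 7) * μ₄), 0, 1;
      0, -(C (8 / 7) * μ₄), 0],
    !![3 * μ₄, 0, 1;
      -(C (6 / 7) * μ₆), μ₄, 0;
      0, -(C (12 / 7) * μ₆), 0],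
    !![2 * μ₆, μ₄, 0;
      -(C (8 / 7) * μ₈), 0, 0;
      0, -(C (9 / 7) * μ₈), 0],
    !![μ₈, 0, 0;
      -(C (10 / 7) * μ₁₀), 0, 0;
      μ₁₂, -(C (6 / 7) * μ₁₀), 0],
    !![0, 0, 0;
      -(C (5 / 7) * μ₁₂), 0, 0;
      2 * μ₁₄, -(C (3 / 7) * μ₁₂), 0]] j

/-- The blocks `γ_{2j}` of the matrices `Γ_{2j}` of the vector fields `L_{2j}`. -/
def γ (j : Fin 6) : Matrix (Fin 3) (Fin 3) (Params K) :=
  ![!![0, 0, 0;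
      0, 0, 0;
      0, 0, 0],
    !![5 * μ₁₂ - C (4 / 7) * μ₄ * μ₈, 0, 0;
      0, 3 * μ₈ - C (8 / 7) * μ₄ ^ 2, 0;
      0, 0, -(C (5 / 7) * μ₄)],
    !![10 * μ₁₄ - C (6 / 7) * μ₆ * μ₈, 3 * μ₁₂, 0;
      3 * μ₁₂, 6 * μ₁₀ - C (12 / 7) * μ₄ * μ₆, μ₈;
      0, μ₈, -(C (4 / 7) * μ₆)],
    !![3 * μ₄ * μ₁₂ - C (8 / 7) * μ₈ ^ 2, 6 * μ₁₄, μ₁₂;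
      6 * μ₁₄, 9 * μ₁₂ - C (9 / 7) * μ₄ * μ₈, 2 * μ₁₀;
      μ₁₂, 2 * μ₁₀, -(C (3 / 7) * μ₈)],
    !![6 * μ₄ * μ₁₄ + 2 * μ₆ * μ₁₂ - C (10 / 7) * μ₈ * μ₁₀, μ₄ * μ₁₂, 2 * μ₁₄;
      μ₄ * μ₁₂, 12 * μ₁₄ - C (6 / 7) * μ₄ * μ₁₀, 3 * μ₁₂;
      2 * μ₁₄, 3 * μ₁₂, -(C (2 / 7) * μ₁₀)],
    !![4 * μ₆ * μ₁₄ - C (5 / 7) * μ₈ * μ₁₂, 2 * μ₄ * μ₁₄, 0;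
      2 * μ₄ * μ₁₄, -(C (3 / 7) * μ₄ * μ₁₂), 4 * μ₁₄;
      0, 4 * μ₁₄, -(C (1 / 7) * μ₁₂)]] j

/-- The matrix `Γ_{2j}` of the action of `L_{2j}` on the first cohomology of the curve with
respect to the basis `ω₅, ω₃, ω₁, η₋₅, η₋₃, η₋₁`, see `IsGaussManin`. -/
def Γ (j : Fin 6) : Matrix (Fin 3 ⊕ Fin 3) (Fin 3 ⊕ Fin 3) (Params K) :=
  Matrix.fromBlocks (-β j) (α j) (-γ j) (β j).transpose

/-- The coefficients of row `j` of the Bezoutian `2 (f'(x) - f'(z)) / (x - z)` of `f'`: the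
coefficient of `z^(5 - j)`, as a polynomial in `x`. -/
def bezoutRow (j : Fin 6) : Fin 8 → Params K :=
  ![![14, 0, 0, 0, 0, 0, 0, 0], ![0, 14, 0, 0, 0, 0, 0, 0], ![10 * μ₄, 0, 14, 0, 0, 0, 0, 0],
    ![8 * μ₆, 10 * μ₄, 0, 14, 0, 0, 0, 0], ![6 * μ₈, 8 * μ₆, 10 * μ₄, 0, 14, 0, 0, 0],
    ![4 * μ₁₀, 6 * μ₈, 8 * μ₆, 10 * μ₄, 0, 14, 0, 0]] j

/-- `L_{2j}` maps `f` to the remainder modulo `f'` of the product of `f` with row `j` of the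
Bezoutian of `f'`. -/
def IsTangent (K : Type*) [Field K] (j : Fin 6) : Prop :=
  ∃ Q : Polynomial (Params K),
    xPoly (fun t => L j (curveCoeff (K := K) t)) =
      xPoly curveCoeff * xPoly (bezoutRow j) - Polynomial.derivative (xPoly curveCoeff) * Q

/-- The matrix `Γ_{2j}` represents the action of `L_{2j}` on the first cohomology.  As
`L_{2j} y = L_{2j} f / (2y)` for the extension of `L_{2j}` that kills `x`,
`L_{2j} (h dx / (2y)) = (2 f L_{2j} h - h L_{2j} f) dx / (4y³)`, while
`d (P / y) = (4 f P' - 2 P f') dx / (4y³)`; so the equation says that, for each of the forms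
`h_r dx / (2y)` of the basis, the form
`L_{2j} (h_r dx / (2y)) - ∑ₛ (Γ_{2j})_{rs} h_s dx / (2y)` is exact. -/
def IsGaussManin (K : Type*) [Field K] (j : Fin 6) : Prop :=
  ∀ r : Fin 3 ⊕ Fin 3, ∃ P : Polynomial (Params K),
    2 * xPoly curveCoeff * xPoly (fun t => L j (formCoeff (K := K) r t))
        - xPoly (formCoeff r) * xPoly (fun t => L j (curveCoeff (K := K) t)) =
      2 * xPoly curveCoeff * (∑ s, Polynomial.C (Γ j r s) * xPoly (formCoeff s))
        + (4 * xPoly curveCoeff * Polynomial.derivative P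
          - 2 * P * Polynomial.derivative (xPoly curveCoeff))

/-! ## The heat operators -/

/-- The ring `K[μ][[u₅, u₃, u₁]]`; the variables of index `0, 1, 2` are `u₅, u₃, u₁`. -/
abbrev Series (K : Type*) [Field K] : Type _ := MvPowerSeries (Fin 3) (Params K)

/-- The vector field `L_{2j}` acting on the coefficients of a power series in `u`. -/
def seriesL (j : Fin 6) : Series K →ₗ[K] Series K where
  toFun φ := fun d => L j (MvPowerSeries.coeff d φ)
  map_add' φ ψ := by
    funext d
    exact (congrArg (L j) (map_add (MvPowerSeries.coeff d) φ ψ)).trans (map_add (L j) _ _)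
  map_smul' c φ := by
    funext d
    exact (L j).map_smul c (MvPowerSeries.coeff d φ)

/-- The partial derivative `∂/∂u_i`, for `i = 0, 1, 2`, where `u_0, u_1, u_2` are
`u₅, u₃, u₁`. -/
abbrev D (i : Fin 3) (φ : Series K) : Series K := MvPowerSeries.pderiv (Params K) i φ

/-- The heat operator
`H_{2j} = ½ ᵗ(∂_u, u) (α β; ᵗβ γ) (∂_u, u) - ⅛ (L_{2j} Δ) / Δ`, that is,
`∑_{a,b} (½ α_{ab} ∂_a ∂_b + β_{ab} u_b ∂_a + ½ γ_{ab} u_a u_b) + ½ Tr β - ⅛ c_j`. -/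
def H (j : Fin 6) : Series K →ₗ[K] Series K where
  toFun φ :=
    (∑ a, ∑ b,
      (MvPowerSeries.C (C (1 / 2) * α j a b) * D a (D b φ)
        + MvPowerSeries.C (β j a b) * (MvPowerSeries.X b * D a φ)
        + MvPowerSeries.C (C (1 / 2) * γ j a b)
            * (MvPowerSeries.X a * (MvPowerSeries.X b * φ))))
      + MvPowerSeries.C (C (1 / 2) * (β j).trace - C (1 / 8) * discFactor j) * φ
  map_add' φ ψ := by
    simp only [map_add, mul_add, Finset.sum_add_distrib]
    abel
  map_smul' c φ := by
    have hD : ∀ (i : Fin 3) (ψ : Series K), D i (c • ψ) = c • D i ψ := by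
      intro i ψ
      rw [← algebraMap_smul (Params K) c ψ, ← algebraMap_smul (Params K) c (D i ψ)]
      exact (MvPowerSeries.pderiv (Params K) i).map_smul _ _
    simp only [hD, mul_smul_comm, ← smul_add, ← Finset.smul_sum, RingHom.id_apply]

/-- The operator `L_{2j} - H_{2j}`. -/
def heat (j : Fin 6) : Series K →ₗ[K] Series K := seriesL j - H j

variable (K) in
/-- The space of the solutions `φ ∈ K[μ][[u₅, u₃, u₁]]` of the system of heat equations
`(L_{2j} - H_{2j}) φ = 0`, `j = 0, …, 5`. -/
def solutionSpace : Submodule K (Series K) := ⨅ j, LinearMap.ker (heat j)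

/-! ## Hurwitz series -/

/-- The indices `(ℓ, m, n₄, n₆, n₈, n₁₀, n₁₂, n₁₄)` of the coefficients. -/
@[ext]
structure Idx where
  l : ℤ
  m : ℤ
  n4 : ℤ
  n6 : ℤ
  n8 : ℤ
  n10 : ℤ
  n12 : ℤ
  n14 : ℤ

/-- The `μ`-weight of an index. -/
def Idx.wt (I : Idx) : ℤ :=
  4 * I.n4 + 6 * I.n6 + 8 * I.n8 + 10 * I.n10 + 12 * I.n12 + 14 * I.n14

/-- The exponent `k` of `u₁` that belongs to an index. -/
def Idx.k (I : Idx) : ℤ := 6 - 5 * I.l - 3 * I.m + I.wt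

/-- All of `k, ℓ, m, n₄, …, n₁₄` are nonnegative. -/
def Idx.Nonneg (I : Idx) : Prop :=
  0 ≤ I.k ∧ 0 ≤ I.l ∧ 0 ≤ I.m ∧ 0 ≤ I.n4 ∧ 0 ≤ I.n6 ∧ 0 ≤ I.n8 ∧ 0 ≤ I.n10 ∧ 0 ≤ I.n12 ∧
    0 ≤ I.n14

/-- The index `(1, 0, …, 0)`. -/
def Idx.start : Idx := ⟨1, 0, 0, 0, 0, 0, 0, 0⟩

/-- The `μ`-weight of a monomial in the parameters. -/
def monWt (n : Fin 6 →₀ ℕ) : ℕ :=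
  4 * n 0 + 6 * n 1 + 8 * n 2 + 10 * n 3 + 12 * n 4 + 14 * n 5

/-- The index of the monomial with exponents `n` in `μ` and `d` in `u`. -/
def monIdx (d : Fin 3 →₀ ℕ) (n : Fin 6 →₀ ℕ) : Idx :=
  ⟨d 0, d 1, n 0, n 1, n 2, n 3, n 4, n 5⟩

/-- The Hurwitz series
`∑ b(ℓ, m, n₄, …, n₁₄) μ₄^n₄ ⋯ μ₁₄^n₁₄ (u₅^ℓ / ℓ!) (u₃^m / m!) (u₁^k / k!)`, the sum over all
nonnegative `ℓ, m, n₄, …, n₁₄` for which `k = 6 - 5ℓ - 3m + 4n₄ + ⋯ + 14n₁₄` is nonnegative, see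
`coeff_hurwitz`. -/
def hurwitz (b : Idx → K) : Series K := fun d =>
  ∑ n ∈ Finset.Icc 0 (Finsupp.equivFunOnFinite.symm fun _ => 5 * d 0 + 3 * d 1 + d 2),
    if 5 * d 0 + 3 * d 1 + d 2 = 6 + monWt n then
      MvPolynomial.monomial n
        (b (monIdx d n) / ((d 0).factorial * (d 1).factorial * (d 2).factorial))
    else 0

theorem coeff_hurwitz (b : Idx → K) (d : Fin 3 →₀ ℕ) (n : Fin 6 →₀ ℕ) :
    MvPolynomial.coeff n (MvPowerSeries.coeff d (hurwitz b)) =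
      if 5 * d 0 + 3 * d 1 + d 2 = 6 + monWt n then
        b (monIdx d n) / ((d 0).factorial * (d 1).factorial * (d 2).factorial)
      else 0 := by
  classical
  have h : MvPowerSeries.coeff d (hurwitz b) = hurwitz b d := rfl
  rw [h, hurwitz, MvPolynomial.coeff_sum]
  have h1 : ∀ x : Fin 6 →₀ ℕ, MvPolynomial.coeff n
      (if 5 * d 0 + 3 * d 1 + d 2 = 6 + monWt x then
        MvPolynomial.monomial x
          (b (monIdx d x) / ((d 0).factorial * (d 1).factorial * (d 2).factorial) : K)
      else 0) = if x = n then (if 5 * d 0 + 3 * d 1 + d 2 = 6 + monWt n then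
        b (monIdx d n) / ((d 0).factorial * (d 1).factorial * (d 2).factorial)
      else 0) else 0 := by
    intro x
    by_cases hx : x = n
    · subst hx
      rw [if_pos rfl]
      split_ifs
      · rw [MvPolynomial.coeff_monomial, if_pos rfl]
      · rw [MvPolynomial.coeff_zero]
    · rw [if_neg hx]
      split_ifs
      · rw [MvPolynomial.coeff_monomial, if_neg hx]
      · rw [MvPolynomial.coeff_zero]
  rw [Finset.sum_congr rfl fun x _ => h1 x, Finset.sum_ite_eq']
  by_cases h3 : 5 * d 0 + 3 * d 1 + d 2 = 6 + monWt n
  · have h2 : n ∈ Finset.Icc (0 : Fin 6 →₀ ℕ)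
        (Finsupp.equivFunOnFinite.symm fun _ => 5 * d 0 + 3 * d 1 + d 2) := by
      rw [Finset.mem_Icc]
      refine ⟨bot_le, fun i => ?_⟩
      change n i ≤ 5 * d 0 + 3 * d 1 + d 2
      rw [h3, monWt]
      fin_cases i <;> simp <;> omega
    rw [if_pos h2]
  · rw [if_neg h3, ite_self]

/-! ## The recurrences

In each of the definitions below, the recurrence at the index `I = (ℓ, m, n₄, …, n₁₄)` expresses
that the coefficient of `μ^n u₅^ℓ u₃^m u₁^κ` in the heat equation vanishes; `k` is the exponent
belonging to `I`. -/

/-- The lower weight terms of the recurrence `P₂`; here `κ = k - 2`. -/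
def low2 (b : Idx → K) (I : Idx) : K :=
  match I with
  | ⟨l, m, n4, n6, n8, n10, n12, n14⟩ =>
    let κ : ℤ := Idx.k ⟨l, m, n4, n6, n8, n10, n12, n14⟩ - 2
    (1 / 7) * (
      ((84 * (n4 + 1) : ℤ) : K) * b ⟨l, m, n4 + 1, n6 - 1, n8, n10, n12, n14⟩
      + ((112 * (n6 + 1) : ℤ) : K) * b ⟨l, m, n4, n6 + 1, n8 - 1, n10, n12, n14⟩
      + ((140 * (n8 + 1) : ℤ) : K) * b ⟨l, m, n4, n6, n8 + 1, n10 - 1, n12, n14⟩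
      + ((168 * (n10 + 1) : ℤ) : K) * b ⟨l, m, n4, n6, n8, n10 + 1, n12 - 1, n14⟩
      + ((196 * (n12 + 1) : ℤ) : K) * b ⟨l, m, n4, n6, n8, n10, n12 + 1, n14 - 1⟩
      - ((8 * (n14 + 1) : ℤ) : K) * b ⟨l, m, n4 - 1, n6, n8, n10, n12 - 1, n14 + 1⟩
      - ((16 * (n12 + 1) : ℤ) : K) * b ⟨l, m, n4 - 1, n6, n8, n10 - 1, n12 + 1, n14⟩
      - ((24 * (n10 + 1) : ℤ) : K) * b ⟨l, m, n4 - 1, n6, n8 - 1, n10 + 1, n12, n14⟩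
      - ((32 * (n8 + 1) : ℤ) : K) * b ⟨l, m, n4 - 1, n6 - 1, n8 + 1, n10, n12, n14⟩
      - ((40 * (n6 + 1) : ℤ) : K) * b ⟨l, m, n4 - 2, n6 + 1, n8, n10, n12, n14⟩
      + ((5 * κ * (κ - 1) : ℤ) : K) * b ⟨l, m, n4 - 1, n6, n8, n10, n12, n14⟩
      + ((16 * m : ℤ) : K) * b ⟨l, m - 1, n4 - 1, n6, n8, n10, n12, n14⟩
      + ((8 * l : ℤ) : K) * b ⟨l - 1, m + 1, n4 - 1, n6, n8, n10, n12, n14⟩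
      - ((21 * m * (m - 1) : ℤ) : K) * b ⟨l, m - 2, n4, n6, n8 - 1, n10, n12, n14⟩
      + ((8 * m * (m - 1) : ℤ) : K) * b ⟨l, m - 2, n4 - 2, n6, n8, n10, n12, n14⟩
      - ((35 * l * (l - 1) : ℤ) : K) * b ⟨l - 2, m, n4, n6, n8, n10, n12 - 1, n14⟩
      + ((4 * l * (l - 1) : ℤ) : K) * b ⟨l - 2, m, n4 - 1, n6, n8 - 1, n10, n12, n14⟩)

/-- The lower weight terms of the recurrence `P₄`; here `κ = k - 4`. -/
def low4 (b : Idx → K) (I : Idx) : K :=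
  match I with
  | ⟨l, m, n4, n6, n8, n10, n12, n14⟩ =>
    let κ : ℤ := Idx.k ⟨l, m, n4, n6, n8, n10, n12, n14⟩ - 4
    (1 / 7) * (
      ((56 * (n4 + 1) : ℤ) : K) * b ⟨l, m, n4 + 1, n6, n8 - 1, n10, n12, n14⟩
      + ((70 * (n6 + 1) : ℤ) : K) * b ⟨l, m, n4, n6 + 1, n8, n10 - 1, n12, n14⟩
      + ((84 * (n8 + 1) : ℤ) : K) * b ⟨l, m, n4, n6, n8 + 1, n10, n12 - 1, n14⟩
      + ((98 * (n10 + 1) : ℤ) : K) * b ⟨l, m, n4, n6, n8, n10 + 1, n12, n14 - 1⟩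
      - ((6 * (n14 + 1) : ℤ) : K) * b ⟨l, m, n4, n6 - 1, n8, n10, n12 - 1, n14 + 1⟩
      - ((12 * (n12 + 1) : ℤ) : K) * b ⟨l, m, n4, n6 - 1, n8, n10 - 1, n12 + 1, n14⟩
      - ((18 * (n10 + 1) : ℤ) : K) * b ⟨l, m, n4, n6 - 1, n8 - 1, n10 + 1, n12, n14⟩
      - ((24 * (n8 + 1) : ℤ) : K) * b ⟨l, m, n4, n6 - 2, n8 + 1, n10, n12, n14⟩
      + (((-21 * l - 7 * m - 16 * n6 + 28 * n8 + 42 * n10 + 56 * n12 + 70 * n14 + 21) : ℤ) : K) * b ⟨l, m, n4 - 1, n6, n8, n10, n12, n14⟩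
      + ((2 * κ * (κ - 1) : ℤ) : K) * b ⟨l, m, n4, n6 - 1, n8, n10, n12, n14⟩
      + ((12 * m : ℤ) : K) * b ⟨l, m - 1, n4, n6 - 1, n8, n10, n12, n14⟩
      + ((6 * l : ℤ) : K) * b ⟨l - 1, m + 1, n4, n6 - 1, n8, n10, n12, n14⟩
      - ((7 * m * κ : ℤ) : K) * b ⟨l, m - 1, n4, n6, n8 - 1, n10, n12, n14⟩
      - ((21 * m * (m - 1) : ℤ) : K) * b ⟨l, m - 2, n4, n6, n8, n10 - 1, n12, n14⟩
      + ((6 * m * (m - 1) : ℤ) : K) * b ⟨l, m - 2, n4 - 1, n6 - 1, n8, n10, n12, n14⟩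
      - ((21 * l * m : ℤ) : K) * b ⟨l - 1, m - 1, n4, n6, n8, n10, n12 - 1, n14⟩
      - ((35 * l * (l - 1) : ℤ) : K) * b ⟨l - 2, m, n4, n6, n8, n10, n12, n14 - 1⟩
      + ((3 * l * (l - 1) : ℤ) : K) * b ⟨l - 2, m, n4, n6 - 1, n8 - 1, n10, n12, n14⟩)

/-- The lower weight terms of the recurrence `P₆`; here `κ = k - 6`. -/
def low6 (b : Idx → K) (I : Idx) : K :=
  match I with
  | ⟨l, m, n4, n6, n8, n10, n12, n14⟩ =>
    let κ : ℤ := Idx.k ⟨l, m, n4, n6, n8, n10, n12, n14⟩ - 6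
    (1 / 7) * (
      - ((14 * m : ℤ) : K) * b ⟨l + 1, m - 1, n4 - 1, n6, n8, n10, n12, n14⟩
      + ((140 * (n4 + 1) : ℤ) : K) * b ⟨l, m, n4 + 1, n6, n8, n10 - 1, n12, n14⟩
      + ((168 * (n6 + 1) : ℤ) : K) * b ⟨l, m, n4, n6 + 1, n8, n10, n12 - 1, n14⟩
      + ((196 * (n8 + 1) : ℤ) : K) * b ⟨l, m, n4, n6, n8 + 1, n10, n12, n14 - 1⟩
      - ((16 * (n14 + 1) : ℤ) : K) * b ⟨l, m, n4, n6, n8 - 1, n10, n12 - 1, n14 + 1⟩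
      - ((32 * (n12 + 1) : ℤ) : K) * b ⟨l, m, n4, n6, n8 - 1, n10 - 1, n12 + 1, n14⟩
      - ((48 * (n10 + 1) : ℤ) : K) * b ⟨l, m, n4, n6, n8 - 2, n10 + 1, n12, n14⟩
      + (((-28 * l - 36 * n8 + 56 * n10 + 84 * n12 + 112 * n14 + 28) : ℤ) : K) * b ⟨l, m, n4, n6 - 1, n8, n10, n12, n14⟩
      - ((24 * (n6 + 1) : ℤ) : K) * b ⟨l, m, n4 - 1, n6 + 1, n8 - 1, n10, n12, n14⟩
      + ((84 * (n8 + 1) : ℤ) : K) * b ⟨l, m, n4 - 1, n6, n8 + 1, n10 - 1, n12, n14⟩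
      + ((112 * (n10 + 1) : ℤ) : K) * b ⟨l, m, n4 - 1, n6, n8, n10 + 1, n12 - 1, n14⟩
      + ((140 * (n12 + 1) : ℤ) : K) * b ⟨l, m, n4 - 1, n6, n8, n10, n12 + 1, n14 - 1⟩
      + ((3 * κ * (κ - 1) : ℤ) : K) * b ⟨l, m, n4, n6, n8 - 1, n10, n12, n14⟩
      + ((18 * m : ℤ) : K) * b ⟨l, m - 1, n4, n6, n8 - 1, n10, n12, n14⟩
      + ((16 * l : ℤ) : K) * b ⟨l - 1, m + 1, n4, n6, n8 - 1, n10, n12, n14⟩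
      - ((28 * m * κ : ℤ) : K) * b ⟨l, m - 1, n4, n6, n8, n10 - 1, n12, n14⟩
      - ((63 * m * (m - 1) : ℤ) : K) * b ⟨l, m - 2, n4, n6, n8, n10, n12 - 1, n14⟩
      + ((9 * m * (m - 1) : ℤ) : K) * b ⟨l, m - 2, n4 - 1, n6, n8 - 1, n10, n12, n14⟩
      - ((14 * l * κ : ℤ) : K) * b ⟨l - 1, m, n4, n6, n8, n10, n12 - 1, n14⟩
      - ((84 * l * m : ℤ) : K) * b ⟨l - 1, m - 1, n4, n6, n8, n10, n12, n14 - 1⟩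
      + ((8 * l * (l - 1) : ℤ) : K) * b ⟨l - 2, m, n4, n6, n8 - 2, n10, n12, n14⟩
      - ((21 * l * (l - 1) : ℤ) : K) * b ⟨l - 2, m, n4 - 1, n6, n8, n10, n12 - 1, n14⟩)

/-- The lower weight terms of the recurrence `P₈`; here `κ = k - 8`. -/
def low8 (b : Idx → K) (I : Idx) : K :=
  match I with
  | ⟨l, m, n4, n6, n8, n10, n12, n14⟩ =>
    let κ : ℤ := Idx.k ⟨l, m, n4, n6, n8, n10, n12, n14⟩ - 8
    (1 / 7) * (
      ((84 * (n4 + 1) : ℤ) : K) * b ⟨l, m, n4 + 1, n6, n8, n10, n12 - 1, n14⟩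
      + ((98 * (n6 + 1) : ℤ) : K) * b ⟨l, m, n4, n6 + 1, n8, n10, n12, n14 - 1⟩
      - ((10 * (n14 + 1) : ℤ) : K) * b ⟨l, m, n4, n6, n8, n10 - 1, n12 - 1, n14 + 1⟩
      - ((20 * (n12 + 1) : ℤ) : K) * b ⟨l, m, n4, n6, n8, n10 - 2, n12 + 1, n14⟩
      + (((-7 * l - 16 * n10 + 28 * n12 + 42 * n14 + 7) : ℤ) : K) * b ⟨l, m, n4, n6, n8 - 1, n10, n12, n14⟩
      - ((12 * (n8 + 1) : ℤ) : K) * b ⟨l, m, n4, n6 - 1, n8 + 1, n10 - 1, n12, n14⟩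
      + ((42 * (n10 + 1) : ℤ) : K) * b ⟨l, m, n4, n6 - 1, n8, n10 + 1, n12 - 1, n14⟩
      + ((56 * (n12 + 1) : ℤ) : K) * b ⟨l, m, n4, n6 - 1, n8, n10, n12 + 1, n14 - 1⟩
      - ((8 * (n6 + 1) : ℤ) : K) * b ⟨l, m, n4 - 1, n6 + 1, n8, n10 - 1, n12, n14⟩
      + ((56 * (n8 + 1) : ℤ) : K) * b ⟨l, m, n4 - 1, n6, n8 + 1, n10, n12 - 1, n14⟩
      + ((70 * (n10 + 1) : ℤ) : K) * b ⟨l, m, n4 - 1, n6, n8, n10 + 1, n12, n14 - 1⟩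
      + ((κ * (κ - 1) : ℤ) : K) * b ⟨l, m, n4, n6, n8, n10 - 1, n12, n14⟩
      + ((6 * m : ℤ) : K) * b ⟨l, m - 1, n4, n6, n8, n10 - 1, n12, n14⟩
      + ((10 * l : ℤ) : K) * b ⟨l - 1, m + 1, n4, n6, n8, n10 - 1, n12, n14⟩
      - ((21 * m * κ : ℤ) : K) * b ⟨l, m - 1, n4, n6, n8, n10, n12 - 1, n14⟩
      - ((7 * l : ℤ) : K) * b ⟨l - 1, m, n4, n6, n8, n10, n12 - 1, n14⟩
      - ((42 * m * (m - 1) : ℤ) : K) * b ⟨l, m - 2, n4, n6, n8, n10, n12, n14 - 1⟩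
      + ((3 * m * (m - 1) : ℤ) : K) * b ⟨l, m - 2, n4 - 1, n6, n8, n10 - 1, n12, n14⟩
      - ((14 * l * κ : ℤ) : K) * b ⟨l - 1, m, n4, n6, n8, n10, n12, n14 - 1⟩
      - ((7 * l * m : ℤ) : K) * b ⟨l - 1, m - 1, n4 - 1, n6, n8, n10, n12 - 1, n14⟩
      + ((5 * l * (l - 1) : ℤ) : K) * b ⟨l - 2, m, n4, n6, n8 - 1, n10 - 1, n12, n14⟩
      - ((7 * l * (l - 1) : ℤ) : K) * b ⟨l - 2, m, n4, n6 - 1, n8, n10, n12 - 1, n14⟩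
      - ((21 * l * (l - 1) : ℤ) : K) * b ⟨l - 2, m, n4 - 1, n6, n8, n10, n12, n14 - 1⟩)

/-- The lower weight terms of the recurrence `P₁₀`; here `κ = k - 10`. -/
def low10 (b : Idx → K) (I : Idx) : K :=
  match I with
  | ⟨l, m, n4, n6, n8, n10, n12, n14⟩ =>
    let κ : ℤ := Idx.k ⟨l, m, n4, n6, n8, n10, n12, n14⟩ - 10
    (1 / 7) * (
      ((196 * (n4 + 1) : ℤ) : K) * b ⟨l, m, n4 + 1, n6, n8, n10, n12, n14 - 1⟩
      - ((24 * (n14 + 1) : ℤ) : K) * b ⟨l, m, n4, n6, n8, n10, n12 - 2, n14 + 1⟩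
      + (((-20 * n12 + 56 * n14 + 7) : ℤ) : K) * b ⟨l, m, n4, n6, n8, n10 - 1, n12, n14⟩
      - ((16 * (n10 + 1) : ℤ) : K) * b ⟨l, m, n4, n6, n8 - 1, n10 + 1, n12 - 1, n14⟩
      + ((84 * (n12 + 1) : ℤ) : K) * b ⟨l, m, n4, n6, n8 - 1, n10, n12 + 1, n14 - 1⟩
      - ((12 * (n8 + 1) : ℤ) : K) * b ⟨l, m, n4, n6 - 1, n8 + 1, n10, n12 - 1, n14⟩
      + ((112 * (n10 + 1) : ℤ) : K) * b ⟨l, m, n4, n6 - 1, n8, n10 + 1, n12, n14 - 1⟩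
      - ((8 * (n6 + 1) : ℤ) : K) * b ⟨l, m, n4 - 1, n6 + 1, n8, n10, n12 - 1, n14⟩
      + ((140 * (n8 + 1) : ℤ) : K) * b ⟨l, m, n4 - 1, n6, n8 + 1, n10, n12, n14 - 1⟩
      + ((κ * (κ - 1) : ℤ) : K) * b ⟨l, m, n4, n6, n8, n10, n12 - 1, n14⟩
      + ((6 * m : ℤ) : K) * b ⟨l, m - 1, n4, n6, n8, n10, n12 - 1, n14⟩
      + ((10 * l : ℤ) : K) * b ⟨l - 1, m + 1, n4, n6, n8, n10, n12 - 1, n14⟩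
      - ((56 * m * κ : ℤ) : K) * b ⟨l, m - 1, n4, n6, n8, n10, n12, n14 - 1⟩
      - ((28 * l : ℤ) : K) * b ⟨l - 1, m, n4, n6, n8, n10, n12, n14 - 1⟩
      + ((3 * m * (m - 1) : ℤ) : K) * b ⟨l, m - 2, n4 - 1, n6, n8, n10, n12 - 1, n14⟩
      - ((28 * l * m : ℤ) : K) * b ⟨l - 1, m - 1, n4 - 1, n6, n8, n10, n12, n14 - 1⟩
      + ((5 * l * (l - 1) : ℤ) : K) * b ⟨l - 2, m, n4, n6, n8 - 1, n10, n12 - 1, n14⟩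
      - ((28 * l * (l - 1) : ℤ) : K) * b ⟨l - 2, m, n4, n6 - 1, n8, n10, n12, n14 - 1⟩)

/-- Translation of an index in the directions `ℓ` and `m`. -/
def Idx.shift (I : Idx) (dl dm : ℤ) : Idx := { I with l := I.l + dl, m := I.m + dm }

/-- The recurrence `P₂`:
`b(ℓ, m, n) = 2 (2 - k) b(ℓ, m + 1, n) - 6 m b(ℓ + 1, m - 1, n) + lower weight terms`. -/
def P2 (b : Idx → K) (I : Idx) : Prop :=
  b I = ((2 * (2 - I.k) : ℤ) : K) * b (I.shift 0 1) - ((6 * I.m : ℤ) : K) * b (I.shift 1 (-1))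
    + low2 b I

/-- The recurrence `P₄`:
`b(ℓ, m + 1, n) = - (k' - 1) b(ℓ + 1, m, n) + lower weight terms`, where `k'` is the exponent of
`u₁` belonging to the left hand side. -/
def P4 (b : Idx → K) (I : Idx) : Prop :=
  b (I.shift 0 1) = -((((I.shift 0 1).k - 1 : ℤ) : K) * b (I.shift 1 0)) + low4 b I

/-- The recurrence `P₆`: `b(ℓ, m + 2, n) + 2 b(ℓ + 1, m, n) = lower weight terms`. -/
def P6 (b : Idx → K) (I : Idx) : Prop := b (I.shift 0 2) + 2 * b (I.shift 1 0) = low6 b I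

/-- The recurrence `P₈`: `b(ℓ + 1, m + 1, n) = lower weight terms`. -/
def P8 (b : Idx → K) (I : Idx) : Prop := b (I.shift 1 1) = low8 b I

/-- The recurrence `P₁₀`: `b(ℓ + 2, m, n) = lower weight terms`. -/
def P10 (b : Idx → K) (I : Idx) : Prop := b (I.shift 2 0) = low10 b I

/-! ## The recursion schemes -/

/-- The right hand side of `P₂`, solved for `b(ℓ, m, n)`. -/
def rhs2 (b : Idx → K) (I : Idx) : K :=
  ((2 * (2 - I.k) : ℤ) : K) * b (I.shift 0 1) - ((6 * I.m : ℤ) : K) * b (I.shift 1 (-1))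
    + low2 b I

/-- The right hand side of `P₄`, solved for `b(ℓ, m, n)`. -/
def rhs4 (b : Idx → K) (I : Idx) : K :=
  -(((I.k - 1 : ℤ) : K) * b (I.shift 1 (-1))) + low4 b (I.shift 0 (-1))

/-- The right hand side of `P₆` solved for `b(ℓ, m, n)` through its first term:
`b(ℓ, m, n) = - 2 b(ℓ + 1, m - 2, n) + lower weight terms`. -/
def rhs6a (b : Idx → K) (I : Idx) : K :=
  -(2 * b (I.shift 1 (-2))) + low6 b (I.shift 0 (-2))

/-- The right hand side of `P₆` solved for `b(ℓ, m, n)` through its second term: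
`2 b(ℓ, m, n) = - b(ℓ - 1, m + 2, n) + lower weight terms`. -/
def rhs6b (b : Idx → K) (I : Idx) : K :=
  (1 / 2) * (-b (I.shift (-1) 2) + low6 b (I.shift (-1) 0))

/-- The right hand side of `P₈`, solved for `b(ℓ, m, n)`. -/
def rhs8 (b : Idx → K) (I : Idx) : K := low8 b (I.shift (-1) (-1))

/-- The right hand side of `P₁₀`, solved for `b(ℓ, m, n)`. -/
def rhs10 (b : Idx → K) (I : Idx) : K := low10 b (I.shift (-2) 0)

/-- The choice of a recurrence by the first recursion scheme. -/
def rule1 (b : Idx → K) (I : Idx) : K :=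
  if 1 < I.k then rhs2 b I
  else if I.k = 1 ∧ 0 < I.m then rhs4 b I
  else if I.k = 0 ∧ 1 < I.m then rhs6a b I
  else if I.k = 0 ∧ I.m = 1 then rhs8 b I
  else rhs10 b I

/-- The choice of a recurrence by the second recursion scheme. -/
def rule2 (b : Idx → K) (I : Idx) : K :=
  if 1 < I.l then rhs10 b I
  else if I.l = 1 ∧ 0 < I.m then rhs8 b I
  else if I.l = 1 then rhs6b b I
  else if 0 < I.m ∧ 0 < I.k then rhs4 b I
  else if 0 < I.m then rhs6a b I
  else rhs2 b I

open Classical in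
/-- The family `b` obeys the recursion scheme with the given rule: it vanishes where one of
`k, ℓ, m, n₄, …, n₁₄` is negative, it is normalised by `b(1, 0, …, 0) = 1`, and every other value
is given by the rule. -/
def Scheme (rule : (Idx → K) → Idx → K) (b : Idx → K) : Prop :=
  ∀ I : Idx, b I = if ¬ I.Nonneg then 0 else if I = Idx.start then 1 else rule b I

open Classical in
/-- The coefficient of `b(J)` in the linear form `F(b)(I)` in the family `b`. -/
def coeffAt (F : (Idx → K) → Idx → K) (I J : Idx) : K := F (fun I' => if I' = J then 1 else 0) I

/-- One step of a recursion scheme: the rule computes `b(I)` from values among which `b(J)` occurs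
with a nonzero coefficient. -/
def Step (rule : (Idx → K) → Idx → K) (I J : Idx) : Prop :=
  I.Nonneg ∧ I ≠ Idx.start ∧ J.Nonneg ∧ coeffAt rule I J ≠ 0

end

end HyperellipticSigma

open HyperellipticSigma

/-!
The curve varies over the space of the parameters `μ`. The vector fields `L_{2j}` are tangent to the
discriminant because row `j` of the Bezoutian times `f` differs from `L_{2j} f` by an explicit
multiple `f' Q_j` of `f'`; the same quotient `Q_j` gives the primitives of the exact forms by which
`L_{2j} (h dx / 2y)` reduces to the symplectic basis (`isTangent`, `isGaussManin`).

For the heat equations, a power series is described by its Hurwitz coefficients, with integral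
exponents and the value zero at negative ones. Multiplication by a parameter or a variable and the
partial derivatives act on these coefficients by shifts, so that the operators `L_{2j} - H_{2j}`
become difference operators (`hc_heat_zero`, …, `hc_heat_five`). The operator with `j = 0`
multiplies each monomial by its weight plus `6`; hence its kernel consists of the Hurwitz series
`σ_b`. On such a series the other five operators produce the defects of the recurrences `P₂, …,
P₁₀`.

The two recursion schemes are well-founded, since a step that does not lower the `μ`-weight lowers a
potential, `pot1` or `pot2` (`chain_wt`). So each scheme has exactly one solution, and any solution
of all of the recurrences is determined by its value at the start: the space of solutions has
dimension at most one (`eq_smul_of_rule`, `schemes_of_recurrences`).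

The substance is the existence of a common solution. Let `b` be the solution of the first scheme,
and let `R_j = (L_{2j} - H_{2j}) σ_b` be the defects. Then `R_0` vanishes, the scheme makes `R_1`
vanish, and in `R_2, …, R_5` only certain coefficients of low degree in `u₃` and `u₁`. The rest
follows from the relations `[L_{2i} - H_{2i}, L_{2j} - H_{2j}] = ∑ₖ c_{ijk} (L_{2k} - H_{2k})`
(`heat_commutator`). They hold because `H_{2j}` is a quadratic expression in the operators `∂/∂u_a`,
`u_a` whose matrix multiplied by the symplectic form is `Γ_{2j}`, so that they reduce to the
corresponding relations between the vector fields, the factors `c_j` and the matrices `Γ_{2j}`.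
Applied to `σ_b`, they are linear relations between the `R_j`. One shows by induction on the
`μ`-weight that all coefficients of the `R_j` vanish: if those of lower weight do, then in weight
`w` the relations involve only the parts of the `H_{2j}` with constant coefficients and the
constants among the `c_{ijk}`, and the resulting system `LeadingConditions`, together with the
coefficients known to vanish, admits only zero up to four coefficients
(`LeadingConditions.eq_zero`). These four occur in the weights `2`, `4`, `6` and `8` only, where
there is no monomial, respectively where a few values of `b` are to be computed (`initial_values`).
Thus `b` satisfies all of the recurrences (`recurrences_of_rule1`).
-/

namespace HyperellipticSigma

noncomputable section

variable {K : Type*} [Field K]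

open MvPolynomial (C)

set_option linter.unusedSimpArgs false

/-! ### The vector fields on the parameter space and on cohomology -/

theorem L_X (j i : Fin 6) : L j (MvPolynomial.X i : Params K) = V j i :=
  MvPolynomial.mkDerivation_X ..

theorem L_C (j : Fin 6) (a : K) : L j (C a : Params K) = 0 :=
  MvPolynomial.derivation_C ..

theorem L_ofNat (j : Fin 6) (n : ℕ) [n.AtLeastTwo] : L j (ofNat(n) : Params K) = 0 := by
  exact_mod_cast (L j).map_natCast n

/-- The quotient of the product of `f` with row `j` of the Bezoutian by `f'`. -/
def bezoutQuot (j : Fin 6) : Fin 8 → Params K :=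
  ![![0, 2, 0, 0, 0, 0, 0, 0],
    ![C (4 / 7) * μ₄, 0, 2, 0, 0, 0, 0, 0],
    ![C (6 / 7) * μ₆, 2 * μ₄, 0, 2, 0, 0, 0, 0],
    ![C (8 / 7) * μ₈, 2 * μ₆, 2 * μ₄, 0, 2, 0, 0, 0],
    ![C (10 / 7) * μ₁₀, 2 * μ₈, 2 * μ₆, 2 * μ₄, 0, 2, 0, 0],
    ![C (12 / 7) * μ₁₂, 2 * μ₁₀, 2 * μ₈, 2 * μ₆, 2 * μ₄, 0, 2, 0]] j

/-- The polynomials `T` for which `P = f T - ½ h Q`, with `Q` the quotient `bezoutQuot`, is the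
numerator of the exact form `d (P / y)` in the reduction of `L_{2j} (h dx / (2y))`. -/
def exactCoeff (j : Fin 6) : Fin 3 ⊕ Fin 3 → Fin 8 → Params K :=
  ![Sum.elim ![0, 0, 0] ![0, 0, 0],
    Sum.elim ![0, 0, 0] ![![5, 0, 0, 0, 0, 0, 0, 0], 0, 0],
    Sum.elim ![0, 0, 0] ![![0, 5, 0, 0, 0, 0, 0, 0], ![3, 0, 0, 0, 0, 0, 0, 0], 0],
    Sum.elim ![0, 0, 0] ![![3 * μ₄, 0, 5, 0, 0, 0, 0, 0], ![0, 3, 0, 0, 0, 0, 0, 0],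
      ![1, 0, 0, 0, 0, 0, 0, 0]],
    Sum.elim ![0, 0, ![1, 0, 0, 0, 0, 0, 0, 0]]
      ![![2 * μ₆, 3 * μ₄, 0, 5, 0, 0, 0, 0], ![μ₄, 0, 3, 0, 0, 0, 0, 0],
        ![0, 1, 0, 0, 0, 0, 0, 0]],
    Sum.elim ![0, ![1, 0, 0, 0, 0, 0, 0, 0], ![0, 1, 0, 0, 0, 0, 0, 0]]
      ![![μ₈, 2 * μ₆, 3 * μ₄, 0, 5, 0, 0, 0], ![0, μ₄, 0, 3, 0, 0, 0, 0],
        ![0, 0, 1, 0, 0, 0, 0, 0]]] j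

theorem params_funext [CharZero K] {p q : Params K}
    (h : ∀ x : Fin 6 → K, MvPolynomial.eval x p = MvPolynomial.eval x q) : p = q :=
  MvPolynomial.funext h

/-- Polynomial identities are checked at the points of `K`: there the constants `C a` become
rational numbers, which `ring` can handle. -/
theorem params_polynomial_funext [CharZero K] {p q : Polynomial (Params K)}
    (h : ∀ (r : Params K) (x : Fin 6 → K),
      MvPolynomial.eval x (p.eval r) = MvPolynomial.eval x (q.eval r)) : p = q := by
  have : Infinite (Params K) := inferInstance
  exact Polynomial.funext fun r => params_funext (h r)

theorem eval_xPoly (c : Fin 8 → Params K) (r : Params K) :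
    (xPoly c).eval r = ∑ i, c i * r ^ (i : ℕ) := by
  simp [xPoly, Polynomial.eval_finsetSum]

theorem eval_derivative_xPoly (c : Fin 8 → Params K) (r : Params K) :
    (Polynomial.derivative (xPoly c)).eval r =
      ∑ i : Fin 7, c i.succ * ((i : ℕ) + 1) * r ^ (i : ℕ) := by
  simp [xPoly, Fin.sum_univ_succ]
  ring

/-- `L_{2j} f` is the remainder of the product of `f` with row `j` of the Bezoutian modulo `f'`. -/
theorem xPoly_L_curveCoeff [CharZero K] (j : Fin 6) :
    xPoly (fun t => L j (curveCoeff (K := K) t)) =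
      xPoly curveCoeff * xPoly (bezoutRow j)
        - Polynomial.derivative (xPoly curveCoeff) * xPoly (bezoutQuot j) := by
  refine params_polynomial_funext fun r x => ?_
  simp only [Polynomial.eval_sub, Polynomial.eval_mul, eval_xPoly, eval_derivative_xPoly]
  fin_cases j <;>
  · simp [Fin.sum_univ_succ, curveCoeff, bezoutRow, bezoutQuot, L_X, V]
    ring

theorem isTangent [CharZero K] (j : Fin 6) : IsTangent K j :=
  ⟨xPoly (bezoutQuot j), xPoly_L_curveCoeff j⟩

set_option maxHeartbeats 4000000 in
/-- The equation of `IsGaussManin` for `P = f T - ½ h Q`, after division by `f`; the terms with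
`h f' Q` cancel by `xPoly_L_curveCoeff`. -/
theorem reduced_gaussManin [CharZero K] (j : Fin 6) (r : Fin 3 ⊕ Fin 3) :
    2 * xPoly (fun t => L j (formCoeff (K := K) r t)) - xPoly (formCoeff r) * xPoly (bezoutRow j) =
      2 * (∑ s, Polynomial.C (Γ j r s) * xPoly (formCoeff s))
        + 2 * Polynomial.derivative (xPoly curveCoeff) * xPoly (exactCoeff j r)
        + 4 * xPoly curveCoeff * Polynomial.derivative (xPoly (exactCoeff j r))
        - 2 * (Polynomial.derivative (xPoly (formCoeff r)) * xPoly (bezoutQuot j)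
          + xPoly (formCoeff r) * Polynomial.derivative (xPoly (bezoutQuot j))) := by
  refine params_polynomial_funext fun t x => ?_
  simp only [Polynomial.eval_add, Polynomial.eval_ofNat, Polynomial.eval_C,
    Fintype.sum_sum_type, Fin.sum_univ_three, Polynomial.eval_sub, Polynomial.eval_mul,
    eval_xPoly, eval_derivative_xPoly]
  fin_cases j <;> rcases r with r | r <;> fin_cases r <;>
  · simp only [Fin.zero_eta, Fin.mk_one, Fin.reduceFinMk, Fin.sum_univ_eight,
      Fin.sum_univ_seven, formCoeff, exactCoeff, Γ, Sum.elim_inl, Sum.elim_inr,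
      Matrix.fromBlocks_apply₁₁, Matrix.fromBlocks_apply₁₂, Matrix.fromBlocks_apply₂₁,
      Matrix.fromBlocks_apply₂₂, Matrix.neg_apply, Matrix.transpose_apply, Matrix.cons_val,
      Pi.zero_apply, mul_zero, zero_mul, add_zero, zero_add, Fin.succ_zero_eq_one,
      Fin.reduceSucc, one_mul]
    try simp only [curveCoeff, bezoutRow, bezoutQuot, α, β, γ, Matrix.cons_val, Matrix.of_apply,
      Derivation.leibniz, L_X, L_ofNat, Derivation.map_zero, Derivation.map_one_eq_zero,
      smul_eq_mul, mul_zero, zero_mul, add_zero, zero_add]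
    try simp only [V, Matrix.of_apply, Matrix.cons_val]
    try simp only [RingHom.map_mul, RingHom.map_add, RingHom.map_sub, RingHom.map_neg,
      RingHom.map_zero, RingHom.map_one, RingHom.map_pow, map_ofNat,
      MvPolynomial.eval_X, MvPolynomial.eval_C, Fin.coe_ofNat_eq_mod, Nat.reduceMod,
      Nat.cast_ofNat, Nat.cast_zero, Nat.cast_one]
    try ring

theorem isGaussManin [CharZero K] (j : Fin 6) : IsGaussManin K j := by
  intro r
  refine ⟨xPoly curveCoeff * xPoly (exactCoeff j r)
    - Polynomial.C (C (1 / 2)) * xPoly (formCoeff r) * xPoly (bezoutQuot j), ?_⟩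
  have h2 : (2 : Polynomial (Params K)) * Polynomial.C (C (1 / 2)) = 1 := by
    rw [← Polynomial.C_ofNat, ← Polynomial.C_mul, ← map_ofNat (C (σ := Fin 6) (R := K)) 2,
      ← C.map_mul]
    norm_num
  simp only [Polynomial.derivative_sub, Polynomial.derivative_mul, Polynomial.derivative_C]
  linear_combination (xPoly curveCoeff) * reduced_gaussManin (K := K) j r
    - xPoly (formCoeff r) * xPoly_L_curveCoeff (K := K) j
    - (xPoly (formCoeff r) * xPoly (bezoutQuot j) * Polynomial.derivative (xPoly curveCoeff)
      - 2 * xPoly curveCoeff * (Polynomial.derivative (xPoly (formCoeff r)) * xPoly (bezoutQuot j)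
          + xPoly (formCoeff r) * Polynomial.derivative (xPoly (bezoutQuot j)))) * h2

/-! ### Hurwitz coefficients -/

/-- The vector of exponents with the given integers as entries, negative ones replaced by `0`. -/
def natExp {r : ℕ} (d : Fin r → ℤ) : Fin r →₀ ℕ :=
  Finsupp.equivFunOnFinite.symm fun i => (d i).toNat

@[simp] theorem natExp_apply {r : ℕ} (d : Fin r → ℤ) (i : Fin r) : natExp d i = (d i).toNat := rfl

theorem natExp_add_single {r : ℕ} (d : Fin r → ℤ) (i : Fin r) (h : 0 ≤ d i) :
    natExp (d + Pi.single i 1) = natExp d + Finsupp.single i 1 := by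
  ext j
  by_cases hj : j = i
  · subst hj; simp; omega
  · simp [hj]

theorem prod_factorial_add_single {r : ℕ} (d : Fin r → ℤ) (i : Fin r) (h : 0 ≤ d i) :
    ∏ j, ((natExp (d + Pi.single i 1) j).factorial : K) =
      ((d i + 1 : ℤ) : K) * ∏ j, ((natExp d j).factorial : K) := by
  classical
  have h1 : ∀ j, ((natExp (d + Pi.single i 1) j).factorial : K) =
      (if j = i then ((d i + 1 : ℤ) : K) else 1) * ((natExp d j).factorial : K) := by
    intro j
    rw [natExp_add_single d i h]
    by_cases hj : j = i
    · subst hj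
      have h2 : ((d j : ℤ) : K) = ((natExp d j : ℕ) : K) := by
        rw [← Int.cast_natCast, natExp_apply, Int.toNat_of_nonneg h]
      rw [if_pos rfl, Int.cast_add, h2]
      simp [Nat.factorial_succ]
    · simp [hj]
  rw [Finset.prod_congr rfl fun j _ => h1 j, Finset.prod_mul_distrib]
  simp

open Classical in
/-- The coefficient of `μ^n u^d / d!` in a power series, for integral exponents; it vanishes if
one of the exponents is negative. -/
def hcoeff (φ : Series K) (d : Fin 3 → ℤ) (n : Fin 6 → ℤ) : K :=
  if 0 ≤ d ∧ 0 ≤ n then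
    (∏ i, ((natExp d i).factorial : K)) *
      MvPolynomial.coeff (natExp n) (MvPowerSeries.coeff (natExp d) φ)
  else 0

theorem hcoeff_of_nonneg (φ : Series K) {d : Fin 3 → ℤ} {n : Fin 6 → ℤ} (h : 0 ≤ d ∧ 0 ≤ n) :
    hcoeff φ d n = (∏ i, ((natExp d i).factorial : K)) *
      MvPolynomial.coeff (natExp n) (MvPowerSeries.coeff (natExp d) φ) := if_pos h

theorem hcoeff_of_not_nonneg (φ : Series K) {d : Fin 3 → ℤ} {n : Fin 6 → ℤ}
    (h : ¬ (0 ≤ d ∧ 0 ≤ n)) : hcoeff φ d n = 0 := if_neg h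

theorem hcoeff_add (φ ψ : Series K) (d n) :
    hcoeff (φ + ψ) d n = hcoeff φ d n + hcoeff ψ d n := by
  unfold hcoeff; split_ifs <;> simp [mul_add]

theorem hcoeff_neg (φ : Series K) (d n) : hcoeff (-φ) d n = -hcoeff φ d n := by
  unfold hcoeff; split_ifs <;> simp

theorem hcoeff_sub (φ ψ : Series K) (d n) :
    hcoeff (φ - ψ) d n = hcoeff φ d n - hcoeff ψ d n := by
  rw [sub_eq_add_neg, hcoeff_add, hcoeff_neg, sub_eq_add_neg]

theorem hcoeff_zero (d n) : hcoeff (0 : Series K) d n = 0 := by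
  unfold hcoeff; split_ifs <;> simp

theorem hcoeff_C_mul (a : K) (φ : Series K) (d n) :
    hcoeff (MvPowerSeries.C (C a) * φ) d n = a * hcoeff φ d n := by
  unfold hcoeff
  split_ifs
  · rw [MvPowerSeries.coeff_C_mul, MvPolynomial.coeff_C_mul]; ring
  · simp

theorem eq_zero_of_hcoeff [CharZero K] {φ : Series K}
    (h : ∀ d n, 0 ≤ d → 0 ≤ n → hcoeff φ d n = 0) : φ = 0 := by
  ext d n
  have h1 := h (fun i => d i) (fun i => n i) (fun i => by simp) (fun i => by simp)
  rw [hcoeff_of_nonneg _ ⟨fun i => by simp, fun i => by simp⟩] at h1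
  have hd : natExp (fun i => (d i : ℤ)) = d := by ext i; simp
  have hn : natExp (fun i => (n i : ℤ)) = n := by ext i; simp
  rw [hd, hn] at h1
  rcases mul_eq_zero.mp h1 with h2 | h2
  · exact absurd h2 (Finset.prod_ne_zero_iff.mpr fun i _ => by
      exact_mod_cast Nat.factorial_ne_zero _)
  · simpa using h2

/-- Multiplication by a parameter shifts the Hurwitz coefficients. -/
theorem hcoeff_param_mul (i : Fin 6) (φ : Series K) (d n) :
    hcoeff (MvPowerSeries.C (MvPolynomial.X i) * φ) d n = hcoeff φ d (n - Pi.single i 1) := by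
  classical
  by_cases hd : 0 ≤ d
  swap
  · rw [hcoeff_of_not_nonneg _ (fun h => hd h.1), hcoeff_of_not_nonneg _ (fun h => hd h.1)]
  by_cases hn' : 0 ≤ n - Pi.single i 1
  · have hn : 0 ≤ n := fun j => by
      have := hn' j
      have h2 : (0 : ℤ) ≤ Pi.single (M := fun _ => ℤ) i 1 j := by
        by_cases h : j = i
        · subst h; simp
        · simp [h]
      simp only [Pi.zero_apply, Pi.sub_apply] at this ⊢
      omega
    rw [hcoeff_of_nonneg _ ⟨hd, hn⟩, hcoeff_of_nonneg _ ⟨hd, hn'⟩, MvPowerSeries.coeff_C_mul]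
    congr 1
    have : natExp n = Finsupp.single i 1 + natExp (n - Pi.single i 1) := by
      ext j
      have := hn' j
      by_cases h : j = i
      · subst h; simp at this ⊢; omega
      · simp [h]
    rw [this, MvPolynomial.coeff_X_mul]
  · rw [hcoeff_of_not_nonneg _ (fun h => hn' h.2)]
    by_cases hn : 0 ≤ n
    · rw [hcoeff_of_nonneg _ ⟨hd, hn⟩, MvPowerSeries.coeff_C_mul, MvPolynomial.coeff_X_mul', if_neg,
        mul_zero]
      intro h
      apply hn'
      intro j
      have := hn j
      by_cases h' : j = i
      · subst h'; simp at this h ⊢; omega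
      · simpa [h'] using this
    · rw [hcoeff_of_not_nonneg _ (fun h => hn h.2)]

/-- Multiplication by a variable; at `d i = 0` the factor `d i` vanishes. -/
theorem hcoeff_X_mul (i : Fin 3) (φ : Series K) (d n) :
    hcoeff (MvPowerSeries.X i * φ) d n = (d i : K) * hcoeff φ (d - Pi.single i 1) n := by
  classical
  by_cases hn : 0 ≤ n
  swap
  · rw [hcoeff_of_not_nonneg _ (fun h => hn h.2), hcoeff_of_not_nonneg _ (fun h => hn h.2),
      mul_zero]
  by_cases hd' : 0 ≤ d - Pi.single i 1
  · have hd : 0 ≤ d := fun j => by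
      have := hd' j
      have h2 : (0 : ℤ) ≤ Pi.single (M := fun _ => ℤ) i 1 j := by
        by_cases h : j = i
        · subst h; simp
        · simp [h]
      simp only [Pi.zero_apply, Pi.sub_apply] at this ⊢
      omega
    rw [hcoeff_of_nonneg _ ⟨hd, hn⟩, hcoeff_of_nonneg _ ⟨hd', hn⟩]
    have hi : 0 ≤ (d - Pi.single i 1 : Fin 3 → ℤ) i := hd' i
    have h0 : d = d - Pi.single i 1 + Pi.single i 1 := (sub_add_cancel _ _).symm
    have h1 : natExp d = Finsupp.single i 1 + natExp (d - Pi.single i 1) := by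
      rw [add_comm, ← natExp_add_single _ i hi, ← h0]
    have h2 : MvPowerSeries.coeff (natExp d) (MvPowerSeries.X i * φ) =
        MvPowerSeries.coeff (natExp (d - Pi.single i 1)) φ := by
      rw [h1, MvPowerSeries.X, MvPowerSeries.coeff_add_monomial_mul, one_mul]
    have h3 : ∏ j, ((natExp d j).factorial : K) =
        d i * ∏ j, ((natExp (d - Pi.single i 1) j).factorial : K) := by
      have := prod_factorial_add_single (K := K) (d - Pi.single i 1) i hi
      rw [← h0] at this
      simpa using this
    rw [h2, h3]; ring
  · rw [hcoeff_of_not_nonneg φ (fun h => hd' h.1), mul_zero]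
    by_cases hd : 0 ≤ d
    · have h0 : d i = 0 := by
        by_contra h
        apply hd'
        intro j
        have := hd j
        by_cases h' : j = i
        · subst h'; simp at this ⊢; omega
        · simpa [h'] using this
      rw [hcoeff_of_nonneg _ ⟨hd, hn⟩]
      have : MvPowerSeries.coeff (natExp d) (MvPowerSeries.X i * φ) = 0 := by
        rw [mul_comm, MvPowerSeries.X, MvPowerSeries.coeff_mul_monomial, if_neg]
        intro h
        have := h i
        simp [h0] at this
      rw [this]; simp
    · rw [hcoeff_of_not_nonneg _ (fun h => hd h.1)]

/-- The derivative with respect to a variable shifts the Hurwitz coefficients. The exponent has to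
be nonnegative: for `d i = -1` the right hand side is a coefficient at `u_i ^ 0`. -/
theorem hcoeff_D (i : Fin 3) (φ : Series K) {d : Fin 3 → ℤ} (n) (hi : 0 ≤ d i) :
    hcoeff (D i φ) d n = hcoeff φ (d + Pi.single i 1) n := by
  classical
  by_cases hn : 0 ≤ n
  swap
  · rw [hcoeff_of_not_nonneg _ (fun h => hn h.2), hcoeff_of_not_nonneg _ (fun h => hn h.2)]
  have hiff : 0 ≤ d + Pi.single i 1 ↔ 0 ≤ d := by
    constructor <;> intro h j <;> have := h j <;> by_cases h' : j = i
    · subst h'; exact hi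
    · simpa [h'] using this
    · subst h'; simp; omega
    · simpa [h'] using this
  by_cases hd : 0 ≤ d
  · rw [hcoeff_of_nonneg _ ⟨hd, hn⟩, hcoeff_of_nonneg _ ⟨hiff.mpr hd, hn⟩,
      MvPowerSeries.coeff_pderiv]
    have h2 : ((d i : ℤ) : K) = ((natExp d i : ℕ) : K) := by
      rw [← Int.cast_natCast, natExp_apply, Int.toNat_of_nonneg hi]
    rw [prod_factorial_add_single d i hi, natExp_add_single d i hi, Int.cast_add, h2]
    have h5 : ((natExp d i : Params K) + 1) = C ((natExp d i + 1 : ℕ) : K) := by simp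
    rw [h5, mul_comm (MvPowerSeries.coeff _ φ), MvPolynomial.coeff_C_mul]
    push_cast; ring
  · rw [hcoeff_of_not_nonneg _ (fun h => hd h.1),
      hcoeff_of_not_nonneg _ (fun h => hd (hiff.mp h.1))]

/-- The first order operators `u_b ∂_a`. This holds for all `d b`, since the factor `d b` makes up
for the case `a = b`, `d b = 0`, where `hcoeff_D` does not apply. -/
theorem hcoeff_X_mul_D (a b : Fin 3) (φ : Series K) {d : Fin 3 → ℤ} (n) (ha : 0 ≤ d a) :
    hcoeff (MvPowerSeries.X b * D a φ) d n =
      (d b : K) * hcoeff φ (d - Pi.single b 1 + Pi.single a 1) n := by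
  rw [hcoeff_X_mul]
  by_cases h : 0 ≤ (d - Pi.single b 1 : Fin 3 → ℤ) a
  · rw [hcoeff_D a φ n h]
  · have : a = b := by
      by_contra hab
      exact h (by simp [hab, ha])
    subst this
    have h0 : d a = 0 := by simp at h; omega
    simp [h0]

/-- The derivative with respect to a parameter, applied to the coefficients of a power series. -/
def paramD (i : Fin 6) (φ : Series K) : Series K :=
  fun d => MvPolynomial.pderiv i (MvPowerSeries.coeff d φ)

/-- At `n i = -1`, where the left hand side is zero by convention, the factor `n i + 1` vanishes;
so no condition on `n` is needed. -/
theorem hcoeff_paramD (i : Fin 6) (φ : Series K) (d n) :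
    hcoeff (paramD i φ) d n = ((n i + 1 : ℤ) : K) * hcoeff φ d (n + Pi.single i 1) := by
  classical
  by_cases hd : 0 ≤ d
  swap
  · rw [hcoeff_of_not_nonneg _ (fun h => hd h.1), hcoeff_of_not_nonneg _ (fun h => hd h.1),
      mul_zero]
  by_cases hn : 0 ≤ n
  · have hn' : 0 ≤ n + Pi.single i 1 := fun j => by
      have := hn j
      by_cases h : j = i
      · subst h; simp at this ⊢; omega
      · simpa [h] using this
    rw [hcoeff_of_nonneg _ ⟨hd, hn⟩, hcoeff_of_nonneg _ ⟨hd, hn'⟩]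
    have h0 : MvPowerSeries.coeff (natExp d) (paramD i φ) =
      MvPolynomial.pderiv i (MvPowerSeries.coeff (natExp d) φ) := rfl
    have h2 : ((n i + 1 : ℤ) : K) = (natExp n i : K) + 1 := by
      have := hn i
      rw [← Int.cast_natCast, natExp_apply, Int.toNat_of_nonneg this]
      push_cast; ring
    rw [h0, natExp_add_single n i (hn i), h2, MvPolynomial.coeff_pderiv]
    ring
  · rw [hcoeff_of_not_nonneg _ (fun h => hn h.2)]
    by_cases hn' : 0 ≤ n + Pi.single i 1
    · have : n i + 1 = 0 := by
        by_contra h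
        apply hn
        intro j
        have := hn' j
        by_cases h' : j = i
        · subst h'; simp at this ⊢; omega
        · simpa [h'] using this
      rw [this]; simp
    · rw [hcoeff_of_not_nonneg _ (fun h => hn' h.2), mul_zero]

theorem L_eq_sum (j : Fin 6) (p : Params K) :
    L j p = ∑ i, (V : Matrix (Fin 6) (Fin 6) (Params K)) j i * MvPolynomial.pderiv i p := by
  have h : L (K := K) j = ∑ i, (V : Matrix (Fin 6) (Fin 6) (Params K)) j i •
      MvPolynomial.pderiv (R := K) i := by
    refine MvPolynomial.derivation_ext fun i => (L_X (K := K) j i).trans ?_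
    simp only [Fin.sum_univ_six, Derivation.add_apply, Derivation.smul_apply,
      MvPolynomial.pderiv_X, smul_eq_mul]
    fin_cases i <;> simp
  rw [h]
  simp [Fin.sum_univ_six]

theorem seriesL_eq_sum (j : Fin 6) (φ : Series K) :
    seriesL j φ =
      ∑ i, MvPowerSeries.C ((V : Matrix (Fin 6) (Fin 6) (Params K)) j i) * paramD i φ := by
  refine MvPowerSeries.ext fun d => ?_
  rw [map_sum]
  simp only [MvPowerSeries.coeff_C_mul]
  exact L_eq_sum j _

/-! ### The heat operators in terms of Hurwitz coefficients -/

theorem C_add_mul (p q : Params K) (φ : Series K) : MvPowerSeries.C (p + q) * φ =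
    MvPowerSeries.C p * φ + MvPowerSeries.C q * φ := by rw [map_add, add_mul]
theorem C_sub_mul (p q : Params K) (φ : Series K) : MvPowerSeries.C (p - q) * φ =
    MvPowerSeries.C p * φ - MvPowerSeries.C q * φ := by rw [map_sub, sub_mul]
theorem C_neg_mul (p : Params K) (φ : Series K) : MvPowerSeries.C (-p) * φ =
    -(MvPowerSeries.C p * φ) := by rw [map_neg, neg_mul]
theorem C_mul_mul (p q : Params K) (φ : Series K) : MvPowerSeries.C (p * q) * φ =
    MvPowerSeries.C p * (MvPowerSeries.C q * φ) := by rw [map_mul, mul_assoc]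
theorem C_sq_mul (p : Params K) (φ : Series K) : MvPowerSeries.C (p ^ 2) * φ =
    MvPowerSeries.C p * (MvPowerSeries.C p * φ) := by rw [sq, C_mul_mul]

theorem sub_single_param (n4 n6 n8 n10 n12 n14 a : ℤ) :
    ![n4, n6, n8, n10, n12, n14] - Pi.single 0 a = ![n4 - a, n6, n8, n10, n12, n14] ∧
    ![n4, n6, n8, n10, n12, n14] - Pi.single 1 a = ![n4, n6 - a, n8, n10, n12, n14] ∧
    ![n4, n6, n8, n10, n12, n14] - Pi.single 2 a = ![n4, n6, n8 - a, n10, n12, n14] ∧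
    ![n4, n6, n8, n10, n12, n14] - Pi.single 3 a = ![n4, n6, n8, n10 - a, n12, n14] ∧
    ![n4, n6, n8, n10, n12, n14] - Pi.single 4 a = ![n4, n6, n8, n10, n12 - a, n14] ∧
    ![n4, n6, n8, n10, n12, n14] - Pi.single 5 a = ![n4, n6, n8, n10, n12, n14 - a] := by
  refine ⟨?_, ?_, ?_, ?_, ?_, ?_⟩ <;> · ext i; fin_cases i <;> simp

theorem add_single_param (n4 n6 n8 n10 n12 n14 a : ℤ) :
    ![n4, n6, n8, n10, n12, n14] + Pi.single 0 a = ![n4 + a, n6, n8, n10, n12, n14] ∧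
    ![n4, n6, n8, n10, n12, n14] + Pi.single 1 a = ![n4, n6 + a, n8, n10, n12, n14] ∧
    ![n4, n6, n8, n10, n12, n14] + Pi.single 2 a = ![n4, n6, n8 + a, n10, n12, n14] ∧
    ![n4, n6, n8, n10, n12, n14] + Pi.single 3 a = ![n4, n6, n8, n10 + a, n12, n14] ∧
    ![n4, n6, n8, n10, n12, n14] + Pi.single 4 a = ![n4, n6, n8, n10, n12 + a, n14] ∧
    ![n4, n6, n8, n10, n12, n14] + Pi.single 5 a = ![n4, n6, n8, n10, n12, n14 + a] := by
  refine ⟨?_, ?_, ?_, ?_, ?_, ?_⟩ <;> · ext i; fin_cases i <;> simp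

theorem sub_single_var (l m k a : ℤ) : ![l, m, k] - Pi.single 0 a = ![l - a, m, k] ∧
    ![l, m, k] - Pi.single 1 a = ![l, m - a, k] ∧
    ![l, m, k] - Pi.single 2 a = ![l, m, k - a] := by
  refine ⟨?_, ?_, ?_⟩ <;> · ext i; fin_cases i <;> simp

theorem add_single_var (l m k a : ℤ) : ![l, m, k] + Pi.single 0 a = ![l + a, m, k] ∧
    ![l, m, k] + Pi.single 1 a = ![l, m + a, k] ∧
    ![l, m, k] + Pi.single 2 a = ![l, m, k + a] := by
  refine ⟨?_, ?_, ?_⟩ <;> · ext i; fin_cases i <;> simp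

theorem hcoeff_D_D (a b : Fin 3) (φ : Series K) {d : Fin 3 → ℤ} (n) (hd : 0 ≤ d) :
    hcoeff (D a (D b φ)) d n = hcoeff φ (d + Pi.single a 1 + Pi.single b 1) n := by
  rw [hcoeff_D a _ n (hd a), hcoeff_D b]
  have := hd b
  by_cases h : b = a
  · subst h; simp at this ⊢; omega
  · simpa [h] using this

/-- `hcoeff` with all exponents written out: the coefficient of
`μ₄ ^ n4 ⋯ μ₁₄ ^ n14 (u₅ ^ l / l!) (u₃ ^ m / m!) (u₁ ^ k / k!)`. With this form, the rules for the
basic operators become rewriting rules, by which `simp` expands the heat operators. -/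
def hc (φ : Series K) (l m k n4 n6 n8 n10 n12 n14 : ℤ) : K :=
  hcoeff φ ![l, m, k] ![n4, n6, n8, n10, n12, n14]

section rules

variable (φ ψ : Series K) (l m k n4 n6 n8 n10 n12 n14 : ℤ)

@[simp] theorem hc_add : hc (φ + ψ) l m k n4 n6 n8 n10 n12 n14 =
    hc φ l m k n4 n6 n8 n10 n12 n14 + hc ψ l m k n4 n6 n8 n10 n12 n14 := hcoeff_add ..

@[simp] theorem hc_sub : hc (φ - ψ) l m k n4 n6 n8 n10 n12 n14 =
    hc φ l m k n4 n6 n8 n10 n12 n14 - hc ψ l m k n4 n6 n8 n10 n12 n14 := hcoeff_sub ..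

@[simp] theorem hc_neg : hc (-φ) l m k n4 n6 n8 n10 n12 n14 = -hc φ l m k n4 n6 n8 n10 n12 n14 :=
  hcoeff_neg ..

@[simp] theorem hc_zero : hc (0 : Series K) l m k n4 n6 n8 n10 n12 n14 = 0 := hcoeff_zero ..

@[simp] theorem hc_C_mul (a : K) : hc (MvPowerSeries.C (C a) * φ) l m k n4 n6 n8 n10 n12 n14 =
    a * hc φ l m k n4 n6 n8 n10 n12 n14 := hcoeff_C_mul ..

@[simp] theorem hc_ofNat_mul (a : ℕ) [a.AtLeastTwo] :
    hc (MvPowerSeries.C (ofNat(a) : Params K) * φ) l m k n4 n6 n8 n10 n12 n14 =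
      ofNat(a) * hc φ l m k n4 n6 n8 n10 n12 n14 := by
  have : (ofNat(a) : Params K) = C (ofNat(a) : K) := (map_ofNat C a).symm
  rw [this, hc_C_mul]

@[simp] theorem hc_param_mul_0 :
    hc (MvPowerSeries.C (MvPolynomial.X 0) * φ) l m k n4 n6 n8 n10 n12 n14 =
      hc φ l m k (n4 - 1) n6 n8 n10 n12 n14 := by
  rw [hc, hcoeff_param_mul, (sub_single_param n4 n6 n8 n10 n12 n14 1).1, ← hc]

@[simp] theorem hc_paramD_0 : hc (paramD 0 φ) l m k n4 n6 n8 n10 n12 n14 =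
    (n4 + 1) * hc φ l m k (n4 + 1) n6 n8 n10 n12 n14 := by
  rw [hc, hcoeff_paramD, (add_single_param n4 n6 n8 n10 n12 n14 1).1, ← hc]
  push_cast
  rfl

@[simp] theorem hc_param_mul_1 :
    hc (MvPowerSeries.C (MvPolynomial.X 1) * φ) l m k n4 n6 n8 n10 n12 n14 =
      hc φ l m k n4 (n6 - 1) n8 n10 n12 n14 := by
  rw [hc, hcoeff_param_mul, (sub_single_param n4 n6 n8 n10 n12 n14 1).2.1, ← hc]

@[simp] theorem hc_paramD_1 : hc (paramD 1 φ) l m k n4 n6 n8 n10 n12 n14 =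
    (n6 + 1) * hc φ l m k n4 (n6 + 1) n8 n10 n12 n14 := by
  rw [hc, hcoeff_paramD, (add_single_param n4 n6 n8 n10 n12 n14 1).2.1, ← hc]
  push_cast
  rfl

@[simp] theorem hc_param_mul_2 :
    hc (MvPowerSeries.C (MvPolynomial.X 2) * φ) l m k n4 n6 n8 n10 n12 n14 =
      hc φ l m k n4 n6 (n8 - 1) n10 n12 n14 := by
  rw [hc, hcoeff_param_mul, (sub_single_param n4 n6 n8 n10 n12 n14 1).2.2.1, ← hc]

@[simp] theorem hc_paramD_2 : hc (paramD 2 φ) l m k n4 n6 n8 n10 n12 n14 =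
    (n8 + 1) * hc φ l m k n4 n6 (n8 + 1) n10 n12 n14 := by
  rw [hc, hcoeff_paramD, (add_single_param n4 n6 n8 n10 n12 n14 1).2.2.1, ← hc]
  push_cast
  rfl

@[simp] theorem hc_param_mul_3 :
    hc (MvPowerSeries.C (MvPolynomial.X 3) * φ) l m k n4 n6 n8 n10 n12 n14 =
      hc φ l m k n4 n6 n8 (n10 - 1) n12 n14 := by
  rw [hc, hcoeff_param_mul, (sub_single_param n4 n6 n8 n10 n12 n14 1).2.2.2.1, ← hc]

@[simp] theorem hc_paramD_3 : hc (paramD 3 φ) l m k n4 n6 n8 n10 n12 n14 =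
    (n10 + 1) * hc φ l m k n4 n6 n8 (n10 + 1) n12 n14 := by
  rw [hc, hcoeff_paramD, (add_single_param n4 n6 n8 n10 n12 n14 1).2.2.2.1, ← hc]
  push_cast
  rfl

@[simp] theorem hc_param_mul_4 :
    hc (MvPowerSeries.C (MvPolynomial.X 4) * φ) l m k n4 n6 n8 n10 n12 n14 =
      hc φ l m k n4 n6 n8 n10 (n12 - 1) n14 := by
  rw [hc, hcoeff_param_mul, (sub_single_param n4 n6 n8 n10 n12 n14 1).2.2.2.2.1, ← hc]

@[simp] theorem hc_paramD_4 : hc (paramD 4 φ) l m k n4 n6 n8 n10 n12 n14 =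
    (n12 + 1) * hc φ l m k n4 n6 n8 n10 (n12 + 1) n14 := by
  rw [hc, hcoeff_paramD, (add_single_param n4 n6 n8 n10 n12 n14 1).2.2.2.2.1, ← hc]
  push_cast
  rfl

@[simp] theorem hc_param_mul_5 :
    hc (MvPowerSeries.C (MvPolynomial.X 5) * φ) l m k n4 n6 n8 n10 n12 n14 =
      hc φ l m k n4 n6 n8 n10 n12 (n14 - 1) := by
  rw [hc, hcoeff_param_mul, (sub_single_param n4 n6 n8 n10 n12 n14 1).2.2.2.2.2, ← hc]

@[simp] theorem hc_paramD_5 : hc (paramD 5 φ) l m k n4 n6 n8 n10 n12 n14 =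
    (n14 + 1) * hc φ l m k n4 n6 n8 n10 n12 (n14 + 1) := by
  rw [hc, hcoeff_paramD, (add_single_param n4 n6 n8 n10 n12 n14 1).2.2.2.2.2, ← hc]
  push_cast
  rfl

theorem hc_X_mul_0 : hc (MvPowerSeries.X 0 * φ) l m k n4 n6 n8 n10 n12 n14 =
    l * hc φ (l - 1) m k n4 n6 n8 n10 n12 n14 := by
  rw [hc, hcoeff_X_mul, (sub_single_var l m k 1).1, ← hc]
  rfl

theorem hc_X_mul_1 : hc (MvPowerSeries.X 1 * φ) l m k n4 n6 n8 n10 n12 n14 =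
    m * hc φ l (m - 1) k n4 n6 n8 n10 n12 n14 := by
  rw [hc, hcoeff_X_mul, (sub_single_var l m k 1).2.1, ← hc]
  rfl

theorem hc_X_mul_2 : hc (MvPowerSeries.X 2 * φ) l m k n4 n6 n8 n10 n12 n14 =
    k * hc φ l m (k - 1) n4 n6 n8 n10 n12 n14 := by
  rw [hc, hcoeff_X_mul, (sub_single_var l m k 1).2.2, ← hc]
  rfl

end rules

section nonneg

variable (φ : Series K) {l m k : ℤ} (n4 n6 n8 n10 n12 n14 : ℤ)

@[simp] theorem hc_X_mul_D_0_0 (hl : 0 ≤ l) :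
    hc (MvPowerSeries.X 0 * D 0 φ) l m k n4 n6 n8 n10 n12 n14 =
      l * hc φ l m k n4 n6 n8 n10 n12 n14 := by
  rw [hc, hcoeff_X_mul_D 0 0 φ _ hl, (sub_single_var l m k 1).1, (add_single_var _ _ _ 1).1, ← hc]
  rw [sub_add_cancel]; rfl

@[simp] theorem hc_X_mul_D_1_0 (hl : 0 ≤ l) :
    hc (MvPowerSeries.X 1 * D 0 φ) l m k n4 n6 n8 n10 n12 n14 =
      m * hc φ (l + 1) (m - 1) k n4 n6 n8 n10 n12 n14 := by
  rw [hc, hcoeff_X_mul_D 0 1 φ _ hl, (sub_single_var l m k 1).2.1, (add_single_var _ _ _ 1).1, ← hc]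
  rfl

@[simp] theorem hc_X_mul_D_2_0 (hl : 0 ≤ l) :
    hc (MvPowerSeries.X 2 * D 0 φ) l m k n4 n6 n8 n10 n12 n14 =
      k * hc φ (l + 1) m (k - 1) n4 n6 n8 n10 n12 n14 := by
  rw [hc, hcoeff_X_mul_D 0 2 φ _ hl, (sub_single_var l m k 1).2.2, (add_single_var _ _ _ 1).1, ← hc]
  rfl

@[simp] theorem hc_X_mul_D_0_1 (hm : 0 ≤ m) :
    hc (MvPowerSeries.X 0 * D 1 φ) l m k n4 n6 n8 n10 n12 n14 =
      l * hc φ (l - 1) (m + 1) k n4 n6 n8 n10 n12 n14 := by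
  rw [hc, hcoeff_X_mul_D 1 0 φ _ hm, (sub_single_var l m k 1).1, (add_single_var _ _ _ 1).2.1, ← hc]
  rfl

@[simp] theorem hc_X_mul_D_1_1 (hm : 0 ≤ m) :
    hc (MvPowerSeries.X 1 * D 1 φ) l m k n4 n6 n8 n10 n12 n14 =
      m * hc φ l m k n4 n6 n8 n10 n12 n14 := by
  rw [hc, hcoeff_X_mul_D 1 1 φ _ hm, (sub_single_var l m k 1).2.1, (add_single_var _ _ _ 1).2.1,
    ← hc]
  rw [sub_add_cancel]; rfl

@[simp] theorem hc_X_mul_D_2_1 (hm : 0 ≤ m) :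
    hc (MvPowerSeries.X 2 * D 1 φ) l m k n4 n6 n8 n10 n12 n14 =
      k * hc φ l (m + 1) (k - 1) n4 n6 n8 n10 n12 n14 := by
  rw [hc, hcoeff_X_mul_D 1 2 φ _ hm, (sub_single_var l m k 1).2.2, (add_single_var _ _ _ 1).2.1,
    ← hc]
  rfl

@[simp] theorem hc_X_mul_D_0_2 (hk : 0 ≤ k) :
    hc (MvPowerSeries.X 0 * D 2 φ) l m k n4 n6 n8 n10 n12 n14 =
      l * hc φ (l - 1) m (k + 1) n4 n6 n8 n10 n12 n14 := by
  rw [hc, hcoeff_X_mul_D 2 0 φ _ hk, (sub_single_var l m k 1).1, (add_single_var _ _ _ 1).2.2, ← hc]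
  rfl

@[simp] theorem hc_X_mul_D_1_2 (hk : 0 ≤ k) :
    hc (MvPowerSeries.X 1 * D 2 φ) l m k n4 n6 n8 n10 n12 n14 =
      m * hc φ l (m - 1) (k + 1) n4 n6 n8 n10 n12 n14 := by
  rw [hc, hcoeff_X_mul_D 2 1 φ _ hk, (sub_single_var l m k 1).2.1, (add_single_var _ _ _ 1).2.2,
    ← hc]
  rfl

@[simp] theorem hc_X_mul_D_2_2 (hk : 0 ≤ k) :
    hc (MvPowerSeries.X 2 * D 2 φ) l m k n4 n6 n8 n10 n12 n14 =
      k * hc φ l m k n4 n6 n8 n10 n12 n14 := by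
  rw [hc, hcoeff_X_mul_D 2 2 φ _ hk, (sub_single_var l m k 1).2.2, (add_single_var _ _ _ 1).2.2,
    ← hc]
  rw [sub_add_cancel]; rfl

@[simp] theorem hc_D_D_0_0 (hd : 0 ≤ ![l, m, k]) :
    hc (D 0 (D 0 φ)) l m k n4 n6 n8 n10 n12 n14 = hc φ ((l + 1) + 1) m k n4 n6 n8 n10 n12 n14 := by
  rw [hc, hcoeff_D_D 0 0 φ _ hd, (add_single_var l m k 1).1, (add_single_var _ _ _ 1).1, ← hc]

@[simp] theorem hc_D_D_0_1 (hd : 0 ≤ ![l, m, k]) :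
    hc (D 0 (D 1 φ)) l m k n4 n6 n8 n10 n12 n14 = hc φ (l + 1) (m + 1) k n4 n6 n8 n10 n12 n14 := by
  rw [hc, hcoeff_D_D 0 1 φ _ hd, (add_single_var l m k 1).1, (add_single_var _ _ _ 1).2.1, ← hc]

@[simp] theorem hc_D_D_0_2 (hd : 0 ≤ ![l, m, k]) :
    hc (D 0 (D 2 φ)) l m k n4 n6 n8 n10 n12 n14 = hc φ (l + 1) m (k + 1) n4 n6 n8 n10 n12 n14 := by
  rw [hc, hcoeff_D_D 0 2 φ _ hd, (add_single_var l m k 1).1, (add_single_var _ _ _ 1).2.2, ← hc]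

@[simp] theorem hc_D_D_1_0 (hd : 0 ≤ ![l, m, k]) :
    hc (D 1 (D 0 φ)) l m k n4 n6 n8 n10 n12 n14 = hc φ (l + 1) (m + 1) k n4 n6 n8 n10 n12 n14 := by
  rw [hc, hcoeff_D_D 1 0 φ _ hd, (add_single_var l m k 1).2.1, (add_single_var _ _ _ 1).1, ← hc]

@[simp] theorem hc_D_D_1_1 (hd : 0 ≤ ![l, m, k]) :
    hc (D 1 (D 1 φ)) l m k n4 n6 n8 n10 n12 n14 = hc φ l ((m + 1) + 1) k n4 n6 n8 n10 n12 n14 := by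
  rw [hc, hcoeff_D_D 1 1 φ _ hd, (add_single_var l m k 1).2.1, (add_single_var _ _ _ 1).2.1, ← hc]

@[simp] theorem hc_D_D_1_2 (hd : 0 ≤ ![l, m, k]) :
    hc (D 1 (D 2 φ)) l m k n4 n6 n8 n10 n12 n14 = hc φ l (m + 1) (k + 1) n4 n6 n8 n10 n12 n14 := by
  rw [hc, hcoeff_D_D 1 2 φ _ hd, (add_single_var l m k 1).2.1, (add_single_var _ _ _ 1).2.2, ← hc]

@[simp] theorem hc_D_D_2_0 (hd : 0 ≤ ![l, m, k]) :
    hc (D 2 (D 0 φ)) l m k n4 n6 n8 n10 n12 n14 = hc φ (l + 1) m (k + 1) n4 n6 n8 n10 n12 n14 := by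
  rw [hc, hcoeff_D_D 2 0 φ _ hd, (add_single_var l m k 1).2.2, (add_single_var _ _ _ 1).1, ← hc]

@[simp] theorem hc_D_D_2_1 (hd : 0 ≤ ![l, m, k]) :
    hc (D 2 (D 1 φ)) l m k n4 n6 n8 n10 n12 n14 = hc φ l (m + 1) (k + 1) n4 n6 n8 n10 n12 n14 := by
  rw [hc, hcoeff_D_D 2 1 φ _ hd, (add_single_var l m k 1).2.2, (add_single_var _ _ _ 1).2.1, ← hc]

@[simp] theorem hc_D_D_2_2 (hd : 0 ≤ ![l, m, k]) :
    hc (D 2 (D 2 φ)) l m k n4 n6 n8 n10 n12 n14 = hc φ l m ((k + 1) + 1) n4 n6 n8 n10 n12 n14 := by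
  rw [hc, hcoeff_D_D 2 2 φ _ hd, (add_single_var l m k 1).2.2, (add_single_var _ _ _ 1).2.2, ← hc]

end nonneg

theorem heat_eq (j : Fin 6) (φ : Series K) : heat j φ =
    ∑ i, MvPowerSeries.C ((V : Matrix (Fin 6) (Fin 6) (Params K)) j i) * paramD i φ - ((∑ a, ∑ b,
      (MvPowerSeries.C (C (1 / 2) * α j a b) * D a (D b φ)
        + MvPowerSeries.C (β j a b) * (MvPowerSeries.X b * D a φ)
        + MvPowerSeries.C (C (1 / 2) * γ j a b)
            * (MvPowerSeries.X a * (MvPowerSeries.X b * φ))))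
      + MvPowerSeries.C (C (1 / 2) * (β j).trace - C (1 / 8) * discFactor j) * φ) := by
  rw [← seriesL_eq_sum]; rfl

/-- With weights `i` for `μ_i` and `-5, -3, -1` for `u₅, u₃, u₁`, the operator `L₀ - H₀` multiplies
each monomial by its weight plus `6`. -/
theorem hc_heat_zero [CharZero K] (φ : Series K) {l m k : ℤ} (hl : 0 ≤ l) (hm : 0 ≤ m) (hk : 0 ≤ k)
    (n4 n6 n8 n10 n12 n14 : ℤ) :
    hc (heat 0 φ) l m k n4 n6 n8 n10 n12 n14 =
      ((6 + 4 * n4 + 6 * n6 + 8 * n8 + 10 * n10 + 12 * n12 + 14 * n14 - 5 * l - 3 * m - k : ℤ) : K)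
        * hc φ l m k n4 n6 n8 n10 n12 n14 := by
  have hd : (0 : Fin 3 → ℤ) ≤ ![l, m, k] := fun i => by fin_cases i <;> assumption
  rw [heat_eq]
  simp only [Fin.sum_univ_six, Fin.sum_univ_three, hc_sub, hc_add]
  simp [-map_mul, -map_add, -map_sub, -map_neg, -map_pow, -neg_mul, V, α, β, γ,
    discFactor, Matrix.trace, Fin.sum_univ_three, C_add_mul, C_sub_mul, C_mul_mul, hl, hm, hk, hd]
  ring

/-- In this formula and the following ones, the first term stems from the part of `H_{2j}` with
constant coefficients; all of the other terms contain values at exponents of smaller `μ`-weight. -/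
theorem hc_heat_one [CharZero K] (φ : Series K) {l m k : ℤ} (hl : 0 ≤ l) (hm : 0 ≤ m)
    (hk : 0 ≤ k) (n4 n6 n8 n10 n12 n14 : ℤ) :
    hc (heat 1 φ) l m k n4 n6 n8 n10 n12 n14 =
      -((1 / 2) * (hc φ l m (k + 2) n4 n6 n8 n10 n12 n14
        + 2 * k * hc φ l (m + 1) (k - 1) n4 n6 n8 n10 n12 n14
        + 6 * m * hc φ (l + 1) (m - 1) k n4 n6 n8 n10 n12 n14))
      + 1 / 14 * (
        ((84 * (n4 + 1) : ℤ) : K) * hc φ l m k (n4 + 1) (n6 - 1) n8 n10 n12 n14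
        + ((112 * (n6 + 1) : ℤ) : K) * hc φ l m k n4 (n6 + 1) (n8 - 1) n10 n12 n14
        + ((140 * (n8 + 1) : ℤ) : K) * hc φ l m k n4 n6 (n8 + 1) (n10 - 1) n12 n14
        + ((168 * (n10 + 1) : ℤ) : K) * hc φ l m k n4 n6 n8 (n10 + 1) (n12 - 1) n14
        + ((196 * (n12 + 1) : ℤ) : K) * hc φ l m k n4 n6 n8 n10 (n12 + 1) (n14 - 1)
        - ((8 * (n14 + 1) : ℤ) : K) * hc φ l m k (n4 - 1) n6 n8 n10 (n12 - 1) (n14 + 1)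
        - ((16 * (n12 + 1) : ℤ) : K) * hc φ l m k (n4 - 1) n6 n8 (n10 - 1) (n12 + 1) n14
        - ((24 * (n10 + 1) : ℤ) : K) * hc φ l m k (n4 - 1) n6 (n8 - 1) (n10 + 1) n12 n14
        - ((32 * (n8 + 1) : ℤ) : K) * hc φ l m k (n4 - 1) (n6 - 1) (n8 + 1) n10 n12 n14
        - ((40 * (n6 + 1) : ℤ) : K) * hc φ l m k (n4 - 2) (n6 + 1) n8 n10 n12 n14
        + ((5 * k * (k - 1) : ℤ) : K) * hc φ l m (k - 2) (n4 - 1) n6 n8 n10 n12 n14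
        + ((16 * m : ℤ) : K) * hc φ l (m - 1) (k + 1) (n4 - 1) n6 n8 n10 n12 n14
        + ((8 * l : ℤ) : K) * hc φ (l - 1) (m + 1) k (n4 - 1) n6 n8 n10 n12 n14
        - ((21 * m * (m - 1) : ℤ) : K) * hc φ l (m - 2) k n4 n6 (n8 - 1) n10 n12 n14
        + ((8 * m * (m - 1) : ℤ) : K) * hc φ l (m - 2) k (n4 - 2) n6 n8 n10 n12 n14
        - ((35 * l * (l - 1) : ℤ) : K) * hc φ (l - 2) m k n4 n6 n8 n10 (n12 - 1) n14
        + ((4 * l * (l - 1) : ℤ) : K) * hc φ (l - 2) m k (n4 - 1) n6 (n8 - 1) n10 n12 n14) := by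
  have hd : (0 : Fin 3 → ℤ) ≤ ![l, m, k] := fun i => by fin_cases i <;> assumption
  rw [heat_eq]
  simp only [Fin.sum_univ_six, Fin.sum_univ_three, hc_sub, hc_add]
  simp [-map_mul, -map_add, -map_sub, -map_neg, -map_pow, -neg_mul, V, α, β, γ,
    discFactor, Matrix.trace, Fin.sum_univ_three, C_add_mul, C_sub_mul, C_neg_mul, C_mul_mul,
    C_sq_mul, hl, hm, hk, hd]
  simp only [hc_X_mul_0, hc_X_mul_1, hc_X_mul_2, sub_sub, add_assoc, one_add_one_eq_two]
  push_cast
  ring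

theorem hc_heat_two [CharZero K] (φ : Series K) {l m k : ℤ} (hl : 0 ≤ l) (hm : 0 ≤ m)
    (hk : 0 ≤ k) (n4 n6 n8 n10 n12 n14 : ℤ) :
    hc (heat 2 φ) l m k n4 n6 n8 n10 n12 n14 = -((hc φ l (m + 1) (k + 1) n4 n6 n8 n10 n12 n14
        + k * hc φ (l + 1) m (k - 1) n4 n6 n8 n10 n12 n14))
      + 1 / 7 * (
        ((56 * (n4 + 1) : ℤ) : K) * hc φ l m k (n4 + 1) n6 (n8 - 1) n10 n12 n14
        + ((70 * (n6 + 1) : ℤ) : K) * hc φ l m k n4 (n6 + 1) n8 (n10 - 1) n12 n14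
        + ((84 * (n8 + 1) : ℤ) : K) * hc φ l m k n4 n6 (n8 + 1) n10 (n12 - 1) n14
        + ((98 * (n10 + 1) : ℤ) : K) * hc φ l m k n4 n6 n8 (n10 + 1) n12 (n14 - 1)
        - ((6 * (n14 + 1) : ℤ) : K) * hc φ l m k n4 (n6 - 1) n8 n10 (n12 - 1) (n14 + 1)
        - ((12 * (n12 + 1) : ℤ) : K) * hc φ l m k n4 (n6 - 1) n8 (n10 - 1) (n12 + 1) n14
        - ((18 * (n10 + 1) : ℤ) : K) * hc φ l m k n4 (n6 - 1) (n8 - 1) (n10 + 1) n12 n14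
        - ((24 * (n8 + 1) : ℤ) : K) * hc φ l m k n4 (n6 - 2) (n8 + 1) n10 n12 n14
        + (((-21 * l - 7 * m - 16 * n6 + 28 * n8 + 42 * n10 + 56 * n12 + 70 * n14 + 21) : ℤ) : K)
            * hc φ l m k (n4 - 1) n6 n8 n10 n12 n14
        + ((2 * k * (k - 1) : ℤ) : K) * hc φ l m (k - 2) n4 (n6 - 1) n8 n10 n12 n14
        + ((12 * m : ℤ) : K) * hc φ l (m - 1) (k + 1) n4 (n6 - 1) n8 n10 n12 n14
        + ((6 * l : ℤ) : K) * hc φ (l - 1) (m + 1) k n4 (n6 - 1) n8 n10 n12 n14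
        - ((7 * m * k : ℤ) : K) * hc φ l (m - 1) (k - 1) n4 n6 (n8 - 1) n10 n12 n14
        - ((21 * m * (m - 1) : ℤ) : K) * hc φ l (m - 2) k n4 n6 n8 (n10 - 1) n12 n14
        + ((6 * m * (m - 1) : ℤ) : K) * hc φ l (m - 2) k (n4 - 1) (n6 - 1) n8 n10 n12 n14
        - ((21 * l * m : ℤ) : K) * hc φ (l - 1) (m - 1) k n4 n6 n8 n10 (n12 - 1) n14
        - ((35 * l * (l - 1) : ℤ) : K) * hc φ (l - 2) m k n4 n6 n8 n10 n12 (n14 - 1)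
        + ((3 * l * (l - 1) : ℤ) : K) * hc φ (l - 2) m k n4 (n6 - 1) (n8 - 1) n10 n12 n14) := by
  have hd : (0 : Fin 3 → ℤ) ≤ ![l, m, k] := fun i => by fin_cases i <;> assumption
  rw [heat_eq]
  simp only [Fin.sum_univ_six, Fin.sum_univ_three, hc_sub, hc_add]
  simp [-map_mul, -map_add, -map_sub, -map_neg, -map_pow, -neg_mul, V, α, β, γ,
    discFactor, Matrix.trace, Fin.sum_univ_three, C_add_mul, C_sub_mul, C_neg_mul, C_mul_mul,
    C_sq_mul, hl, hm, hk, hd]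
  simp only [hc_X_mul_0, hc_X_mul_1, hc_X_mul_2, sub_sub, add_assoc, one_add_one_eq_two]
  push_cast
  ring

theorem hc_heat_three [CharZero K] (φ : Series K) {l m k : ℤ} (hl : 0 ≤ l) (hm : 0 ≤ m)
    (hk : 0 ≤ k) (n4 n6 n8 n10 n12 n14 : ℤ) :
    hc (heat 3 φ) l m k n4 n6 n8 n10 n12 n14 =
      -((1 / 2) * (hc φ l (m + 2) k n4 n6 n8 n10 n12 n14
        + 2 * hc φ (l + 1) m (k + 1) n4 n6 n8 n10 n12 n14))
      + 1 / 14 * (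
        - ((14 * m : ℤ) : K) * hc φ (l + 1) (m - 1) k (n4 - 1) n6 n8 n10 n12 n14
        + ((140 * (n4 + 1) : ℤ) : K) * hc φ l m k (n4 + 1) n6 n8 (n10 - 1) n12 n14
        + ((168 * (n6 + 1) : ℤ) : K) * hc φ l m k n4 (n6 + 1) n8 n10 (n12 - 1) n14
        + ((196 * (n8 + 1) : ℤ) : K) * hc φ l m k n4 n6 (n8 + 1) n10 n12 (n14 - 1)
        - ((16 * (n14 + 1) : ℤ) : K) * hc φ l m k n4 n6 (n8 - 1) n10 (n12 - 1) (n14 + 1)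
        - ((32 * (n12 + 1) : ℤ) : K) * hc φ l m k n4 n6 (n8 - 1) (n10 - 1) (n12 + 1) n14
        - ((48 * (n10 + 1) : ℤ) : K) * hc φ l m k n4 n6 (n8 - 2) (n10 + 1) n12 n14
        + (((-28 * l - 36 * n8 + 56 * n10 + 84 * n12 + 112 * n14 + 28) : ℤ) : K)
            * hc φ l m k n4 (n6 - 1) n8 n10 n12 n14
        - ((24 * (n6 + 1) : ℤ) : K) * hc φ l m k (n4 - 1) (n6 + 1) (n8 - 1) n10 n12 n14
        + ((84 * (n8 + 1) : ℤ) : K) * hc φ l m k (n4 - 1) n6 (n8 + 1) (n10 - 1) n12 n14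
        + ((112 * (n10 + 1) : ℤ) : K) * hc φ l m k (n4 - 1) n6 n8 (n10 + 1) (n12 - 1) n14
        + ((140 * (n12 + 1) : ℤ) : K) * hc φ l m k (n4 - 1) n6 n8 n10 (n12 + 1) (n14 - 1)
        + ((3 * k * (k - 1) : ℤ) : K) * hc φ l m (k - 2) n4 n6 (n8 - 1) n10 n12 n14
        + ((18 * m : ℤ) : K) * hc φ l (m - 1) (k + 1) n4 n6 (n8 - 1) n10 n12 n14
        + ((16 * l : ℤ) : K) * hc φ (l - 1) (m + 1) k n4 n6 (n8 - 1) n10 n12 n14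
        - ((28 * m * k : ℤ) : K) * hc φ l (m - 1) (k - 1) n4 n6 n8 (n10 - 1) n12 n14
        - ((63 * m * (m - 1) : ℤ) : K) * hc φ l (m - 2) k n4 n6 n8 n10 (n12 - 1) n14
        + ((9 * m * (m - 1) : ℤ) : K) * hc φ l (m - 2) k (n4 - 1) n6 (n8 - 1) n10 n12 n14
        - ((14 * l * k : ℤ) : K) * hc φ (l - 1) m (k - 1) n4 n6 n8 n10 (n12 - 1) n14
        - ((84 * l * m : ℤ) : K) * hc φ (l - 1) (m - 1) k n4 n6 n8 n10 n12 (n14 - 1)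
        + ((8 * l * (l - 1) : ℤ) : K) * hc φ (l - 2) m k n4 n6 (n8 - 2) n10 n12 n14
        - ((21 * l * (l - 1) : ℤ) : K) * hc φ (l - 2) m k (n4 - 1) n6 n8 n10 (n12 - 1) n14) := by
  have hd : (0 : Fin 3 → ℤ) ≤ ![l, m, k] := fun i => by fin_cases i <;> assumption
  rw [heat_eq]
  simp only [Fin.sum_univ_six, Fin.sum_univ_three, hc_sub, hc_add]
  simp [-map_mul, -map_add, -map_sub, -map_neg, -map_pow, -neg_mul, V, α, β, γ,
    discFactor, Matrix.trace, Fin.sum_univ_three, C_add_mul, C_sub_mul, C_neg_mul, C_mul_mul,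
    C_sq_mul, hl, hm, hk, hd]
  simp only [hc_X_mul_0, hc_X_mul_1, hc_X_mul_2, sub_sub, add_assoc, one_add_one_eq_two]
  push_cast
  ring

theorem hc_heat_four [CharZero K] (φ : Series K) {l m k : ℤ} (hl : 0 ≤ l) (hm : 0 ≤ m)
    (hk : 0 ≤ k) (n4 n6 n8 n10 n12 n14 : ℤ) :
    hc (heat 4 φ) l m k n4 n6 n8 n10 n12 n14 = -((hc φ (l + 1) (m + 1) k n4 n6 n8 n10 n12 n14))
      + 1 / 7 * (
        ((84 * (n4 + 1) : ℤ) : K) * hc φ l m k (n4 + 1) n6 n8 n10 (n12 - 1) n14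
        + ((98 * (n6 + 1) : ℤ) : K) * hc φ l m k n4 (n6 + 1) n8 n10 n12 (n14 - 1)
        - ((10 * (n14 + 1) : ℤ) : K) * hc φ l m k n4 n6 n8 (n10 - 1) (n12 - 1) (n14 + 1)
        - ((20 * (n12 + 1) : ℤ) : K) * hc φ l m k n4 n6 n8 (n10 - 2) (n12 + 1) n14
        + (((-7 * l - 16 * n10 + 28 * n12 + 42 * n14 + 7) : ℤ) : K)
            * hc φ l m k n4 n6 (n8 - 1) n10 n12 n14
        - ((12 * (n8 + 1) : ℤ) : K) * hc φ l m k n4 (n6 - 1) (n8 + 1) (n10 - 1) n12 n14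
        + ((42 * (n10 + 1) : ℤ) : K) * hc φ l m k n4 (n6 - 1) n8 (n10 + 1) (n12 - 1) n14
        + ((56 * (n12 + 1) : ℤ) : K) * hc φ l m k n4 (n6 - 1) n8 n10 (n12 + 1) (n14 - 1)
        - ((8 * (n6 + 1) : ℤ) : K) * hc φ l m k (n4 - 1) (n6 + 1) n8 (n10 - 1) n12 n14
        + ((56 * (n8 + 1) : ℤ) : K) * hc φ l m k (n4 - 1) n6 (n8 + 1) n10 (n12 - 1) n14
        + ((70 * (n10 + 1) : ℤ) : K) * hc φ l m k (n4 - 1) n6 n8 (n10 + 1) n12 (n14 - 1)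
        + ((k * (k - 1) : ℤ) : K) * hc φ l m (k - 2) n4 n6 n8 (n10 - 1) n12 n14
        + ((6 * m : ℤ) : K) * hc φ l (m - 1) (k + 1) n4 n6 n8 (n10 - 1) n12 n14
        + ((10 * l : ℤ) : K) * hc φ (l - 1) (m + 1) k n4 n6 n8 (n10 - 1) n12 n14
        - ((21 * m * k : ℤ) : K) * hc φ l (m - 1) (k - 1) n4 n6 n8 n10 (n12 - 1) n14
        - ((7 * l : ℤ) : K) * hc φ (l - 1) m (k + 1) n4 n6 n8 n10 (n12 - 1) n14
        - ((42 * m * (m - 1) : ℤ) : K) * hc φ l (m - 2) k n4 n6 n8 n10 n12 (n14 - 1)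
        + ((3 * m * (m - 1) : ℤ) : K) * hc φ l (m - 2) k (n4 - 1) n6 n8 (n10 - 1) n12 n14
        - ((14 * l * k : ℤ) : K) * hc φ (l - 1) m (k - 1) n4 n6 n8 n10 n12 (n14 - 1)
        - ((7 * l * m : ℤ) : K) * hc φ (l - 1) (m - 1) k (n4 - 1) n6 n8 n10 (n12 - 1) n14
        + ((5 * l * (l - 1) : ℤ) : K) * hc φ (l - 2) m k n4 n6 (n8 - 1) (n10 - 1) n12 n14
        - ((7 * l * (l - 1) : ℤ) : K) * hc φ (l - 2) m k n4 (n6 - 1) n8 n10 (n12 - 1) n14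
        - ((21 * l * (l - 1) : ℤ) : K) * hc φ (l - 2) m k (n4 - 1) n6 n8 n10 n12 (n14 - 1)) := by
  have hd : (0 : Fin 3 → ℤ) ≤ ![l, m, k] := fun i => by fin_cases i <;> assumption
  rw [heat_eq]
  simp only [Fin.sum_univ_six, Fin.sum_univ_three, hc_sub, hc_add]
  simp [-map_mul, -map_add, -map_sub, -map_neg, -map_pow, -neg_mul, V, α, β, γ,
    discFactor, Matrix.trace, Fin.sum_univ_three, C_add_mul, C_sub_mul, C_neg_mul, C_mul_mul,
    C_sq_mul, hl, hm, hk, hd]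
  simp only [hc_X_mul_0, hc_X_mul_1, hc_X_mul_2, sub_sub, add_assoc, one_add_one_eq_two]
  push_cast
  ring

theorem hc_heat_five [CharZero K] (φ : Series K) {l m k : ℤ} (hl : 0 ≤ l) (hm : 0 ≤ m)
    (hk : 0 ≤ k) (n4 n6 n8 n10 n12 n14 : ℤ) :
    hc (heat 5 φ) l m k n4 n6 n8 n10 n12 n14 =
      -((1 / 2) * (hc φ (l + 2) m k n4 n6 n8 n10 n12 n14))
      + 1 / 14 * (
        ((196 * (n4 + 1) : ℤ) : K) * hc φ l m k (n4 + 1) n6 n8 n10 n12 (n14 - 1)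
        - ((24 * (n14 + 1) : ℤ) : K) * hc φ l m k n4 n6 n8 n10 (n12 - 2) (n14 + 1)
        + (((-20 * n12 + 56 * n14 + 7) : ℤ) : K) * hc φ l m k n4 n6 n8 (n10 - 1) n12 n14
        - ((16 * (n10 + 1) : ℤ) : K) * hc φ l m k n4 n6 (n8 - 1) (n10 + 1) (n12 - 1) n14
        + ((84 * (n12 + 1) : ℤ) : K) * hc φ l m k n4 n6 (n8 - 1) n10 (n12 + 1) (n14 - 1)
        - ((12 * (n8 + 1) : ℤ) : K) * hc φ l m k n4 (n6 - 1) (n8 + 1) n10 (n12 - 1) n14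
        + ((112 * (n10 + 1) : ℤ) : K) * hc φ l m k n4 (n6 - 1) n8 (n10 + 1) n12 (n14 - 1)
        - ((8 * (n6 + 1) : ℤ) : K) * hc φ l m k (n4 - 1) (n6 + 1) n8 n10 (n12 - 1) n14
        + ((140 * (n8 + 1) : ℤ) : K) * hc φ l m k (n4 - 1) n6 (n8 + 1) n10 n12 (n14 - 1)
        + ((k * (k - 1) : ℤ) : K) * hc φ l m (k - 2) n4 n6 n8 n10 (n12 - 1) n14
        + ((6 * m : ℤ) : K) * hc φ l (m - 1) (k + 1) n4 n6 n8 n10 (n12 - 1) n14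
        + ((10 * l : ℤ) : K) * hc φ (l - 1) (m + 1) k n4 n6 n8 n10 (n12 - 1) n14
        - ((56 * m * k : ℤ) : K) * hc φ l (m - 1) (k - 1) n4 n6 n8 n10 n12 (n14 - 1)
        - ((28 * l : ℤ) : K) * hc φ (l - 1) m (k + 1) n4 n6 n8 n10 n12 (n14 - 1)
        + ((3 * m * (m - 1) : ℤ) : K) * hc φ l (m - 2) k (n4 - 1) n6 n8 n10 (n12 - 1) n14
        - ((28 * l * m : ℤ) : K) * hc φ (l - 1) (m - 1) k (n4 - 1) n6 n8 n10 n12 (n14 - 1)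
        + ((5 * l * (l - 1) : ℤ) : K) * hc φ (l - 2) m k n4 n6 (n8 - 1) n10 (n12 - 1) n14
        - ((28 * l * (l - 1) : ℤ) : K) * hc φ (l - 2) m k n4 (n6 - 1) n8 n10 n12 (n14 - 1)) := by
  have hd : (0 : Fin 3 → ℤ) ≤ ![l, m, k] := fun i => by fin_cases i <;> assumption
  rw [heat_eq]
  simp only [Fin.sum_univ_six, Fin.sum_univ_three, hc_sub, hc_add]
  simp [-map_mul, -map_add, -map_sub, -map_neg, -map_pow, -neg_mul, V, α, β, γ,
    discFactor, Matrix.trace, Fin.sum_univ_three, C_add_mul, C_sub_mul, C_neg_mul, C_mul_mul,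
    C_sq_mul, hl, hm, hk, hd]
  simp only [hc_X_mul_0, hc_X_mul_1, hc_X_mul_2, sub_sub, add_assoc, one_add_one_eq_two]
  push_cast
  ring

/-! ### Hurwitz series and the heat equations -/

theorem eq_zero_of_hc [CharZero K] {φ : Series K}
    (h : ∀ l m k n4 n6 n8 n10 n12 n14 : ℤ, 0 ≤ l → 0 ≤ m → 0 ≤ k →
      hc φ l m k n4 n6 n8 n10 n12 n14 = 0) : φ = 0 := by
  refine eq_zero_of_hcoeff fun d n hd _ => ?_
  have h1 : d = ![d 0, d 1, d 2] := by ext i; fin_cases i <;> rfl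
  have h2 : n = ![n 0, n 1, n 2, n 3, n 4, n 5] := by ext i; fin_cases i <;> rfl
  rw [h1, h2]
  exact h _ _ _ _ _ _ _ _ _ (hd 0) (hd 1) (hd 2)

theorem hc_of_not_nonneg (φ : Series K) {l m k n4 n6 n8 n10 n12 n14 : ℤ}
    (h : ¬ (0 ≤ l ∧ 0 ≤ m ∧ 0 ≤ k ∧ 0 ≤ n4 ∧ 0 ≤ n6 ∧ 0 ≤ n8 ∧ 0 ≤ n10 ∧ 0 ≤ n12 ∧ 0 ≤ n14)) :
    hc φ l m k n4 n6 n8 n10 n12 n14 = 0 :=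
  hcoeff_of_not_nonneg _ fun h' => h ⟨h'.1 0, h'.1 1, h'.1 2, h'.2 0, h'.2 1, h'.2 2, h'.2 3,
    h'.2 4, h'.2 5⟩

/-- The Hurwitz coefficients of `hurwitz b` are the values of `b`, placed at the exponents of
total weight `-6`. -/
theorem hc_hurwitz [CharZero K] {b : Idx → K} (hb : ∀ I : Idx, ¬ I.Nonneg → b I = 0)
    (l m k n4 n6 n8 n10 n12 n14 : ℤ) :
    hc (hurwitz b) l m k n4 n6 n8 n10 n12 n14 =
      if k = Idx.k ⟨l, m, n4, n6, n8, n10, n12, n14⟩ then b ⟨l, m, n4, n6, n8, n10, n12, n14⟩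
      else 0 := by
  by_cases h : 0 ≤ l ∧ 0 ≤ m ∧ 0 ≤ k ∧ 0 ≤ n4 ∧ 0 ≤ n6 ∧ 0 ≤ n8 ∧ 0 ≤ n10 ∧ 0 ≤ n12 ∧ 0 ≤ n14
  · obtain ⟨hl, hm, hk, h4, h6, h8, h10, h12, h14⟩ := h
    lift l to ℕ using hl
    lift m to ℕ using hm
    lift k to ℕ using hk
    lift n4 to ℕ using h4
    lift n6 to ℕ using h6
    lift n8 to ℕ using h8
    lift n10 to ℕ using h10
    lift n12 to ℕ using h12
    lift n14 to ℕ using h14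
    have hd : (0 : Fin 3 → ℤ) ≤ ![(l : ℤ), m, k] := fun i => by fin_cases i <;> simp
    have hn : (0 : Fin 6 → ℤ) ≤ ![(n4 : ℤ), n6, n8, n10, n12, n14] :=
      fun i => by fin_cases i <;> simp
    have e := coeff_hurwitz b (natExp ![(l : ℤ), m, k]) (natExp ![(n4 : ℤ), n6, n8, n10, n12, n14])
    rw [hc, hcoeff_of_nonneg _ ⟨hd, hn⟩]
    by_cases hw : 5 * l + 3 * m + k =
      6 + (4 * n4 + 6 * n6 + 8 * n8 + 10 * n10 + 12 * n12 + 14 * n14)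
    · rw [if_pos (by simpa [monWt] using hw)] at e
      rw [e, if_pos (by simp only [Idx.k, Idx.wt]; omega)]
      have h3 : ∀ a : ℕ, (a.factorial : K) ≠ 0 := fun a => by exact_mod_cast a.factorial_ne_zero
      simp only [Fin.prod_univ_three, natExp_apply, monIdx, Matrix.cons_val, Int.toNat_natCast]
      field_simp [h3 l, h3 m, h3 k]
    · rw [if_neg (by simpa [monWt] using hw)] at e
      rw [e, if_neg (by simp only [Idx.k, Idx.wt]; omega), mul_zero]
  · rw [hc_of_not_nonneg _ h]
    split_ifs with hk
    · rw [hb]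
      rintro ⟨h0, h1, h2, h3⟩
      exact h ⟨h1, h2, hk ▸ h0, h3⟩
    · rfl

theorem hc_hurwitz_of_eq [CharZero K] {b : Idx → K} (hb : ∀ I : Idx, ¬ I.Nonneg → b I = 0)
    {l m k n4 n6 n8 n10 n12 n14 : ℤ} (h : k = 6 - 5 * l - 3 * m +
      (4 * n4 + 6 * n6 + 8 * n8 + 10 * n10 + 12 * n12 + 14 * n14)) :
    hc (hurwitz b) l m k n4 n6 n8 n10 n12 n14 = b ⟨l, m, n4, n6, n8, n10, n12, n14⟩ :=
  (hc_hurwitz hb ..).trans (if_pos h)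

theorem hc_hurwitz_of_ne [CharZero K] {b : Idx → K} (hb : ∀ I : Idx, ¬ I.Nonneg → b I = 0)
    {l m k n4 n6 n8 n10 n12 n14 : ℤ} (h : k ≠ 6 - 5 * l - 3 * m +
      (4 * n4 + 6 * n6 + 8 * n8 + 10 * n10 + 12 * n12 + 14 * n14)) :
    hc (hurwitz b) l m k n4 n6 n8 n10 n12 n14 = 0 :=
  (hc_hurwitz hb ..).trans (if_neg h)

theorem hurwitz_injective [CharZero K] {b b' : Idx → K} (hb : ∀ I : Idx, ¬ I.Nonneg → b I = 0)
    (hb' : ∀ I : Idx, ¬ I.Nonneg → b' I = 0) (h : hurwitz b = hurwitz b') : b = b' := by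
  funext ⟨l, m, n4, n6, n8, n10, n12, n14⟩
  rw [← hc_hurwitz_of_eq hb rfl, h, hc_hurwitz_of_eq hb' rfl]

theorem heat_zero_hurwitz [CharZero K] {b : Idx → K} (hb : ∀ I : Idx, ¬ I.Nonneg → b I = 0) :
    heat 0 (hurwitz b) = 0 := by
  refine eq_zero_of_hc fun l m k n4 n6 n8 n10 n12 n14 hl hm hk => ?_
  rw [hc_heat_zero _ hl hm hk, hc_hurwitz hb]
  split_ifs with h
  · rw [mul_eq_zero, Int.cast_eq_zero]
    left
    simp only [Idx.k, Idx.wt] at h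
    omega
  · rw [mul_zero]

theorem exists_eq_hurwitz [CharZero K] {φ : Series K} (hφ : heat 0 φ = 0) :
    ∃ b : Idx → K, (∀ I : Idx, ¬ I.Nonneg → b I = 0) ∧ φ = hurwitz b := by
  let b : Idx → K := fun I => hc φ I.l I.m I.k I.n4 I.n6 I.n8 I.n10 I.n12 I.n14
  have hb : ∀ I : Idx, ¬ I.Nonneg → b I = 0 := fun I hI =>
    hc_of_not_nonneg _ fun ⟨h1, h2, h3, h4⟩ => hI ⟨h3, h1, h2, h4⟩
  refine ⟨b, hb, sub_eq_zero.mp (eq_zero_of_hc fun l m k n4 n6 n8 n10 n12 n14 hl hm hk => ?_)⟩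
  rw [hc_sub, hc_hurwitz hb]
  split_ifs with h
  · rw [sub_eq_zero, h]
  · have h1 := hc_heat_zero φ hl hm hk n4 n6 n8 n10 n12 n14
    rw [hφ, hc_zero, eq_comm, mul_eq_zero, Int.cast_eq_zero] at h1
    rw [sub_zero]
    refine h1.resolve_left fun h2 => h ?_
    simp only [Idx.k, Idx.wt]
    omega

theorem heat_zero_eq_zero_iff [CharZero K] (φ : Series K) : heat 0 φ = 0 ↔
    ∃! b : Idx → K, (∀ I : Idx, ¬ I.Nonneg → b I = 0) ∧ φ = hurwitz b := by
  constructor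
  · intro h
    obtain ⟨b, hb, rfl⟩ := exists_eq_hurwitz h
    exact ⟨b, ⟨hb, rfl⟩, fun b' hb' => hurwitz_injective hb'.1 hb hb'.2.symm⟩
  · rintro ⟨b, ⟨hb, rfl⟩, -⟩
    exact heat_zero_hurwitz hb

section residual

variable [CharZero K] {b : Idx → K} {l m k n4 n6 n8 n10 n12 n14 : ℤ}

/-- At the exponents where the weights match, the coefficients of `(L₂ - H₂) σ_b` are, up to a
factor, the defects of the recurrence `P₂`; at the other exponents they vanish. The same holds for
the other operators and recurrences. -/
theorem hc_heat_one_hurwitz (hb : ∀ I : Idx, ¬ I.Nonneg → b I = 0) (hl : 0 ≤ l)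
    (hm : 0 ≤ m) (hk : 0 ≤ k) {I : Idx} (hI : I = ⟨l, m, n4, n6, n8, n10, n12, n14⟩)
    (h : I.k = k + 2) :
    hc (heat 1 (hurwitz b)) l m k n4 n6 n8 n10 n12 n14 =
      -(1 / 2) * (b I - rhs2 b I) := by
  rw [hc_heat_one _ hl hm hk]
  subst hI
  rw [rhs2, low2, h]
  simp only [Idx.k, Idx.wt] at h
  simp (disch := omega) only [hc_hurwitz_of_eq hb, Idx.shift, add_sub_cancel_right, add_zero,
    ← sub_eq_add_neg]
  push_cast
  ring

theorem hc_heat_one_hurwitz_of_ne (hb : ∀ I : Idx, ¬ I.Nonneg → b I = 0) (hl : 0 ≤ l)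
    (hm : 0 ≤ m) (hk : 0 ≤ k) (h : Idx.k ⟨l, m, n4, n6, n8, n10, n12, n14⟩ ≠ k + 2) :
    hc (heat 1 (hurwitz b)) l m k n4 n6 n8 n10 n12 n14 = 0 := by
  rw [hc_heat_one _ hl hm hk]
  simp only [Idx.k, Idx.wt] at h
  simp (disch := omega) only [hc_hurwitz_of_ne hb]
  ring

theorem hc_heat_two_hurwitz (hb : ∀ I : Idx, ¬ I.Nonneg → b I = 0) (hl : 0 ≤ l)
    (hm : 0 ≤ m) (hk : 0 ≤ k) {I : Idx} (hI : I = ⟨l, m, n4, n6, n8, n10, n12, n14⟩)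
    (h : I.k = k + 4) :
    hc (heat 2 (hurwitz b)) l m k n4 n6 n8 n10 n12 n14 =
      -1 * (b (I.shift 0 1) + ((I.shift 0 1).k - 1 : ℤ) * b (I.shift 1 0) - low4 b I) := by
  rw [hc_heat_two _ hl hm hk]
  subst hI
  have h' : (Idx.shift ⟨l, m, n4, n6, n8, n10, n12, n14⟩ 0 1).k = k + 1 := by
    simp only [Idx.k, Idx.wt, Idx.shift] at h ⊢
    omega
  rw [h', low4, h]
  simp only [Idx.k, Idx.wt] at h
  simp (disch := omega) only [hc_hurwitz_of_eq hb, Idx.shift, add_sub_cancel_right, add_zero]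
  push_cast
  ring

theorem hc_heat_two_hurwitz_of_ne (hb : ∀ I : Idx, ¬ I.Nonneg → b I = 0) (hl : 0 ≤ l)
    (hm : 0 ≤ m) (hk : 0 ≤ k) (h : Idx.k ⟨l, m, n4, n6, n8, n10, n12, n14⟩ ≠ k + 4) :
    hc (heat 2 (hurwitz b)) l m k n4 n6 n8 n10 n12 n14 = 0 := by
  rw [hc_heat_two _ hl hm hk]
  simp only [Idx.k, Idx.wt] at h
  simp (disch := omega) only [hc_hurwitz_of_ne hb]
  ring

theorem hc_heat_three_hurwitz (hb : ∀ I : Idx, ¬ I.Nonneg → b I = 0) (hl : 0 ≤ l)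
    (hm : 0 ≤ m) (hk : 0 ≤ k) {I : Idx} (hI : I = ⟨l, m, n4, n6, n8, n10, n12, n14⟩)
    (h : I.k = k + 6) :
    hc (heat 3 (hurwitz b)) l m k n4 n6 n8 n10 n12 n14 =
      -(1 / 2) * (b (I.shift 0 2) + 2 * b (I.shift 1 0) - low6 b I) := by
  rw [hc_heat_three _ hl hm hk]
  subst hI
  rw [low6, h]
  simp only [Idx.k, Idx.wt] at h
  simp (disch := omega) only [hc_hurwitz_of_eq hb, Idx.shift, add_sub_cancel_right, add_zero]
  push_cast
  ring

theorem hc_heat_three_hurwitz_of_ne (hb : ∀ I : Idx, ¬ I.Nonneg → b I = 0) (hl : 0 ≤ l)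
    (hm : 0 ≤ m) (hk : 0 ≤ k) (h : Idx.k ⟨l, m, n4, n6, n8, n10, n12, n14⟩ ≠ k + 6) :
    hc (heat 3 (hurwitz b)) l m k n4 n6 n8 n10 n12 n14 = 0 := by
  rw [hc_heat_three _ hl hm hk]
  simp only [Idx.k, Idx.wt] at h
  simp (disch := omega) only [hc_hurwitz_of_ne hb]
  ring

theorem hc_heat_four_hurwitz (hb : ∀ I : Idx, ¬ I.Nonneg → b I = 0) (hl : 0 ≤ l)
    (hm : 0 ≤ m) (hk : 0 ≤ k) {I : Idx} (hI : I = ⟨l, m, n4, n6, n8, n10, n12, n14⟩)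
    (h : I.k = k + 8) :
    hc (heat 4 (hurwitz b)) l m k n4 n6 n8 n10 n12 n14 =
      -1 * (b (I.shift 1 1) - low8 b I) := by
  rw [hc_heat_four _ hl hm hk]
  subst hI
  rw [low8, h]
  simp only [Idx.k, Idx.wt] at h
  simp (disch := omega) only [hc_hurwitz_of_eq hb, Idx.shift, add_sub_cancel_right]
  push_cast
  ring

theorem hc_heat_four_hurwitz_of_ne (hb : ∀ I : Idx, ¬ I.Nonneg → b I = 0) (hl : 0 ≤ l)
    (hm : 0 ≤ m) (hk : 0 ≤ k) (h : Idx.k ⟨l, m, n4, n6, n8, n10, n12, n14⟩ ≠ k + 8) :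
    hc (heat 4 (hurwitz b)) l m k n4 n6 n8 n10 n12 n14 = 0 := by
  rw [hc_heat_four _ hl hm hk]
  simp only [Idx.k, Idx.wt] at h
  simp (disch := omega) only [hc_hurwitz_of_ne hb]
  ring

theorem hc_heat_five_hurwitz (hb : ∀ I : Idx, ¬ I.Nonneg → b I = 0) (hl : 0 ≤ l)
    (hm : 0 ≤ m) (hk : 0 ≤ k) {I : Idx} (hI : I = ⟨l, m, n4, n6, n8, n10, n12, n14⟩)
    (h : I.k = k + 10) :
    hc (heat 5 (hurwitz b)) l m k n4 n6 n8 n10 n12 n14 =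
      -(1 / 2) * (b (I.shift 2 0) - low10 b I) := by
  rw [hc_heat_five _ hl hm hk]
  subst hI
  rw [low10, h]
  simp only [Idx.k, Idx.wt] at h
  simp (disch := omega) only [hc_hurwitz_of_eq hb, Idx.shift, add_sub_cancel_right, add_zero]
  push_cast
  ring

theorem hc_heat_five_hurwitz_of_ne (hb : ∀ I : Idx, ¬ I.Nonneg → b I = 0) (hl : 0 ≤ l)
    (hm : 0 ≤ m) (hk : 0 ≤ k) (h : Idx.k ⟨l, m, n4, n6, n8, n10, n12, n14⟩ ≠ k + 10) :
    hc (heat 5 (hurwitz b)) l m k n4 n6 n8 n10 n12 n14 = 0 := by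
  rw [hc_heat_five _ hl hm hk]
  simp only [Idx.k, Idx.wt] at h
  simp (disch := omega) only [hc_hurwitz_of_ne hb]
  ring

end residual

theorem heat_one_hurwitz_eq_zero_iff [CharZero K] {b : Idx → K}
    (hb : ∀ I : Idx, ¬ I.Nonneg → b I = 0) :
    heat 1 (hurwitz b) = 0 ↔ ∀ I : Idx, I.Nonneg → 2 ≤ I.k → P2 b I := by
  constructor
  · intro h I hI hk
    have e := hc_heat_one_hurwitz hb hI.2.1 hI.2.2.1 (sub_nonneg.mpr hk) (I := I) rfl
      (sub_add_cancel _ _).symm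
    rw [h, hc_zero] at e
    have e := sub_eq_zero.mp ((mul_eq_zero.mp e.symm).resolve_left (by norm_num))
    exact e
  · intro h
    refine eq_zero_of_hc fun l m k n4 n6 n8 n10 n12 n14 hl hm hk => ?_
    by_cases hn : 0 ≤ n4 ∧ 0 ≤ n6 ∧ 0 ≤ n8 ∧ 0 ≤ n10 ∧ 0 ≤ n12 ∧ 0 ≤ n14
    · by_cases hI : Idx.k ⟨l, m, n4, n6, n8, n10, n12, n14⟩ = k + 2
      · have e := h ⟨l, m, n4, n6, n8, n10, n12, n14⟩ ⟨by omega, hl, hm, hn⟩ (by omega)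
        rw [P2] at e
        rw [hc_heat_one_hurwitz hb hl hm hk rfl hI, e]
        exact mul_eq_zero_of_right _ (sub_self _)
      · exact hc_heat_one_hurwitz_of_ne hb hl hm hk hI
    · exact hc_of_not_nonneg _ fun h' => hn h'.2.2.2

theorem heat_two_hurwitz_eq_zero_iff [CharZero K] {b : Idx → K}
    (hb : ∀ I : Idx, ¬ I.Nonneg → b I = 0) :
    heat 2 (hurwitz b) = 0 ↔ ∀ I : Idx, I.Nonneg → 4 ≤ I.k → P4 b I := by
  constructor
  · intro h I hI hk
    have e := hc_heat_two_hurwitz hb hI.2.1 hI.2.2.1 (sub_nonneg.mpr hk) (I := I) rfl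
      (sub_add_cancel _ _).symm
    rw [h, hc_zero] at e
    have e := sub_eq_zero.mp ((mul_eq_zero.mp e.symm).resolve_left (by norm_num))
    rw [P4]
    linear_combination e
  · intro h
    refine eq_zero_of_hc fun l m k n4 n6 n8 n10 n12 n14 hl hm hk => ?_
    by_cases hn : 0 ≤ n4 ∧ 0 ≤ n6 ∧ 0 ≤ n8 ∧ 0 ≤ n10 ∧ 0 ≤ n12 ∧ 0 ≤ n14
    · by_cases hI : Idx.k ⟨l, m, n4, n6, n8, n10, n12, n14⟩ = k + 4
      · have e := h ⟨l, m, n4, n6, n8, n10, n12, n14⟩ ⟨by omega, hl, hm, hn⟩ (by omega)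
        rw [P4] at e
        rw [hc_heat_two_hurwitz hb hl hm hk rfl hI, e]
        ring
      · exact hc_heat_two_hurwitz_of_ne hb hl hm hk hI
    · exact hc_of_not_nonneg _ fun h' => hn h'.2.2.2

theorem heat_three_hurwitz_eq_zero_iff [CharZero K] {b : Idx → K}
    (hb : ∀ I : Idx, ¬ I.Nonneg → b I = 0) :
    heat 3 (hurwitz b) = 0 ↔ ∀ I : Idx, I.Nonneg → 6 ≤ I.k → P6 b I := by
  constructor
  · intro h I hI hk
    have e := hc_heat_three_hurwitz hb hI.2.1 hI.2.2.1 (sub_nonneg.mpr hk) (I := I) rfl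
      (sub_add_cancel _ _).symm
    rw [h, hc_zero] at e
    have e := sub_eq_zero.mp ((mul_eq_zero.mp e.symm).resolve_left (by norm_num))
    exact e
  · intro h
    refine eq_zero_of_hc fun l m k n4 n6 n8 n10 n12 n14 hl hm hk => ?_
    by_cases hn : 0 ≤ n4 ∧ 0 ≤ n6 ∧ 0 ≤ n8 ∧ 0 ≤ n10 ∧ 0 ≤ n12 ∧ 0 ≤ n14
    · by_cases hI : Idx.k ⟨l, m, n4, n6, n8, n10, n12, n14⟩ = k + 6
      · have e := h ⟨l, m, n4, n6, n8, n10, n12, n14⟩ ⟨by omega, hl, hm, hn⟩ (by omega)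
        rw [P6] at e
        rw [hc_heat_three_hurwitz hb hl hm hk rfl hI, e]
        exact mul_eq_zero_of_right _ (sub_self _)
      · exact hc_heat_three_hurwitz_of_ne hb hl hm hk hI
    · exact hc_of_not_nonneg _ fun h' => hn h'.2.2.2

theorem heat_four_hurwitz_eq_zero_iff [CharZero K] {b : Idx → K}
    (hb : ∀ I : Idx, ¬ I.Nonneg → b I = 0) :
    heat 4 (hurwitz b) = 0 ↔ ∀ I : Idx, I.Nonneg → 8 ≤ I.k → P8 b I := by
  constructor
  · intro h I hI hk
    have e := hc_heat_four_hurwitz hb hI.2.1 hI.2.2.1 (sub_nonneg.mpr hk) (I := I) rfl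
      (sub_add_cancel _ _).symm
    rw [h, hc_zero] at e
    have e := sub_eq_zero.mp ((mul_eq_zero.mp e.symm).resolve_left (by norm_num))
    exact e
  · intro h
    refine eq_zero_of_hc fun l m k n4 n6 n8 n10 n12 n14 hl hm hk => ?_
    by_cases hn : 0 ≤ n4 ∧ 0 ≤ n6 ∧ 0 ≤ n8 ∧ 0 ≤ n10 ∧ 0 ≤ n12 ∧ 0 ≤ n14
    · by_cases hI : Idx.k ⟨l, m, n4, n6, n8, n10, n12, n14⟩ = k + 8
      · have e := h ⟨l, m, n4, n6, n8, n10, n12, n14⟩ ⟨by omega, hl, hm, hn⟩ (by omega)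
        rw [P8] at e
        rw [hc_heat_four_hurwitz hb hl hm hk rfl hI, e]
        exact mul_eq_zero_of_right _ (sub_self _)
      · exact hc_heat_four_hurwitz_of_ne hb hl hm hk hI
    · exact hc_of_not_nonneg _ fun h' => hn h'.2.2.2

theorem heat_five_hurwitz_eq_zero_iff [CharZero K] {b : Idx → K}
    (hb : ∀ I : Idx, ¬ I.Nonneg → b I = 0) :
    heat 5 (hurwitz b) = 0 ↔ ∀ I : Idx, I.Nonneg → 10 ≤ I.k → P10 b I := by
  constructor
  · intro h I hI hk
    have e := hc_heat_five_hurwitz hb hI.2.1 hI.2.2.1 (sub_nonneg.mpr hk) (I := I) rfl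
      (sub_add_cancel _ _).symm
    rw [h, hc_zero] at e
    have e := sub_eq_zero.mp ((mul_eq_zero.mp e.symm).resolve_left (by norm_num))
    exact e
  · intro h
    refine eq_zero_of_hc fun l m k n4 n6 n8 n10 n12 n14 hl hm hk => ?_
    by_cases hn : 0 ≤ n4 ∧ 0 ≤ n6 ∧ 0 ≤ n8 ∧ 0 ≤ n10 ∧ 0 ≤ n12 ∧ 0 ≤ n14
    · by_cases hI : Idx.k ⟨l, m, n4, n6, n8, n10, n12, n14⟩ = k + 10
      · have e := h ⟨l, m, n4, n6, n8, n10, n12, n14⟩ ⟨by omega, hl, hm, hn⟩ (by omega)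
        rw [P10] at e
        rw [hc_heat_five_hurwitz hb hl hm hk rfl hI, e]
        exact mul_eq_zero_of_right _ (sub_self _)
      · exact hc_heat_five_hurwitz_of_ne hb hl hm hk hI
    · exact hc_of_not_nonneg _ fun h' => hn h'.2.2.2

/-! ### Finite linear forms and the weights of the recurrences -/

/-- Linear forms in a family `b` that involve only finitely many of its values. -/
def FiniteForm (F : (Idx → K) → K) : Prop :=
  ∃ s : Idx →₀ K, ∀ b, F b = s.sum fun J c => c * b J

namespace FiniteForm

theorem eval (J : Idx) : FiniteForm (K := K) fun b => b J :=
  ⟨Finsupp.single J 1, fun b => by simp⟩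

theorem add {F G : (Idx → K) → K} (hF : FiniteForm F) (hG : FiniteForm G) :
    FiniteForm fun b => F b + G b := by
  classical
  obtain ⟨s, hs⟩ := hF
  obtain ⟨t, ht⟩ := hG
  exact ⟨s + t, fun b => by
    simp only [hs, ht]
    rw [Finsupp.sum_add_index' (fun _ => zero_mul _) fun _ _ _ => add_mul _ _ _]⟩

theorem const_mul (c : K) {F : (Idx → K) → K} (hF : FiniteForm F) :
    FiniteForm fun b => c * F b := by
  obtain ⟨s, hs⟩ := hF
  exact ⟨c • s, fun b => by
    simp only [hs]
    rw [Finsupp.sum_smul_index' fun _ => zero_mul _, Finsupp.mul_sum]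
    simp [mul_assoc]⟩

theorem neg {F : (Idx → K) → K} (hF : FiniteForm F) : FiniteForm fun b => -F b := by
  simpa using const_mul (-1) hF

theorem sub {F G : (Idx → K) → K} (hF : FiniteForm F) (hG : FiniteForm G) :
    FiniteForm fun b => F b - G b := by
  simpa only [sub_eq_add_neg] using add hF hG.neg

open Classical in
/-- A finite linear form depends only on the values of `b` that occur with a nonzero
coefficient. -/
theorem congr {F : (Idx → K) → K} (hF : FiniteForm F) {b b' : Idx → K}
    (h : ∀ J, F (fun I => if I = J then 1 else 0) ≠ 0 → b J = b' J) : F b = F b' := by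
  obtain ⟨s, hs⟩ := hF
  rw [hs, hs]
  refine Finsupp.sum_congr fun J hJ => ?_
  rw [h J]
  rw [hs, Finsupp.sum]
  simpa using Finsupp.mem_support_iff.mp hJ

theorem map_smul {F : (Idx → K) → K} (hF : FiniteForm F) (c : K) (b : Idx → K) :
    F (c • b) = c * F b := by
  obtain ⟨s, hs⟩ := hF
  rw [hs, hs, Finsupp.mul_sum]
  refine Finsupp.sum_congr fun J _ => ?_
  simp only [Pi.smul_apply, smul_eq_mul]
  ring

theorem low2 (I : Idx) : FiniteForm (K := K) fun b => low2 b I := by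
  refine const_mul _ ?_
  repeat' first | exact const_mul _ (eval _) | apply add | apply sub

theorem low4 (I : Idx) : FiniteForm (K := K) fun b => low4 b I := by
  refine const_mul _ ?_
  repeat' first | exact const_mul _ (eval _) | apply add | apply sub

theorem low6 (I : Idx) : FiniteForm (K := K) fun b => low6 b I := by
  refine const_mul _ ?_
  repeat' first | exact const_mul _ (eval _) | apply add | apply sub

theorem low8 (I : Idx) : FiniteForm (K := K) fun b => low8 b I := by
  refine const_mul _ ?_
  repeat' first | exact const_mul _ (eval _) | apply add | apply sub

theorem low10 (I : Idx) : FiniteForm (K := K) fun b => low10 b I := by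
  refine const_mul _ ?_
  repeat' first | exact const_mul _ (eval _) | apply add | apply sub

theorem rhs2 (I : Idx) : FiniteForm (K := K) fun b => rhs2 b I :=
  (((eval _).const_mul _).sub ((eval _).const_mul _)).add (low2 I)

theorem rhs4 (I : Idx) : FiniteForm (K := K) fun b => rhs4 b I :=
  ((eval _).const_mul _).neg.add (low4 _)

theorem rhs6a (I : Idx) : FiniteForm (K := K) fun b => rhs6a b I :=
  ((eval _).const_mul _).neg.add (low6 _)

theorem rhs6b (I : Idx) : FiniteForm (K := K) fun b => rhs6b b I :=
  ((eval _).neg.add (low6 _)).const_mul _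

theorem rule1 (I : Idx) : FiniteForm (K := K) fun b => rule1 b I := by
  unfold HyperellipticSigma.rule1
  split_ifs
  exacts [rhs2 I, rhs4 I, rhs6a I, low8 _, low10 _]

theorem rule2 (I : Idx) : FiniteForm (K := K) fun b => rule2 b I := by
  unfold HyperellipticSigma.rule2
  split_ifs
  exacts [low10 _, low8 _, rhs6b I, rhs4 I, rhs6a I, rhs2 I]

end FiniteForm

open Classical in
theorem delta_eq_zero {J : Idx} {l m n4 n6 n8 n10 n12 n14 : ℤ}
    (h : 4 * n4 + 6 * n6 + 8 * n8 + 10 * n10 + 12 * n12 + 14 * n14 ≠ J.wt) :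
    (if (⟨l, m, n4, n6, n8, n10, n12, n14⟩ : Idx) = J then (1 : K) else 0) = 0 := by
  rw [if_neg]
  rintro rfl
  exact h rfl

theorem wt_of_coeffAt_low2 {I J : Idx} (h : coeffAt (K := K) low2 I J ≠ 0) :
    I.wt - 12 ≤ J.wt ∧ J.wt ≤ I.wt - 2 := by
  by_contra hw
  obtain ⟨l, m, n4, n6, n8, n10, n12, n14⟩ := I
  have hI : Idx.wt ⟨l, m, n4, n6, n8, n10, n12, n14⟩ =
    4 * n4 + 6 * n6 + 8 * n8 + 10 * n10 + 12 * n12 + 14 * n14 := rfl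
  refine h ?_
  simp (disch := omega) only [coeffAt, low2, delta_eq_zero]
  ring

theorem wt_lt_of_coeffAt_low4 {I J : Idx} (h : coeffAt (K := K) low4 I J ≠ 0) :
    J.wt < I.wt := by
  by_contra hw
  obtain ⟨l, m, n4, n6, n8, n10, n12, n14⟩ := I
  have hI : Idx.wt ⟨l, m, n4, n6, n8, n10, n12, n14⟩ =
    4 * n4 + 6 * n6 + 8 * n8 + 10 * n10 + 12 * n12 + 14 * n14 := rfl
  refine h ?_
  simp (disch := omega) only [coeffAt, low4, delta_eq_zero]
  ring

theorem wt_lt_of_coeffAt_low6 {I J : Idx} (h : coeffAt (K := K) low6 I J ≠ 0) :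
    J.wt < I.wt := by
  by_contra hw
  obtain ⟨l, m, n4, n6, n8, n10, n12, n14⟩ := I
  have hI : Idx.wt ⟨l, m, n4, n6, n8, n10, n12, n14⟩ =
    4 * n4 + 6 * n6 + 8 * n8 + 10 * n10 + 12 * n12 + 14 * n14 := rfl
  refine h ?_
  simp (disch := omega) only [coeffAt, low6, delta_eq_zero]
  ring

theorem wt_lt_of_coeffAt_low8 {I J : Idx} (h : coeffAt (K := K) low8 I J ≠ 0) :
    J.wt < I.wt := by
  by_contra hw
  obtain ⟨l, m, n4, n6, n8, n10, n12, n14⟩ := I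
  have hI : Idx.wt ⟨l, m, n4, n6, n8, n10, n12, n14⟩ =
    4 * n4 + 6 * n6 + 8 * n8 + 10 * n10 + 12 * n12 + 14 * n14 := rfl
  refine h ?_
  simp (disch := omega) only [coeffAt, low8, delta_eq_zero]
  ring

theorem wt_lt_of_coeffAt_low10 {I J : Idx} (h : coeffAt (K := K) low10 I J ≠ 0) :
    J.wt < I.wt := by
  by_contra hw
  obtain ⟨l, m, n4, n6, n8, n10, n12, n14⟩ := I
  have hI : Idx.wt ⟨l, m, n4, n6, n8, n10, n12, n14⟩ =
    4 * n4 + 6 * n6 + 8 * n8 + 10 * n10 + 12 * n12 + 14 * n14 := rfl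
  refine h ?_
  simp (disch := omega) only [coeffAt, low10, delta_eq_zero]
  ring

theorem wt_shift (I : Idx) (dl dm : ℤ) : (I.shift dl dm).wt = I.wt := rfl

theorem k_shift (I : Idx) (dl dm : ℤ) : (I.shift dl dm).k = I.k - 5 * dl - 3 * dm := by
  simp only [Idx.k, wt_shift]
  simp only [Idx.shift]
  ring

theorem shift_shift (I : Idx) (a b c d : ℤ) :
    (I.shift a b).shift c d = I.shift (a + c) (b + d) := by
  simp only [Idx.shift, Idx.mk.injEq, and_true]
  constructor <;> ring

theorem shift_zero (I : Idx) : I.shift 0 0 = I := by simp [Idx.shift]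

/-- Apart from values of lower weight, the right hand side of `P₂` contains only its two leading
terms, and the second one of these only if its factor `m` is nonzero. -/
theorem of_coeffAt_rhs2 {I J : Idx} (h : coeffAt (K := K) rhs2 I J ≠ 0) :
    J = I.shift 0 1 ∨ (J = I.shift 1 (-1) ∧ I.m ≠ 0) ∨ J.wt < I.wt := by
  by_contra! hn
  refine h ?_
  have h1 : coeffAt (K := K) low2 I J = 0 := by
    by_contra h1
    have := wt_of_coeffAt_low2 h1
    omega
  rw [coeffAt] at h1 ⊢
  rw [rhs2, h1, if_neg (Ne.symm hn.1), mul_zero, zero_sub, add_zero, neg_eq_zero]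
  split_ifs with h2
  · rw [hn.2.1 h2.symm]; simp
  · rw [mul_zero]

theorem of_coeffAt_rhs4 {I J : Idx} (h : coeffAt (K := K) rhs4 I J ≠ 0) :
    (J = I.shift 1 (-1) ∧ I.k ≠ 1) ∨ J.wt < I.wt := by
  by_contra! hn
  refine h ?_
  have h1 : coeffAt (K := K) low4 (I.shift 0 (-1)) J = 0 := by
    by_contra h1
    exact absurd (wt_lt_of_coeffAt_low4 h1) (not_lt.mpr hn.2)
  rw [coeffAt] at h1 ⊢
  rw [rhs4, h1, add_zero, neg_eq_zero]
  split_ifs with h2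
  · rw [hn.1 h2.symm]; simp
  · rw [mul_zero]

theorem of_coeffAt_rhs6a {I J : Idx} (h : coeffAt (K := K) rhs6a I J ≠ 0) :
    J = I.shift 1 (-2) ∨ J.wt < I.wt := by
  by_contra! hn
  refine h ?_
  have h1 : coeffAt (K := K) low6 (I.shift 0 (-2)) J = 0 := by
    by_contra h1
    exact absurd (wt_lt_of_coeffAt_low6 h1) (not_lt.mpr hn.2)
  rw [coeffAt] at h1 ⊢
  rw [rhs6a, h1, if_neg (Ne.symm hn.1), mul_zero, neg_zero, add_zero]

theorem of_coeffAt_rhs6b {I J : Idx} (h : coeffAt (K := K) rhs6b I J ≠ 0) :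
    J = I.shift (-1) 2 ∨ J.wt < I.wt := by
  by_contra! hn
  refine h ?_
  have h1 : coeffAt (K := K) low6 (I.shift (-1) 0) J = 0 := by
    by_contra h1
    exact absurd (wt_lt_of_coeffAt_low6 h1) (not_lt.mpr hn.2)
  rw [coeffAt] at h1 ⊢
  rw [rhs6b, h1, if_neg (Ne.symm hn.1), neg_zero, add_zero, mul_zero]

theorem of_coeffAt_rhs8 {I J : Idx} (h : coeffAt (K := K) rhs8 I J ≠ 0) : J.wt < I.wt :=
  wt_lt_of_coeffAt_low8 (I := I.shift (-1) (-1)) h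

theorem of_coeffAt_rhs10 {I J : Idx} (h : coeffAt (K := K) rhs10 I J ≠ 0) : J.wt < I.wt :=
  wt_lt_of_coeffAt_low10 (I := I.shift (-2) 0) h

/-! ### Chains of steps of the recursion schemes -/

theorem Idx.Nonneg.wt_nonneg {I : Idx} (h : I.Nonneg) : 0 ≤ I.wt := by
  obtain ⟨_, _, _, h⟩ := h
  simp only [Idx.wt]
  omega

/-- The weight vanishes only for `n = 0`. -/
theorem Idx.Nonneg.eq_start {I : Idx} (h : I.Nonneg) (hw : I.wt = 0) (hl : I.l = 1)
    (hm : I.m = 0) : I = Idx.start := by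
  obtain ⟨l, m, n4, n6, n8, n10, n12, n14⟩ := I
  obtain ⟨_, _, _, h⟩ := h
  simp only [Idx.wt, Idx.start, Idx.mk.injEq] at *
  omega

/-- A bound for the number of further steps without loss of weight in the first scheme. Such steps
by `P₂` lower `k` by `3` or `2`. At `k = 1` every step loses weight, as the leading term on the
right hand side of `P₄` has the factor `k - 1`. At `k = 0` the only steps without loss of weight,
by `P₆`, lead to `k = 1`. -/
def pot1 (I : Idx) : ℤ := if I.k = 0 then 1 else if I.k = 1 then 0 else I.k

open Classical in
/-- A bound for the number of further steps without loss of weight in the second scheme. In terms of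
`(ℓ, m)`, these steps are `(0, 0) → (0, 1)` by `P₂`, `(0, m) → (1, m - 1)` by `P₄`,
`(0, m) → (1, m - 2)` by `P₆` if `k = 0`, and `(1, 0) → (0, 2)` by `P₆`. The last two of them do not
make a cycle: `(0, 2) → (1, 0)` by `P₆` occurs only at weight zero, where it leads to the start. -/
def pot2 (I : Idx) : ℤ :=
  if I = Idx.start ∨ 1 < I.l then 0
  else if I.l = 1 then if I.m = 0 then 2 else 0
  else if I.m = 0 then 4 else if I.m = 1 then 3 else 1

theorem pot1_nonneg {I : Idx} (h : I.Nonneg) : 0 ≤ pot1 I := by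
  have := h.1
  unfold pot1
  split_ifs <;> omega

theorem pot2_nonneg (I : Idx) : 0 ≤ pot2 I := by
  unfold pot2
  split_ifs <;> omega

theorem step_rule1 {I J : Idx} (h : Step (K := K) rule1 I J) :
    J.wt < I.wt ∨ (J.wt = I.wt ∧ pot1 J < pot1 I) := by
  obtain ⟨hI, h0, hJ, hc⟩ := h
  have hk := hI.1
  have hk' := hJ.1
  rw [coeffAt] at hc
  unfold rule1 at hc
  split_ifs at hc with h1 h2 h3 h4
  · rcases of_coeffAt_rhs2 hc with rfl | ⟨rfl, -⟩ | h
    · right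
      rw [k_shift] at hk'
      refine ⟨rfl, ?_⟩
      unfold pot1
      rw [k_shift]
      split_ifs <;> omega
    · right
      rw [k_shift] at hk'
      refine ⟨rfl, ?_⟩
      unfold pot1
      rw [k_shift]
      split_ifs <;> omega
    · exact Or.inl h
  · rcases of_coeffAt_rhs4 hc with ⟨-, h⟩ | h
    · exact absurd h2.1 h
    · exact Or.inl h
  · rcases of_coeffAt_rhs6a hc with rfl | h
    · right
      refine ⟨rfl, ?_⟩
      unfold pot1
      rw [k_shift]
      split_ifs <;> omega
    · exact Or.inl h
  · exact Or.inl (of_coeffAt_rhs8 hc)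
  · exact Or.inl (of_coeffAt_rhs10 hc)

theorem step_rule2 {I J : Idx} (h : Step (K := K) rule2 I J) :
    J.wt < I.wt ∨ (J.wt = I.wt ∧ pot2 J < pot2 I) := by
  obtain ⟨hI, h0, hJ, hc⟩ := h
  have hk := hI.1
  have hl := hI.2.1
  have hm := hI.2.2.1
  rw [coeffAt] at hc
  unfold rule2 at hc
  split_ifs at hc with h1 h2 h3 h4 h5
  · exact Or.inl (of_coeffAt_rhs10 hc)
  · exact Or.inl (of_coeffAt_rhs8 hc)
  · rcases of_coeffAt_rhs6b hc with rfl | h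
    · right
      refine ⟨rfl, ?_⟩
      have e1 : (I.shift (-1) 2).l = I.l - 1 := rfl
      have e2 : (I.shift (-1) 2).m = I.m + 2 := rfl
      have e3 : I.shift (-1) 2 ≠ Idx.start := fun e => by
        have : I.l - 1 = 1 := congrArg Idx.l e
        omega
      unfold pot2
      rw [e1, e2]
      simp only [e3, h0, false_or]
      split_ifs <;> omega
    · exact Or.inl h
  · rcases of_coeffAt_rhs4 hc with ⟨rfl, h⟩ | h
    · right
      refine ⟨rfl, ?_⟩
      have e1 : (I.shift 1 (-1)).l = I.l + 1 := rfl
      have e2 : (I.shift 1 (-1)).m = I.m - 1 := rfl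
      unfold pot2
      rw [e1, e2]
      simp only [h0, false_or]
      split_ifs <;> omega
    · exact Or.inl h
  · rcases of_coeffAt_rhs6a hc with rfl | h
    · right
      refine ⟨rfl, ?_⟩
      have e1 : (I.shift 1 (-2)).l = I.l + 1 := rfl
      have e2 : (I.shift 1 (-2)).m = I.m - 2 := rfl
      have hm' : 0 ≤ I.m - 2 := hJ.2.2.1
      have e3 : I.m = 2 → I.shift 1 (-2) = Idx.start := fun e => by
        refine hJ.eq_start ?_ (by omega) (by omega)
        have := k_shift I 1 (-2)
        have h6 : (I.shift 1 (-2)).k =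
          6 - 5 * (I.shift 1 (-2)).l - 3 * (I.shift 1 (-2)).m + (I.shift 1 (-2)).wt := rfl
        omega
      unfold pot2
      rw [e1, e2]
      simp only [h0, false_or]
      by_cases e : I.m = 2
      · rw [if_pos (Or.inl (e3 e))]
        split_ifs <;> omega
      · split_ifs <;> omega
    · exact Or.inl h
  · rcases of_coeffAt_rhs2 hc with rfl | ⟨-, h⟩ | h
    · right
      refine ⟨rfl, ?_⟩
      have e1 : (I.shift 0 1).l = I.l + 0 := rfl
      have e2 : (I.shift 0 1).m = I.m + 1 := rfl
      unfold pot2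
      rw [e1, e2]
      simp only [h0, false_or]
      split_ifs <;> omega
    · omega
    · exact Or.inl h

/-- If every step without loss of weight lowers a potential, then so does a chain of such steps, by
at least its length. -/
theorem chain_wt {rule : (Idx → K) → Idx → K} {pot : Idx → ℤ}
    (hstep : ∀ {I J : Idx}, Step rule I J → J.wt < I.wt ∨ (J.wt = I.wt ∧ pot J < pot I))
    (t : ℕ) (s : ℕ → Idx) (hs : ∀ i < t, Step rule (s i) (s (i + 1))) :
    (s t).wt < (s 0).wt ∨ ((s t).wt = (s 0).wt ∧ pot (s t) + t ≤ pot (s 0)) := by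
  induction t with
  | zero => right; simp
  | succ t ih =>
    have h1 := ih fun i hi => hs i (by omega)
    have h2 := hstep (hs t (by omega))
    push_cast
    omega

theorem wellFounded_step {rule : (Idx → K) → Idx → K} {pot : Idx → ℤ}
    (hpot : ∀ I : Idx, I.Nonneg → 0 ≤ pot I)
    (hstep : ∀ {I J : Idx}, Step rule I J → J.wt < I.wt ∨ (J.wt = I.wt ∧ pot J < pot I)) :
    WellFounded fun J I => Step rule I J := by
  refine Subrelation.wf (r := InvImage (Prod.Lex (· < ·) (· < ·))
    fun I : Idx => (I.wt.toNat, (pot I).toNat)) (fun {J I} h => ?_)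
    (InvImage.wf _ (WellFounded.prod_lex wellFounded_lt wellFounded_lt))
  have h1 := h.2.2.1.wt_nonneg
  have h2 := hpot J h.2.2.1
  simp only [InvImage, Prod.lex_def]
  rcases hstep h with h3 | ⟨h3, h4⟩
  · left; omega
  · right; constructor <;> omega

theorem chain_rule1 (t : ℕ) (s : ℕ → Idx)
    (hs : ∀ i < t, Step (K := K) rule1 (s i) (s (i + 1))) :
    (s t).wt ≤ (s 0).wt ∧ (max (s 0).k 1 < t → (s t).wt < (s 0).wt) := by
  have h := chain_wt step_rule1 t s hs
  refine ⟨by omega, fun ht => h.resolve_right fun ⟨_, h2⟩ => ?_⟩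
  obtain ⟨t, rfl⟩ : ∃ t', t = t' + 1 := ⟨t - 1, by omega⟩
  have h3 := pot1_nonneg (hs t (by omega)).2.2.1
  have h4 : pot1 (s 0) ≤ max (s 0).k 1 := by
    unfold pot1
    split_ifs <;> omega
  omega

theorem chain_rule2 (t : ℕ) (s : ℕ → Idx)
    (hs : ∀ i < t, Step (K := K) rule2 (s i) (s (i + 1))) :
    (s t).wt ≤ (s 0).wt ∧ (5 ≤ t → (s t).wt < (s 0).wt) := by
  have h := chain_wt step_rule2 t s hs
  refine ⟨by omega, fun ht => h.resolve_right fun ⟨_, h2⟩ => ?_⟩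
  have h3 := pot2_nonneg (s t)
  have h4 : pot2 (s 0) ≤ 4 := by
    unfold pot2
    split_ifs <;> omega
  omega

/-! ### Solutions of the recursion schemes -/

/-- A family that vanishes at the indices that are not admissible and agrees with a recursion
scheme at the others, except possibly at the start, is determined by its value at the start. -/
theorem eq_smul_of_rule {rule : (Idx → K) → Idx → K}
    (hwf : WellFounded fun J I => Step rule I J) (hfin : ∀ I, FiniteForm fun b => rule b I)
    {b b' : Idx → K} (hb : ∀ I : Idx, ¬ I.Nonneg → b I = 0)
    (hb' : ∀ I : Idx, ¬ I.Nonneg → b' I = 0) (hs : b Idx.start = 1)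
    (hr : ∀ I : Idx, I.Nonneg → I ≠ Idx.start → b I = rule b I)
    (hr' : ∀ I : Idx, I.Nonneg → I ≠ Idx.start → b' I = rule b' I) :
    b' = b' Idx.start • b := by
  funext I
  induction I using hwf.induction with
  | _ I ih =>
    by_cases hI : I.Nonneg
    · by_cases h0 : I = Idx.start
      · simp [h0, hs]
      · rw [hr' I hI h0, Pi.smul_apply, smul_eq_mul, hr I hI h0, ← (hfin I).map_smul]
        refine (hfin I).congr fun J hJ => ?_
        by_cases hJ' : J.Nonneg
        · exact ih J ⟨hI, h0, hJ', hJ⟩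
        · simp [hb J hJ', hb' J hJ']
    · simp [hb I hI, hb' I hI]

open Classical in
/-- Existence of a solution by recursion along the steps of the scheme. -/
theorem exists_scheme {rule : (Idx → K) → Idx → K}
    (hwf : WellFounded fun J I => Step rule I J) (hfin : ∀ I, FiniteForm fun b => rule b I) :
    ∃ b, Scheme rule b := by
  let F : ∀ I : Idx, (∀ J, Step rule I J → K) → K := fun I rec =>
    if ¬ I.Nonneg then 0 else if I = Idx.start then 1
    else rule (fun J => if h : Step rule I J then rec J h else 0) I
  -- setting the values at other indices to zero is harmless, as their coefficients vanish
  refine ⟨hwf.fix F, fun I => ?_⟩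
  rw [hwf.fix_eq]
  simp only [F]
  split_ifs with hI h0
  · rfl
  · refine (hfin I).congr fun J hJ => ?_
    by_cases hJ' : J.Nonneg
    · rw [dif_pos ⟨hI, h0, hJ', hJ⟩]
    · rw [dif_neg fun h => hJ' h.2.2.1, hwf.fix_eq]
      simp only
      rw [if_pos hJ']
  · rfl

theorem Idx.start_nonneg : Idx.start.Nonneg := by
  simp [Idx.Nonneg, Idx.start, Idx.k, Idx.wt]

theorem scheme_iff {rule : (Idx → K) → Idx → K} {b : Idx → K} : Scheme rule b ↔
    (∀ I : Idx, ¬ I.Nonneg → b I = 0) ∧ b Idx.start = 1 ∧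
      ∀ I : Idx, I.Nonneg → I ≠ Idx.start → b I = rule b I := by
  constructor
  · intro h
    refine ⟨fun I hI => ?_, ?_, fun I hI h0 => ?_⟩
    · rw [h I, if_pos hI]
    · rw [h, if_neg (not_not.mpr Idx.start_nonneg), if_pos rfl]
    · conv_lhs => rw [h I]
      rw [if_neg (not_not.mpr hI), if_neg h0]
  · rintro ⟨h1, h2, h3⟩ I
    split_ifs with hI h0
    · rw [h0, h2]
    · exact h3 I hI h0
    · exact h1 I hI

theorem wellFounded_rule1 : WellFounded fun J I => Step (K := K) rule1 I J :=
  wellFounded_step (fun _ => pot1_nonneg) step_rule1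

theorem wellFounded_rule2 : WellFounded fun J I => Step (K := K) rule2 I J :=
  wellFounded_step (fun _ _ => pot2_nonneg _) step_rule2

/-- All of the recurrences hold for the family `b`. -/
def Recurrences (b : Idx → K) : Prop :=
  (∀ I : Idx, I.Nonneg → 2 ≤ I.k → P2 b I) ∧ (∀ I : Idx, I.Nonneg → 4 ≤ I.k → P4 b I) ∧
  (∀ I : Idx, I.Nonneg → 6 ≤ I.k → P6 b I) ∧ (∀ I : Idx, I.Nonneg → 8 ≤ I.k → P8 b I) ∧
  (∀ I : Idx, I.Nonneg → 10 ≤ I.k → P10 b I)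

theorem P2.eq_rhs {b : Idx → K} {I : Idx} (h : P2 b I) : b I = rhs2 b I := h

theorem P4.eq_rhs {b : Idx → K} {I : Idx} (h : P4 b (I.shift 0 (-1))) : b I = rhs4 b I := by
  rw [P4, shift_shift, shift_shift, zero_add, neg_add_cancel, shift_zero] at h
  exact h

theorem P6.eq_rhs_a {b : Idx → K} {I : Idx} (h : P6 b (I.shift 0 (-2))) :
    b I = rhs6a b I := by
  rw [P6, shift_shift, shift_shift, zero_add, neg_add_cancel, shift_zero] at h
  rw [rhs6a, ← h]
  ring_nf

theorem P6.eq_rhs_b [CharZero K] {b : Idx → K} {I : Idx} (h : P6 b (I.shift (-1) 0)) :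
    b I = rhs6b b I := by
  rw [P6, shift_shift, shift_shift, add_zero, zero_add, neg_add_cancel, add_zero,
    shift_zero] at h
  rw [rhs6b, ← h]
  ring_nf

theorem P8.eq_rhs {b : Idx → K} {I : Idx} (h : P8 b (I.shift (-1) (-1))) :
    b I = rhs8 b I := by
  rw [P8, shift_shift, neg_add_cancel, shift_zero] at h
  exact h

theorem P10.eq_rhs {b : Idx → K} {I : Idx} (h : P10 b (I.shift (-2) 0)) :
    b I = rhs10 b I := by
  rw [P10, shift_shift, add_zero, neg_add_cancel, shift_zero] at h
  exact h

theorem Idx.Nonneg.shift {I : Idx} (h : I.Nonneg) {dl dm : ℤ} (hl : 0 ≤ I.l + dl)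
    (hm : 0 ≤ I.m + dm) (hk : 0 ≤ (I.shift dl dm).k) : (I.shift dl dm).Nonneg :=
  ⟨hk, hl, hm, h.2.2.2⟩

/-- Whenever a scheme uses a recurrence, its translate lies in the range where it is required. In
the last case of the first scheme, this rests on `ℓ ≥ 2`: as `k ≤ 1` and `m = 0` there, `ℓ = 0`
would force a negative weight, and `ℓ = 1` leaves only the start. -/
theorem Recurrences.rule1 {b : Idx → K} (h : Recurrences b) {I : Idx} (hI : I.Nonneg)
    (h0 : I ≠ Idx.start) : b I = rule1 b I := by
  have hk := hI.1
  have hl := hI.2.1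
  have hm := hI.2.2.1
  have hdef : I.k = 6 - 5 * I.l - 3 * I.m + I.wt := rfl
  have hw := hI.wt_nonneg
  have e := fun dl dm => k_shift I dl dm
  unfold HyperellipticSigma.rule1
  split_ifs with h1 h2 h3 h4
  · exact (h.1 I hI (by omega)).eq_rhs
  · have := e 0 (-1)
    exact (h.2.1 _ (hI.shift (by omega) (by omega) (by omega)) (by omega)).eq_rhs
  · have := e 0 (-2)
    exact (h.2.2.1 _ (hI.shift (by omega) (by omega) (by omega)) (by omega)).eq_rhs_a
  · have := e (-1) (-1)
    exact (h.2.2.2.1 _ (hI.shift (by omega) (by omega) (by omega)) (by omega)).eq_rhs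
  · have := e (-2) 0
    have h5 : I.l ≠ 1 := fun h5 => h0 (hI.eq_start (by omega) h5 (by omega))
    exact (h.2.2.2.2 _ (hI.shift (by omega) (by omega) (by omega)) (by omega)).eq_rhs

theorem Recurrences.rule2 [CharZero K] {b : Idx → K} (h : Recurrences b) {I : Idx}
    (hI : I.Nonneg) : b I = rule2 b I := by
  have hk := hI.1
  have hl := hI.2.1
  have hm := hI.2.2.1
  have hdef : I.k = 6 - 5 * I.l - 3 * I.m + I.wt := rfl
  have hw := hI.wt_nonneg
  have e := fun dl dm => k_shift I dl dm
  unfold HyperellipticSigma.rule2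
  split_ifs with h1 h2 h3 h4 h5
  · have := e (-2) 0
    exact (h.2.2.2.2 _ (hI.shift (by omega) (by omega) (by omega)) (by omega)).eq_rhs
  · have := e (-1) (-1)
    exact (h.2.2.2.1 _ (hI.shift (by omega) (by omega) (by omega)) (by omega)).eq_rhs
  · have := e (-1) 0
    exact (h.2.2.1 _ (hI.shift (by omega) (by omega) (by omega)) (by omega)).eq_rhs_b
  · have := e 0 (-1)
    exact (h.2.1 _ (hI.shift (by omega) (by omega) (by omega)) (by omega)).eq_rhs
  · have := e 0 (-2)
    exact (h.2.2.1 _ (hI.shift (by omega) (by omega) (by omega)) (by omega)).eq_rhs_a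
  · exact (h.1 I hI (by omega)).eq_rhs

theorem mem_solutionSpace {φ : Series K} : φ ∈ solutionSpace K ↔ ∀ j, heat j φ = 0 := by
  simp [solutionSpace, Submodule.mem_iInf]

theorem hurwitz_mem_solutionSpace [CharZero K] {b : Idx → K}
    (hb : ∀ I : Idx, ¬ I.Nonneg → b I = 0) :
    hurwitz b ∈ solutionSpace K ↔ Recurrences b := by
  rw [mem_solutionSpace, Recurrences, ← heat_one_hurwitz_eq_zero_iff hb,
    ← heat_two_hurwitz_eq_zero_iff hb, ← heat_three_hurwitz_eq_zero_iff hb,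
    ← heat_four_hurwitz_eq_zero_iff hb, ← heat_five_hurwitz_eq_zero_iff hb]
  constructor
  · intro h
    exact ⟨h 1, h 2, h 3, h 4, h 5⟩
  · rintro ⟨h1, h2, h3, h4, h5⟩ j
    fin_cases j
    exacts [heat_zero_hurwitz hb, h1, h2, h3, h4, h5]

theorem hurwitz_smul [CharZero K] (c : K) {b : Idx → K} (hb : ∀ I : Idx, ¬ I.Nonneg → b I = 0) :
    hurwitz (c • b) = c • hurwitz b := by
  have e : c • hurwitz b = MvPowerSeries.C (MvPolynomial.C c) * hurwitz b := by
    refine MvPowerSeries.ext fun d => ?_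
    rw [MvPowerSeries.coeff_C_mul, ← MvPolynomial.smul_eq_C_mul]
    rfl
  rw [← sub_eq_zero, e]
  refine eq_zero_of_hc fun l m k n4 n6 n8 n10 n12 n14 _ _ _ => ?_
  rw [hc_sub, hc_C_mul, hc_hurwitz hb, hc_hurwitz fun I hI => by simp [hb I hI]]
  split_ifs <;> simp

/-- As soon as the recurrences have a solution with value `1` at the start, the two schemes have
it as their only solution, and it spans the space of solutions of the heat equations. -/
theorem schemes_of_recurrences [CharZero K] {b : Idx → K}
    (hb : ∀ I : Idx, ¬ I.Nonneg → b I = 0) (hs : b Idx.start = 1) (h : Recurrences b) :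
    (∀ b' : Idx → K, Scheme rule1 b' ↔ b' = b) ∧ (∀ b' : Idx → K, Scheme rule2 b' ↔ b' = b) ∧
      solutionSpace K = Submodule.span K {hurwitz b} := by
  have h1 : Scheme rule1 b := scheme_iff.mpr ⟨hb, hs, fun _ hI h0 => h.rule1 hI h0⟩
  have h2 : Scheme rule2 b := scheme_iff.mpr ⟨hb, hs, fun _ hI _ => h.rule2 hI⟩
  refine ⟨fun b' => ⟨fun h' => ?_, fun e => e ▸ h1⟩, fun b' => ⟨fun h' => ?_, fun e => e ▸ h2⟩, ?_⟩
  · obtain ⟨hb', hs', hr'⟩ := scheme_iff.mp h'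
    have := eq_smul_of_rule wellFounded_rule1 FiniteForm.rule1 hb hb' hs
      (scheme_iff.mp h1).2.2 hr'
    rwa [hs', one_smul] at this
  · obtain ⟨hb', hs', hr'⟩ := scheme_iff.mp h'
    have := eq_smul_of_rule wellFounded_rule2 FiniteForm.rule2 hb hb' hs
      (scheme_iff.mp h2).2.2 hr'
    rwa [hs', one_smul] at this
  · refine le_antisymm (fun φ hφ => ?_) ?_
    · obtain ⟨b', hb', rfl⟩ := exists_eq_hurwitz (mem_solutionSpace.mp hφ 0)
      have h' := (hurwitz_mem_solutionSpace hb').mp hφ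
      rw [Submodule.mem_span_singleton]
      refine ⟨b' Idx.start, ?_⟩
      rw [← hurwitz_smul _ hb, ← eq_smul_of_rule wellFounded_rule1 FiniteForm.rule1 hb hb' hs
        (scheme_iff.mp h1).2.2 fun I hI h0 => h'.rule1 hI h0]
    · rw [Submodule.span_singleton_le_iff_mem]
      exact (hurwitz_mem_solutionSpace hb).mpr h

theorem hurwitz_ne_zero [CharZero K] {b : Idx → K} (hb : ∀ I : Idx, ¬ I.Nonneg → b I = 0)
    (hs : b Idx.start = 1) : hurwitz b ≠ 0 := fun h => by
  have := hc_hurwitz_of_eq hb (l := 1) (m := 0) (k := 1) (n4 := 0) (n6 := 0) (n8 := 0)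
    (n10 := 0) (n12 := 0) (n14 := 0) rfl
  rw [h, hc_zero] at this
  exact zero_ne_one (this.trans hs)

/-! ### Commutators of quadratic operators -/

section Quadratic

variable {ι R A : Type*} [Fintype ι] [CommRing R] [Ring A]

/-- The quadratic expression `∑ f(S_{ab}) z_a z_b` in elements `z_a` of a ring. -/
def quad (f : R →+* A) (z : ι → A) (S : Matrix ι ι R) : A := ∑ a, ∑ b, f (S a b) * (z a * z b)

theorem quad_add (f : R →+* A) (z : ι → A) (S T : Matrix ι ι R) :
    quad f z (S + T) = quad f z S + quad f z T := by
  simp [quad, add_mul, Finset.sum_add_distrib]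

theorem quad_sub (f : R →+* A) (z : ι → A) (S T : Matrix ι ι R) :
    quad f z (S - T) = quad f z S - quad f z T := by
  simp [quad, sub_mul, Finset.sum_sub_distrib]

theorem quad_smul (f : R →+* A) (z : ι → A) (p : R) (S : Matrix ι ι R) :
    quad f z (p • S) = f p * quad f z S := by
  simp [quad, mul_assoc, Finset.mul_sum]

theorem quad_sum {κ : Type*} (f : R →+* A) (z : ι → A) (s : Finset κ) (S : κ → Matrix ι ι R) :
    quad f z (∑ k ∈ s, S k) = ∑ k ∈ s, quad f z (S k) := by
  classical
  induction s using Finset.induction_on with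
  | empty => simp [quad]
  | insert k s hk ih => rw [Finset.sum_insert hk, Finset.sum_insert hk, quad_add, ih]

/-- If the commutators of the `z_a` are the scalars `ω_{ab}`, then `[∑ S_{ab} z_a z_b, z_c]` is
linear in the `z_a`, with coefficients from `2 S ω`. -/
theorem quad_mul_sub_mul_quad (f : R →+* A) (z : ι → A) (ω S : Matrix ι ι R)
    (hf : ∀ p a, z a * f p = f p * z a) (hz : ∀ a b, z a * z b - z b * z a = f (ω a b))
    (hS : S.transpose = S) (c : ι) :
    quad f z S * z c - z c * quad f z S = ∑ a, f (2 * (S * ω) a c) * z a := by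
  have h1 : ∀ a b, f (S a b) * (z a * z b) * z c - z c * (f (S a b) * (z a * z b)) =
      f (S a b * ω b c) * z a + f (S a b * ω a c) * z b := by
    intro a b
    have h2 := hz b c
    have h3 := hz a c
    calc _ = f (S a b) * (z a * (z b * z c - z c * z b))
          + f (S a b) * ((z a * z c - z c * z a) * z b)
          + (f (S a b) * z c - z c * f (S a b)) * (z a * z b) := by noncomm_ring
      _ = _ := by
        rw [h2, h3, hf, hf, sub_self, zero_mul, add_zero, map_mul, map_mul]
        simp only [mul_assoc]
  have h4 : quad f z S * z c - z c * quad f z S = (∑ a, ∑ b, f (S a b * ω b c) * z a)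
      + ∑ a, ∑ b, f (S a b * ω a c) * z b := by
    simp only [quad, Finset.sum_mul, Finset.mul_sum, ← Finset.sum_sub_distrib, h1,
      Finset.sum_add_distrib]
  have h5 : ∑ a, ∑ b, f (S a b * ω a c) * z b = ∑ a, ∑ b, f (S a b * ω b c) * z a := by
    rw [Finset.sum_comm]
    refine Finset.sum_congr rfl fun a _ => Finset.sum_congr rfl fun b _ => ?_
    rw [← Matrix.transpose_apply S a b, hS]
  rw [h4, h5, ← Finset.sum_add_distrib]
  refine Finset.sum_congr rfl fun a _ => ?_
  rw [Matrix.mul_apply, two_mul, map_add, add_mul, map_sum, Finset.sum_mul]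

/-- The commutator of two quadratic expressions. -/
theorem quad_mul_quad_sub (f : R →+* A) (z : ι → A) (ω S T : Matrix ι ι R)
    (hf : ∀ p a, z a * f p = f p * z a) (hz : ∀ a b, z a * z b - z b * z a = f (ω a b))
    (hω : ω.transpose = -ω) (hS : S.transpose = S) :
    quad f z S * quad f z T - quad f z T * quad f z S =
      2 * quad f z (S * ω * T - T * ω * S) := by
  have hq : ∀ p, quad f z S * f p = f p * quad f z S := by
    intro p
    simp only [quad, Finset.sum_mul, Finset.mul_sum]
    refine Finset.sum_congr rfl fun a _ => Finset.sum_congr rfl fun b _ => ?_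
    rw [mul_assoc, mul_assoc, hf, ← mul_assoc (z a), hf, mul_assoc, ← mul_assoc (f (S a b)),
      ← mul_assoc (f p), ← f.map_mul, ← f.map_mul, mul_comm p]
  have h1 : ∀ c d, quad f z S * (f (T c d) * (z c * z d)) - f (T c d) * (z c * z d) * quad f z S =
      f (T c d) * ((∑ a, f (2 * (S * ω) a c) * z a) * z d)
        + f (T c d) * (z c * ∑ a, f (2 * (S * ω) a d) * z a) := by
    intro c d
    rw [← quad_mul_sub_mul_quad f z ω S hf hz hS, ← quad_mul_sub_mul_quad f z ω S hf hz hS,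
      ← mul_assoc, hq]
    noncomm_ring
  have h2 : quad f z S * quad f z T - quad f z T * quad f z S =
      (∑ c, ∑ d, f (T c d) * ((∑ a, f (2 * (S * ω) a c) * z a) * z d))
        + ∑ c, ∑ d, f (T c d) * (z c * ∑ a, f (2 * (S * ω) a d) * z a) := by
    conv_lhs => enter [1, 2]; rw [quad]
    conv_lhs => enter [2, 1]; rw [quad]
    simp only [Finset.sum_mul, Finset.mul_sum, ← Finset.sum_sub_distrib]
    simp only [← Finset.sum_add_distrib]
    refine Finset.sum_congr rfl fun c _ => Finset.sum_congr rfl fun d _ => ?_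
    rw [h1]
    simp only [Finset.sum_mul, Finset.mul_sum, Finset.sum_add_distrib]
  have h3 : (∑ c, ∑ d, f (T c d) * ((∑ a, f (2 * (S * ω) a c) * z a) * z d)) =
      2 * quad f z (S * ω * T) := by
    rw [← map_ofNat f 2, ← quad_smul, quad, Finset.sum_comm]
    simp only [Finset.sum_mul, Finset.mul_sum]
    conv_lhs => enter [2, d]; rw [Finset.sum_comm]
    rw [Finset.sum_comm]
    refine Finset.sum_congr rfl fun a _ => Finset.sum_congr rfl fun d _ => ?_
    rw [Matrix.smul_apply, Matrix.mul_apply, Finset.smul_sum, map_sum, Finset.sum_mul]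
    refine Finset.sum_congr rfl fun c _ => ?_
    rw [mul_assoc, ← mul_assoc, ← map_mul, smul_eq_mul]
    congr 2
    ring
  have h4 : (∑ c, ∑ d, f (T c d) * (z c * ∑ a, f (2 * (S * ω) a d) * z a)) =
      2 * quad f z (-(T * ω * S)) := by
    have h5 : -(T * ω * S) = T * (S * ω).transpose := by
      rw [Matrix.transpose_mul, hω, hS, mul_assoc]; simp
    rw [h5, ← map_ofNat f 2, ← quad_smul, quad]
    refine Finset.sum_congr rfl fun c _ => ?_
    simp only [Finset.mul_sum]
    rw [Finset.sum_comm]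
    refine Finset.sum_congr rfl fun a _ => ?_
    rw [Matrix.smul_apply, Matrix.mul_apply, Finset.smul_sum, map_sum, Finset.sum_mul]
    refine Finset.sum_congr rfl fun d _ => ?_
    rw [← mul_assoc (z c), hf, mul_assoc, ← mul_assoc, ← map_mul, smul_eq_mul,
      Matrix.transpose_apply]
    congr 2
    ring
  rw [h2, h3, h4, sub_eq_add_neg, quad_add, mul_add]

end Quadratic

/-! ### The heat operators as elements of a ring of operators -/

/-- Multiplication by an element of `K[μ]`, as an operator on power series. -/
def mulC : Params K →+* Module.End K (Series K) :=
  (Algebra.lmul K (Series K)).toRingHom.comp MvPowerSeries.C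

theorem mulC_apply (p : Params K) (φ : Series K) : mulC p φ = MvPowerSeries.C p * φ := rfl

/-- The operators `∂/∂u_a` and `u_a`. -/
def weyl : Fin 3 ⊕ Fin 3 → Module.End K (Series K) :=
  Sum.elim
    (fun a =>
      (MvPowerSeries.pderiv (Params K) a : Series K →ₗ[Params K] Series K).restrictScalars K)
    (fun a => Algebra.lmul K (Series K) (MvPowerSeries.X a))

@[simp] theorem weyl_inl (a : Fin 3) (φ : Series K) : weyl (Sum.inl a) φ = D a φ := rfl

@[simp] theorem weyl_inr (a : Fin 3) (φ : Series K) :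
    weyl (Sum.inr a) φ = MvPowerSeries.X a * φ := rfl

/-- The matrix of the commutators of the operators `∂/∂u_a`, `u_a`. -/
def omega : Matrix (Fin 3 ⊕ Fin 3) (Fin 3 ⊕ Fin 3) (Params K) := Matrix.fromBlocks 0 1 (-1) 0

theorem omega_transpose : (omega (K := K)).transpose = -omega := by
  simp [omega, Matrix.fromBlocks_transpose, Matrix.fromBlocks_neg]

theorem D_X_mul (a b : Fin 3) (φ : Series K) :
    D a (MvPowerSeries.X b * φ) =
      MvPowerSeries.X b * D a φ + MvPowerSeries.C ((1 : Matrix _ _ (Params K)) a b) * φ := by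
  rw [D, Derivation.leibniz, MvPowerSeries.pderiv_X, smul_eq_mul, smul_eq_mul, Matrix.one_apply]
  by_cases h : b = a
  · subst h; simp
  · have h' : a ≠ b := fun h' => h h'.symm
    simp [h, h']

theorem D_C_mul (a : Fin 3) (p : Params K) (φ : Series K) :
    D a (MvPowerSeries.C p * φ) = MvPowerSeries.C p * D a φ := by
  rw [← MvPowerSeries.smul_eq_C_mul, ← MvPowerSeries.smul_eq_C_mul]
  exact (MvPowerSeries.pderiv (Params K) a).map_smul _ _

theorem D_comm (a b : Fin 3) (φ : Series K) : D a (D b φ) = D b (D a φ) := by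
  by_cases h : a = b
  · rw [h]
  refine MvPowerSeries.ext fun d => ?_
  simp only [MvPowerSeries.coeff_pderiv, add_right_comm d (Finsupp.single b 1)]
  simp [h, Ne.symm h]
  ring

theorem weyl_mul_mulC (p : Params K) (a : Fin 3 ⊕ Fin 3) : weyl a * mulC p = mulC p * weyl a := by
  refine LinearMap.ext fun φ => ?_
  rcases a with a | a
  · exact D_C_mul a p φ
  · change MvPowerSeries.X a * (MvPowerSeries.C p * φ) = MvPowerSeries.C p * (MvPowerSeries.X a * φ)
    ring

theorem weyl_commutator (a b : Fin 3 ⊕ Fin 3) :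
    weyl (K := K) a * weyl b - weyl b * weyl a = mulC (omega a b) := by
  refine LinearMap.ext fun φ => ?_
  rw [LinearMap.sub_apply, Module.End.mul_apply, Module.End.mul_apply, mulC_apply]
  rcases a with a | a <;> rcases b with b | b
  · simp [omega, D_comm a b]
  · rw [weyl_inl, weyl_inr, weyl_inl, weyl_inr, D_X_mul, add_sub_cancel_left]
    rfl
  · rw [weyl_inl, weyl_inr, weyl_inl, weyl_inr, D_X_mul, sub_add_cancel_left, ← neg_mul, ← map_neg]
    simp [omega, Matrix.one_apply, eq_comm]
  · simp [omega]; ring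

/-- The symmetric matrix of the quadratic part of the heat operator. -/
def symbol (j : Fin 6) : Matrix (Fin 3 ⊕ Fin 3) (Fin 3 ⊕ Fin 3) (Params K) :=
  Matrix.fromBlocks (α j) (β j) (β j).transpose (γ j)

theorem α_transpose (j : Fin 6) : (α (K := K) j).transpose = α j := by
  ext1 a b
  fin_cases j <;> fin_cases a <;> fin_cases b <;> rfl

theorem γ_transpose (j : Fin 6) : (γ (K := K) j).transpose = γ j := by
  ext1 a b
  fin_cases j <;> fin_cases a <;> fin_cases b <;> rfl

theorem symbol_transpose (j : Fin 6) : (symbol (K := K) j).transpose = symbol j := by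
  rw [symbol, Matrix.fromBlocks_transpose, α_transpose, γ_transpose, Matrix.transpose_transpose]

theorem symbol_mul_omega (j : Fin 6) : symbol (K := K) j * omega = Γ j := by
  simp [symbol, omega, Γ, Matrix.fromBlocks_multiply]

theorem H_eq (j : Fin 6) [CharZero K] : H (K := K) j =
    mulC (C (1 / 2)) * quad mulC weyl (symbol j) - mulC (C (1 / 8) * discFactor j) := by
  refine LinearMap.ext fun φ => ?_
  change (∑ a, ∑ b, (MvPowerSeries.C (C (1 / 2) * α j a b) * D a (D b φ)
        + MvPowerSeries.C (β j a b) * (MvPowerSeries.X b * D a φ)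
        + MvPowerSeries.C (C (1 / 2) * γ j a b)
            * (MvPowerSeries.X a * (MvPowerSeries.X b * φ))))
      + MvPowerSeries.C (C (1 / 2) * (β j).trace - C (1 / 8) * discFactor j) * φ = _
  have h2 : (MvPowerSeries.C (C (1 / 2)) : Series K) * 2 = 1 := by
    rw [← map_ofNat (MvPowerSeries.C (σ := Fin 3) (R := Params K)) 2, ← map_mul,
      ← map_ofNat (C (σ := Fin 6) (R := K)) 2, ← map_mul]
    norm_num
  have h3 : quad mulC weyl (symbol j) φ = ∑ a, ∑ b, (MvPowerSeries.C (α j a b) * D a (D b φ)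
        + 2 * (MvPowerSeries.C (β j a b) * (MvPowerSeries.X b * D a φ))
        + MvPowerSeries.C (γ j a b) * (MvPowerSeries.X a * (MvPowerSeries.X b * φ)))
        + MvPowerSeries.C (β j).trace * φ := by
    have h4 : MvPowerSeries.C (β j).trace * φ =
        ∑ a, ∑ b, MvPowerSeries.C (β j a b * (1 : Matrix _ _ (Params K)) a b) * φ := by
      simp [Matrix.trace, Matrix.one_apply, Finset.sum_mul, apply_ite]
    have h5 : ∑ a, ∑ b, MvPowerSeries.C (β j b a) * (MvPowerSeries.X a * D b φ) =
      ∑ a, ∑ b, MvPowerSeries.C (β j a b) * (MvPowerSeries.X b * D a φ) := Finset.sum_comm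
    have h6 : quad mulC weyl (symbol j) φ =
        ∑ a, ∑ b, MvPowerSeries.C (symbol j a b) * weyl a (weyl b φ) := by
      simp only [quad, LinearMap.sum_apply]
      rfl
    rw [h6, h4]
    simp only [Fintype.sum_sum_type, weyl_inl, weyl_inr, symbol, Matrix.fromBlocks_apply₁₁,
      Matrix.fromBlocks_apply₁₂, Matrix.fromBlocks_apply₂₁, Matrix.fromBlocks_apply₂₂, D_X_mul,
      mul_add, Finset.sum_add_distrib, Matrix.transpose_apply, h5, two_mul, map_mul, mul_assoc]
    abel
  rw [LinearMap.sub_apply, Module.End.mul_apply, mulC_apply, mulC_apply, h3, mul_add, map_sub,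
    sub_mul, add_sub_assoc, ← mul_assoc (MvPowerSeries.C (C (1 / 2))), ← map_mul, Finset.mul_sum]
  congr 1
  refine Finset.sum_congr rfl fun a _ => ?_
  rw [Finset.mul_sum]
  refine Finset.sum_congr rfl fun b _ => ?_
  rw [map_mul, map_mul]
  linear_combination - MvPowerSeries.C (β j a b) * (MvPowerSeries.X b * D a φ) * h2

theorem seriesL_apply (j : Fin 6) (φ : Series K) (d : Fin 3 →₀ ℕ) :
    MvPowerSeries.coeff d (seriesL j φ) = L j (MvPowerSeries.coeff d φ) := rfl

theorem seriesL_mul_mulC (j : Fin 6) (p : Params K) :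
    seriesL j * mulC p - mulC p * seriesL j = mulC (L j p) := by
  refine LinearMap.ext fun φ => MvPowerSeries.ext fun d => ?_
  simp only [LinearMap.sub_apply, Module.End.mul_apply, mulC_apply, map_sub, seriesL_apply,
    MvPowerSeries.coeff_C_mul, Derivation.leibniz, smul_eq_mul]
  ring

theorem seriesL_mul_weyl (j : Fin 6) (a : Fin 3 ⊕ Fin 3) :
    seriesL (K := K) j * weyl a = weyl a * seriesL j := by
  refine LinearMap.ext fun φ => MvPowerSeries.ext fun d => ?_
  simp only [Module.End.mul_apply, seriesL_apply]
  rcases a with a | a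
  · rw [weyl_inl, weyl_inl, MvPowerSeries.coeff_pderiv, MvPowerSeries.coeff_pderiv, seriesL_apply,
      Derivation.leibniz]
    have : L j ((d a : Params K) + 1) = 0 := by
      rw [← Nat.cast_succ]; exact (L j).map_natCast _
    rw [this, smul_zero, zero_add, smul_eq_mul, mul_comm]
  · rw [weyl_inr, weyl_inr, MvPowerSeries.X, MvPowerSeries.coeff_monomial_mul,
      MvPowerSeries.coeff_monomial_mul]
    split_ifs
    · rw [one_mul, one_mul, seriesL_apply]
    · exact map_zero _

theorem seriesL_mul_quad (j : Fin 6) (S : Matrix (Fin 3 ⊕ Fin 3) (Fin 3 ⊕ Fin 3) (Params K)) :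
    seriesL j * quad mulC weyl S - quad mulC weyl S * seriesL j =
      quad mulC weyl (S.map (L j)) := by
  simp only [quad, Finset.sum_mul, Finset.mul_sum, ← Finset.sum_sub_distrib]
  refine Finset.sum_congr rfl fun a _ => Finset.sum_congr rfl fun b _ => ?_
  have h1 : weyl (K := K) a * (weyl b * seriesL j) = seriesL j * (weyl a * weyl b) := by
    rw [← seriesL_mul_weyl, ← mul_assoc, ← seriesL_mul_weyl, mul_assoc]
  rw [Matrix.map_apply, ← seriesL_mul_mulC, mul_assoc (mulC _), mul_assoc (weyl a), h1, sub_mul,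
    mul_assoc, mul_assoc]

theorem mulC_C (a : K) : mulC (C a) = a • (1 : Module.End K (Series K)) := by
  refine LinearMap.ext fun φ => MvPowerSeries.ext fun d => ?_
  rw [mulC_apply, MvPowerSeries.coeff_C_mul, MvPolynomial.C_mul']
  rfl

theorem heat_eq_quad [CharZero K] (j : Fin 6) : heat (K := K) j =
    seriesL j - (1 / 2 : K) • quad mulC weyl (symbol j) + (1 / 8 : K) • mulC (discFactor j) := by
  rw [heat, H_eq, sub_add, map_mul, mulC_C, mulC_C, smul_one_mul, smul_one_mul]

/-- The identities between the coefficients of the operators that amount to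
`[L_{2i} - H_{2i}, L_{2j} - H_{2j}] = ∑ₖ cₖ (L_{2k} - H_{2k})`. -/
structure Compatible {K : Type*} [Field K] (i j : Fin 6) (c : Fin 6 → Params K) : Prop where
  vec : ∀ t, L (K := K) i (V j t) - L j (V i t) = ∑ k, c k * V k t
  disc : L (K := K) i (discFactor j) - L j (discFactor i) = ∑ k, c k * discFactor k
  quadratic : (symbol (K := K) j).map (L i) - (symbol i).map (L j)
      - (Γ i * symbol j - Γ j * symbol i) = ∑ k, c k • symbol k

theorem Compatible.L_commutator {i j : Fin 6} {c : Fin 6 → Params K} (h : Compatible i j c)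
    (p : Params K) : L i (L j p) - L j (L i p) = ∑ k, c k * L k p := by
  have h1 : ⁅L (K := K) i, L (K := K) j⁆ = ∑ k, c k • L k := by
    refine MvPolynomial.derivation_ext fun t => ?_
    rw [Derivation.commutator_apply, L_X, L_X, h.vec t]
    simp [Fin.sum_univ_six, L_X]
  rw [← Derivation.commutator_apply, h1]
  simp [Fin.sum_univ_six]

theorem Compatible.seriesL_commutator {i j : Fin 6} {c : Fin 6 → Params K} (h : Compatible i j c) :
    seriesL i * seriesL j - seriesL j * seriesL i = ∑ k, mulC (c k) * seriesL k := by
  refine LinearMap.ext fun φ => MvPowerSeries.ext fun d => ?_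
  simp only [LinearMap.sub_apply, Module.End.mul_apply, map_sub, seriesL_apply, LinearMap.sum_apply,
    mulC_apply, map_sum, MvPowerSeries.coeff_C_mul, h.L_commutator]

/-- Writing `L_{2j} - H_{2j} = L_{2j} - ½ quad(S_j) + ⅛ c_j` with the symmetric matrix
`S_j = symbol j`, the commutator of two such operators is again of this form:
`[L_{2i}, quad(S)] = quad(L_{2i} S)`, and the commutator of quadratic expressions is given by
`quad_mul_quad_sub`, where `S_i ω = Γ_{2i}`. -/
theorem Compatible.heat_commutator [CharZero K] {i j : Fin 6} {c : Fin 6 → Params K}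
    (h : Compatible i j c) :
    heat i * heat j - heat j * heat i = ∑ k, mulC (c k) * heat k := by
  have hm : ∀ p q : Params K, mulC p * mulC q = mulC q * mulC p := fun p q => by
    rw [← map_mul, ← map_mul, mul_comm]
  have hqf : ∀ (k : Fin 6) (p : Params K), quad mulC weyl (symbol k) * mulC p =
      mulC p * quad mulC weyl (symbol k) := by
    intro k p
    simp only [quad, Finset.sum_mul, Finset.mul_sum]
    refine Finset.sum_congr rfl fun a _ => Finset.sum_congr rfl fun b _ => ?_
    rw [mul_assoc, mul_assoc, weyl_mul_mulC, ← mul_assoc (weyl a), weyl_mul_mulC, mul_assoc,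
      ← mul_assoc, hm, mul_assoc]
  have hquad := quad_mul_quad_sub mulC weyl omega (symbol (K := K) i) (symbol j)
    (fun p a => weyl_mul_mulC p a) weyl_commutator omega_transpose (symbol_transpose i)
  rw [symbol_mul_omega, symbol_mul_omega] at hquad
  have hi := seriesL_mul_quad (K := K) i (symbol j)
  have hj := seriesL_mul_quad (K := K) j (symbol i)
  have di := seriesL_mul_mulC (K := K) i (discFactor j)
  have dj := seriesL_mul_mulC (K := K) j (discFactor i)
  have hsym := congrArg (quad mulC weyl) h.quadratic
  rw [quad_sub, quad_sub, quad_sum] at hsym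
  simp only [quad_smul] at hsym
  have hdisc := congrArg (mulC (K := K)) h.disc
  rw [map_sub, map_sum] at hdisc
  simp only [map_mul] at hdisc
  have h3 : heat (K := K) i * heat j - heat j * heat i =
      (seriesL i * seriesL j - seriesL j * seriesL i)
      - (1 / 2 : K) • ((seriesL i * quad mulC weyl (symbol j)
          - quad mulC weyl (symbol j) * seriesL i)
        - (seriesL j * quad mulC weyl (symbol i) - quad mulC weyl (symbol i) * seriesL j))
      + (1 / 8 : K) • ((seriesL i * mulC (discFactor j) - mulC (discFactor j) * seriesL i)
        - (seriesL j * mulC (discFactor i) - mulC (discFactor i) * seriesL j))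
      + (1 / 4 : K) • (quad mulC weyl (symbol i) * quad mulC weyl (symbol j)
        - quad mulC weyl (symbol j) * quad mulC weyl (symbol i)) := by
    rw [heat_eq_quad, heat_eq_quad]
    simp only [mul_add, add_mul, mul_sub, sub_mul, smul_mul_assoc, mul_smul_comm, hqf,
      hm (discFactor i) (discFactor j)]
    module
  have h4 : ∀ k, mulC (c k) * heat k = mulC (c k) * seriesL k
      - (1 / 2 : K) • (mulC (c k) * quad mulC weyl (symbol k))
      + (1 / 8 : K) • (mulC (c k) * mulC (discFactor k)) := by
    intro k
    rw [heat_eq_quad, mul_add, mul_sub, mul_smul_comm, mul_smul_comm]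
  rw [h3, hquad, h.seriesL_commutator, hi, hj, di, dj, hdisc]
  simp only [h4, Finset.sum_add_distrib, Finset.sum_sub_distrib, ← Finset.smul_sum, ← hsym, two_mul]
  module

/-- By symmetry, the identity between the symbols is to be checked only for the upper triangles of
the diagonal blocks and for one of the other blocks. -/
theorem compatible_of_blocks {i j : Fin 6} {c : Fin 6 → Params K}
    (vec : ∀ t, L (K := K) i (V j t) - L j (V i t) = ∑ k, c k * V k t)
    (disc : L (K := K) i (discFactor j) - L j (discFactor i) = ∑ k, c k * discFactor k)
    (alpha : ∀ a b, a ≤ b → L (K := K) i (α j a b) - L j (α i a b)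
      - (∑ x, (α i a x * β j b x - β i a x * α j x b)
        - ∑ x, (α j a x * β i b x - β j a x * α i x b)) = ∑ k, c k * α k a b)
    (beta : ∀ a b, L (K := K) i (β j a b) - L j (β i a b)
      - (∑ x, (α i a x * γ j x b - β i a x * β j x b)
        - ∑ x, (α j a x * γ i x b - β j a x * β i x b)) = ∑ k, c k * β k a b)
    (gamma : ∀ a b, a ≤ b → L (K := K) i (γ j a b) - L j (γ i a b)
      - (∑ x, (β i x a * γ j x b - γ i a x * β j x b)
        - ∑ x, (β j x a * γ i x b - γ j a x * β i x b)) = ∑ k, c k * γ k a b) :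
    Compatible i j c := by
  refine ⟨vec, disc, ?_⟩
  have hα : ∀ k a b, α (K := K) k a b = α k b a := fun k a b => congrFun₂ (α_transpose k) b a
  have hγ : ∀ k a b, γ (K := K) k a b = γ k b a := fun k a b => congrFun₂ (γ_transpose k) b a
  have alpha' : ∀ a b, _ := fun a b => (le_total a b).elim (alpha a b) fun hab => by
    have := alpha b a hab
    simp only [Finset.sum_sub_distrib] at this ⊢
    simp only [hα _ a]
    rw [← this]
    simp only [hα _ b, mul_comm]
    ring
  have gamma' : ∀ a b, _ := fun a b => (le_total a b).elim (gamma a b) fun hab => by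
    have := gamma b a hab
    simp only [Finset.sum_sub_distrib] at this ⊢
    simp only [hγ _ a]
    rw [← this]
    simp only [hγ _ b, mul_comm]
    ring
  have hs : ∀ a b, (∑ k, c k • symbol (K := K) k) a b = ∑ k, c k * symbol k a b := by
    intro a b
    rw [Matrix.sum_apply]
    rfl
  ext1 a b
  rw [hs]
  rcases a with a | a <;> rcases b with b | b
  · refine Eq.trans ?_ (alpha' a b)
    simp [symbol, Γ, Matrix.fromBlocks_multiply, Matrix.mul_apply]
    ring
  · refine Eq.trans ?_ (beta a b)
    simp [symbol, Γ, Matrix.fromBlocks_multiply, Matrix.mul_apply]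
    ring
  · refine Eq.trans ?_ (beta b a)
    simp [symbol, Γ, Matrix.fromBlocks_multiply, Matrix.mul_apply]
    simp only [hα _ _ b, hγ _ _ a, mul_comm]
    ring
  · refine Eq.trans ?_ (gamma' a b)
    simp [symbol, Γ, Matrix.fromBlocks_multiply, Matrix.mul_apply]
    ring

/-! ### The commutation relations of the heat operators -/

/-- The coefficients of `[L_{2i}, L_{2j}] = ∑ₖ c_{ijk} L_{2k}`, for `1 ≤ i < j`. -/
def structureCoeff : Fin 6 → Fin 6 → Fin 6 → Params K :=
  ![
    0,
    ![0,
      0,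
      ![C (16 / 7) * μ₆, -(C (16 / 7) * μ₄), 0, 2, 0, 0],
      ![C (12 / 7) * μ₈, 0, -(C (12 / 7) * μ₄), 0, 4, 0],
      ![C (8 / 7) * μ₁₀, 0, 0, -(C (8 / 7) * μ₄), 0, 6],
      ![C (4 / 7) * μ₁₂, 0, 0, 0, -(C (4 / 7) * μ₄), 0]],
    ![0,
      0,
      0,
      ![-(2 * μ₁₀), C (18 / 7) * μ₈, -(C (18 / 7) * μ₆), 2 * μ₄, 0, 2],
      ![-(4 * μ₁₂), C (12 / 7) * μ₁₀, 0, -(C (12 / 7) * μ₆), 4 * μ₄, 0],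
      ![-(6 * μ₁₄), C (6 / 7) * μ₁₂, 0, 0, -(C (6 / 7) * μ₆), 6 * μ₄]],
    ![0,
      0,
      0,
      0,
      ![-(2 * μ₁₄), -(2 * μ₁₂), C (16 / 7) * μ₁₀, -(C (16 / 7) * μ₈), 2 * μ₆, 2 * μ₄],
      ![0, -(4 * μ₁₄), C (8 / 7) * μ₁₂, 0, -(C (8 / 7) * μ₈), 4 * μ₆]],
    ![0,
      0,
      0,
      0,
      0,
      ![0, 0, -(2 * μ₁₄), C (10 / 7) * μ₁₂, -(C (10 / 7) * μ₁₀), 2 * μ₈]],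
    0]

set_option maxHeartbeats 16000000 in
theorem V_compatible [CharZero K] (i j : Fin 6) (hi : 0 < i) (hij : i < j) (t : Fin 6) :
    L (K := K) i (V j t) - L j (V i t) = ∑ k, structureCoeff i j k * V k t := by
  refine params_funext fun x => ?_
  fin_cases i <;> fin_cases j <;>
    first
    | exact absurd hi (by decide)
    | exact absurd hij (by decide)
    | skip
  all_goals fin_cases t
  all_goals
  · simp only [Fin.zero_eta, Fin.mk_one, Fin.reduceFinMk, Fin.sum_univ_six, V, structureCoeff,
      Matrix.of_apply, Matrix.cons_val, Pi.zero_apply, mul_zero, zero_mul, add_zero, zero_add,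
      sub_zero, zero_sub, mul_one, one_mul]
    try simp only [Derivation.leibniz, Derivation.leibniz_pow, Derivation.map_add,
      Derivation.map_sub, Derivation.map_neg, Derivation.map_zero, L_X, L_C, L_ofNat,
      smul_eq_mul, Derivation.map_one_eq_zero, nsmul_eq_mul, Nat.cast_ofNat, mul_zero, zero_mul,
      add_zero, zero_add, sub_zero, zero_sub, neg_zero]
    try simp only [V, Matrix.of_apply, Matrix.cons_val]
    try simp only [RingHom.map_mul, RingHom.map_add, RingHom.map_sub, RingHom.map_neg,
      RingHom.map_zero, RingHom.map_one, RingHom.map_pow, map_ofNat, MvPolynomial.eval_X,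
      MvPolynomial.eval_C]
    try ring

set_option maxHeartbeats 16000000 in
theorem discFactor_compatible [CharZero K] (i j : Fin 6) (hi : 0 < i) (hij : i < j) :
    L (K := K) i (discFactor j) - L j (discFactor i) =
      ∑ k, structureCoeff i j k * discFactor k := by
  refine params_funext fun x => ?_
  fin_cases i <;> fin_cases j <;>
    first
    | exact absurd hi (by decide)
    | exact absurd hij (by decide)
    | skip
  all_goals
  · simp only [Fin.zero_eta, Fin.mk_one, Fin.reduceFinMk, Fin.sum_univ_six, discFactor,
      structureCoeff, Matrix.of_apply, Matrix.cons_val, Pi.zero_apply, mul_zero, zero_mul,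
      add_zero, zero_add, sub_zero, zero_sub, mul_one, one_mul]
    try simp only [Derivation.leibniz, Derivation.leibniz_pow, Derivation.map_add,
      Derivation.map_sub, Derivation.map_neg, Derivation.map_zero, L_X, L_C, L_ofNat,
      smul_eq_mul, Derivation.map_one_eq_zero, nsmul_eq_mul, Nat.cast_ofNat, mul_zero, zero_mul,
      add_zero, zero_add, sub_zero, zero_sub, neg_zero]
    try simp only [V, Matrix.of_apply, Matrix.cons_val]
    try simp only [RingHom.map_mul, RingHom.map_add, RingHom.map_sub, RingHom.map_neg,
      RingHom.map_zero, RingHom.map_one, RingHom.map_pow, map_ofNat, MvPolynomial.eval_X,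
      MvPolynomial.eval_C]
    try ring

set_option maxHeartbeats 16000000 in
theorem α_compatible [CharZero K] (i j : Fin 6) (hi : 0 < i) (hij : i < j) (a b : Fin 3)
    (hab : a ≤ b) :
    L (K := K) i (α j a b) - L j (α i a b)
      - (∑ x, (α i a x * β j b x - β i a x * α j x b)
        - ∑ x, (α j a x * β i b x - β j a x * α i x b)) = ∑ k, structureCoeff i j k * α k a b := by
  refine params_funext fun x => ?_
  fin_cases i <;> fin_cases j <;>
    first
    | exact absurd hi (by decide)
    | exact absurd hij (by decide)
    | skip
  all_goals
    fin_cases a <;> fin_cases b <;>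
      first
      | exact absurd hab (by decide)
      | skip
  all_goals
  · simp only [Fin.zero_eta, Fin.mk_one, Fin.reduceFinMk, Fin.sum_univ_six, Fin.sum_univ_three,
      α, β, structureCoeff, Matrix.of_apply, Matrix.cons_val, Pi.zero_apply, mul_zero, zero_mul,
      add_zero, zero_add, sub_zero, zero_sub, mul_one, one_mul]
    try simp only [Derivation.leibniz, Derivation.leibniz_pow, Derivation.map_add,
      Derivation.map_sub, Derivation.map_neg, Derivation.map_zero, L_X, L_C, L_ofNat,
      smul_eq_mul, Derivation.map_one_eq_zero, nsmul_eq_mul, Nat.cast_ofNat, mul_zero, zero_mul,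
      add_zero, zero_add, sub_zero, zero_sub, neg_zero]
    try simp only [V, Matrix.of_apply, Matrix.cons_val]
    try simp only [RingHom.map_mul, RingHom.map_add, RingHom.map_sub, RingHom.map_neg,
      RingHom.map_zero, RingHom.map_one, RingHom.map_pow, map_ofNat, MvPolynomial.eval_X,
      MvPolynomial.eval_C]
    try ring

set_option maxHeartbeats 16000000 in
theorem β_compatible [CharZero K] (i j : Fin 6) (hi : 0 < i) (hij : i < j) (a b : Fin 3) :
    L (K := K) i (β j a b) - L j (β i a b)
      - (∑ x, (α i a x * γ j x b - β i a x * β j x b)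
        - ∑ x, (α j a x * γ i x b - β j a x * β i x b)) = ∑ k, structureCoeff i j k * β k a b := by
  refine params_funext fun x => ?_
  fin_cases i <;> fin_cases j <;>
    first
    | exact absurd hi (by decide)
    | exact absurd hij (by decide)
    | skip
  all_goals fin_cases a <;> fin_cases b
  all_goals
  · simp only [Fin.zero_eta, Fin.mk_one, Fin.reduceFinMk, Fin.sum_univ_six, Fin.sum_univ_three,
      α, β, γ, structureCoeff, Matrix.of_apply, Matrix.cons_val, Pi.zero_apply, mul_zero,
      zero_mul, add_zero, zero_add, sub_zero, zero_sub, mul_one, one_mul]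
    try simp only [Derivation.leibniz, Derivation.leibniz_pow, Derivation.map_add,
      Derivation.map_sub, Derivation.map_neg, Derivation.map_zero, L_X, L_C, L_ofNat,
      smul_eq_mul, Derivation.map_one_eq_zero, nsmul_eq_mul, Nat.cast_ofNat, mul_zero, zero_mul,
      add_zero, zero_add, sub_zero, zero_sub, neg_zero]
    try simp only [V, Matrix.of_apply, Matrix.cons_val]
    try simp only [RingHom.map_mul, RingHom.map_add, RingHom.map_sub, RingHom.map_neg,
      RingHom.map_zero, RingHom.map_one, RingHom.map_pow, map_ofNat, MvPolynomial.eval_X,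
      MvPolynomial.eval_C]
    try ring

set_option maxHeartbeats 16000000 in
theorem γ_compatible [CharZero K] (i j : Fin 6) (hi : 0 < i) (hij : i < j) (a b : Fin 3)
    (hab : a ≤ b) :
    L (K := K) i (γ j a b) - L j (γ i a b)
      - (∑ x, (β i x a * γ j x b - γ i a x * β j x b)
        - ∑ x, (β j x a * γ i x b - γ j a x * β i x b)) = ∑ k, structureCoeff i j k * γ k a b := by
  refine params_funext fun x => ?_
  fin_cases i <;> fin_cases j <;>
    first
    | exact absurd hi (by decide)
    | exact absurd hij (by decide)
    | skip
  all_goals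
    fin_cases a <;> fin_cases b <;>
      first
      | exact absurd hab (by decide)
      | skip
  all_goals
  · simp only [Fin.zero_eta, Fin.mk_one, Fin.reduceFinMk, Fin.sum_univ_six, Fin.sum_univ_three,
      β, γ, structureCoeff, Matrix.of_apply, Matrix.cons_val, Pi.zero_apply, mul_zero, zero_mul,
      add_zero, zero_add, sub_zero, zero_sub, mul_one, one_mul]
    try simp only [Derivation.leibniz, Derivation.leibniz_pow, Derivation.map_add,
      Derivation.map_sub, Derivation.map_neg, Derivation.map_zero, L_X, L_C, L_ofNat,
      smul_eq_mul, Derivation.map_one_eq_zero, nsmul_eq_mul, Nat.cast_ofNat, mul_zero, zero_mul,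
      add_zero, zero_add, sub_zero, zero_sub, neg_zero]
    try simp only [V, Matrix.of_apply, Matrix.cons_val]
    try simp only [RingHom.map_mul, RingHom.map_add, RingHom.map_sub, RingHom.map_neg,
      RingHom.map_zero, RingHom.map_one, RingHom.map_pow, map_ofNat, MvPolynomial.eval_X,
      MvPolynomial.eval_C]
    try ring

/-- The relations `[L_{2i}, L_{2j}] = ∑ₖ c_{ijk} L_{2k}` extend to the factors `c_j`, the
logarithmic derivatives of the discriminant, and to the matrices `Γ_{2j}` of a flat connection. -/
theorem compatible [CharZero K] (i j : Fin 6) (hi : 0 < i) (hij : i < j) :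
    Compatible (K := K) i j (structureCoeff i j) :=
  compatible_of_blocks (V_compatible i j hi hij) (discFactor_compatible i j hi hij)
    (α_compatible i j hi hij) (β_compatible i j hi hij) (γ_compatible i j hi hij)

/-- The operators `L_{2j} - H_{2j}` satisfy the commutation relations of the vector fields
`L_{2j}`. -/
theorem heat_commutator [CharZero K] (i j : Fin 6) (hi : 0 < i) (hij : i < j) (φ : Series K) :
    heat i (heat j φ) - heat j (heat i φ) =
      ∑ k, MvPowerSeries.C (structureCoeff i j k) * heat k φ := by
  have := LinearMap.congr_fun (compatible (K := K) i j hi hij).heat_commutator φ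
  simpa only [LinearMap.sub_apply, Module.End.mul_apply, LinearMap.sum_apply, mulC_apply] using this

/-! ### The leading parts of the compatibility conditions -/

/-- The compatibility conditions for the leading parts `r_j`, `j = 2, …, 5`, of the defects
`(L_{2j} - H_{2j}) φ` of a power series with `(L_{2j} - H_{2j}) φ = 0` for `j = 0, 1`. The
arguments are the exponents of `u₅, u₃, u₁`. If `A_j` is the part of `H_{2j}` with constant
coefficients, these are the conditions `A_i r_j - A_j r_i = - ∑ₖ c_{ijk}(0) r_k` for `1 ≤ i < j ≤ 5`
with `r_1 = 0`, written in Hurwitz coefficients. -/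
structure LeadingConditions (r2 r3 r4 r5 : ℤ → ℤ → ℤ → K) : Prop where
  one_two : ∀ l m k, 0 ≤ l → 0 ≤ m → 0 ≤ k →
    r2 l m (k + 2) + 2 * k * r2 l (m + 1) (k - 1) + 6 * m * r2 (l + 1) (m - 1) k = -4 * r3 l m k
  one_three : ∀ l m k, 0 ≤ l → 0 ≤ m → 0 ≤ k →
    r3 l m (k + 2) + 2 * k * r3 l (m + 1) (k - 1) + 6 * m * r3 (l + 1) (m - 1) k = -8 * r4 l m k
  one_four : ∀ l m k, 0 ≤ l → 0 ≤ m → 0 ≤ k →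
    r4 l m (k + 2) + 2 * k * r4 l (m + 1) (k - 1) + 6 * m * r4 (l + 1) (m - 1) k = -12 * r5 l m k
  one_five : ∀ l m k, 0 ≤ l → 0 ≤ m → 0 ≤ k →
    r5 l m (k + 2) + 2 * k * r5 l (m + 1) (k - 1) + 6 * m * r5 (l + 1) (m - 1) k = 0
  two_three : ∀ l m k, 0 ≤ l → 0 ≤ m → 0 ≤ k →
    r3 l (m + 1) (k + 1) + k * r3 (l + 1) m (k - 1) =
      1 / 2 * r2 l (m + 2) k + r2 (l + 1) m (k + 1) - 2 * r5 l m k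
  two_four : ∀ l m k, 0 ≤ l → 0 ≤ m → 0 ≤ k →
    r4 l (m + 1) (k + 1) + k * r4 (l + 1) m (k - 1) = r2 (l + 1) (m + 1) k
  two_five : ∀ l m k, 0 ≤ l → 0 ≤ m → 0 ≤ k →
    r5 l (m + 1) (k + 1) + k * r5 (l + 1) m (k - 1) = 1 / 2 * r2 (l + 2) m k
  three_four : ∀ l m k, 0 ≤ l → 0 ≤ m → 0 ≤ k →
    1 / 2 * r4 l (m + 2) k + r4 (l + 1) m (k + 1) = r3 (l + 1) (m + 1) k
  three_five : ∀ l m k, 0 ≤ l → 0 ≤ m → 0 ≤ k →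
    1 / 2 * r5 l (m + 2) k + r5 (l + 1) m (k + 1) = 1 / 2 * r3 (l + 2) m k
  four_five : ∀ l m k, 0 ≤ l → 0 ≤ m → 0 ≤ k →
    r5 (l + 1) (m + 1) k = 1 / 2 * r4 (l + 2) m k

/-- A power series in `u` that is killed by the leading part of `H₂`, a heat operator with `u₁` as
its space variable, is determined by its terms of degree at most `1` in `u₁`. -/
theorem eq_zero_of_leading_one {r : ℤ → ℤ → ℤ → K}
    (h : ∀ l m k, 0 ≤ l → 0 ≤ m → 0 ≤ k →
      r l m (k + 2) + 2 * k * r l (m + 1) (k - 1) + 6 * m * r (l + 1) (m - 1) k = 0)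
    (h0 : ∀ l m, 0 ≤ l → 0 ≤ m → r l m 0 = 0) (h1 : ∀ l m, 0 ≤ l → 0 ≤ m → r l m 1 = 0)
    (l m k : ℤ) (hl : 0 ≤ l) (hm : 0 ≤ m) (hk : 0 ≤ k) : r l m k = 0 := by
  lift k to ℕ using hk
  induction k using Nat.strong_induction_on generalizing l m with
  | _ k ih =>
    match k with
    | 0 => exact h0 l m hl hm
    | 1 => exact h1 l m hl hm
    | k + 2 =>
      have e := h l m k hl hm (by positivity)
      have e1 : (k : K) * r l (m + 1) (k - 1) = 0 := by
        rcases k with _ | k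
        · simp
        · have := ih k (by omega) l (m + 1) hl (by omega)
          push_cast
          rw [add_sub_cancel_right, this, mul_zero]
      have e2 : (m : K) * r (l + 1) (m - 1) k = 0 := by
        rcases hm.eq_or_lt with rfl | hm'
        · simp
        · rw [ih k (by omega) (l + 1) (m - 1) (by omega) (by omega), mul_zero]
      push_cast at e ⊢
      linear_combination e - 2 * e1 - 6 * e2

/-- If the leading parts vanish where the first recursion scheme uses the recurrences `P₄, …, P₁₀`
(hypotheses `n2, …, n5'`), then they vanish altogether, up to the four coefficients `s2, …, s4` that
the compatibility conditions leave free. The coefficients with odd `5 ℓ + 3 m + k` vanish by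
homogeneity. Each part is determined by its terms of degree at most `1` in `u₁`, by
`eq_zero_of_leading_one`, once the next part is known to vanish; so the parts are treated in the
order `r5, r4, r3, r2`, and the other conditions serve to show that these terms vanish. -/
theorem LeadingConditions.eq_zero [CharZero K] {r2 r3 r4 r5 : ℤ → ℤ → ℤ → K}
    (h : LeadingConditions r2 r3 r4 r5)
    (odd2 : ∀ l m k, (5 * l + 3 * m + k) % 2 = 1 → r2 l m k = 0)
    (odd3 : ∀ l m k, (5 * l + 3 * m + k) % 2 = 1 → r3 l m k = 0)
    (odd4 : ∀ l m k, (5 * l + 3 * m + k) % 2 = 1 → r4 l m k = 0)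
    (odd5 : ∀ l m k, (5 * l + 3 * m + k) % 2 = 1 → r5 l m k = 0)
    (n2 : ∀ l m, 0 ≤ l → 0 ≤ m → r2 l m 0 = 0) (n3 : ∀ l m, 0 ≤ l → 0 ≤ m → r3 l m 0 = 0)
    (n4 : ∀ l, 0 ≤ l → r4 l 0 0 = 0) (n5 : ∀ l, 0 ≤ l → r5 l 0 0 = 0)
    (n5' : ∀ l, 0 ≤ l → r5 l 0 1 = 0)
    (s2 : r2 1 0 1 = 0) (s2' : r2 0 1 1 = 0) (s3 : r3 1 0 1 = 0) (s4 : r4 0 2 0 = 0) :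
    ∀ l m k, 0 ≤ l → 0 ≤ m → 0 ≤ k →
      r2 l m k = 0 ∧ r3 l m k = 0 ∧ r4 l m k = 0 ∧ r5 l m k = 0 := by
  -- the part `r5`
  have e5 : ∀ l m, 0 ≤ l → 0 ≤ m → r5 l m 1 = 0 := by
    intro l m hl hm
    rcases hm.eq_or_lt with rfl | hm'
    · exact n5' l hl
    · have e := h.two_five l (m - 1) 0 hl (by omega) le_rfl
      rw [n2 _ _ (by omega) (by omega)] at e
      simpa using e
  have f5 : ∀ l m, 0 ≤ l → 0 ≤ m → r5 l m 0 = 0 := by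
    intro l m hl hm
    obtain rfl | rfl | hm' : m = 0 ∨ m = 1 ∨ 2 ≤ m := by omega
    · exact n5 l hl
    · rcases hl.eq_or_lt with rfl | hl'
      · exact odd5 _ _ _ (by norm_num)
      · have e := h.four_five (l - 1) 0 0 (by omega) le_rfl le_rfl
        rw [n4 _ (by omega)] at e
        simpa using e
    · have e := h.three_five l (m - 2) 0 hl (by omega) le_rfl
      rw [n3 _ _ (by omega) (by omega), zero_add, e5 _ _ (by omega) (by omega)] at e
      simpa using e
  have z5 := eq_zero_of_leading_one h.one_five f5 e5
  -- the part `r4`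
  have a4 : ∀ l m k, 2 ≤ l → 0 ≤ m → 0 ≤ k → r4 l m k = 0 := by
    intro l m k hl hm hk
    have e := h.four_five (l - 2) m k (by omega) hm hk
    rw [z5 _ _ _ (by omega) (by omega) hk] at e
    simpa using e.symm
  have b4 : ∀ l m, 0 ≤ l → 0 ≤ m → r4 l m 1 = 0 := by
    intro l m hl hm
    rcases hm.eq_or_lt with rfl | hm'
    · obtain rfl | rfl | hl' : l = 0 ∨ l = 1 ∨ 2 ≤ l := by omega
      · exact odd4 _ _ _ (by norm_num)
      · have e := h.three_four 0 0 0 le_rfl le_rfl le_rfl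
        norm_num [s4, n3] at e
        exact e
      · exact a4 _ _ _ hl' le_rfl zero_le_one
    · have e := h.two_four l (m - 1) 0 hl (by omega) le_rfl
      rw [n2 _ _ (by omega) (by omega)] at e
      simpa using e
  -- the conditions give both `r2 1 2 1 = -11 r4 1 1 0` and `r2 1 2 1 = 2 r3 1 1 2 = -16 r4 1 1 0`
  have c4 : r4 1 1 0 = 0 := by
    have t1 := h.two_four 0 1 1 le_rfl zero_le_one zero_le_one
    have t2 := h.one_four 0 2 0 le_rfl zero_le_two le_rfl
    have t3 := h.one_three 1 1 0 zero_le_one zero_le_one le_rfl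
    have t4 := h.one_two 2 0 0 zero_le_two le_rfl le_rfl
    have t5 := h.two_three 1 0 1 zero_le_one le_rfl zero_le_one
    norm_num [z5, n2, n3] at t1 t2 t3 t4 t5
    rw [t4] at t5
    linear_combination (1 / 5 : K) * (t1 - t2 - 2 * t5 + 2 * t3)
  have d4 : ∀ l m, 0 ≤ l → 0 ≤ m → r4 l m 0 = 0 := by
    intro l m hl hm
    obtain rfl | rfl | hm' : m = 0 ∨ m = 1 ∨ 2 ≤ m := by omega
    · exact n4 l hl
    · obtain rfl | rfl | hl' : l = 0 ∨ l = 1 ∨ 2 ≤ l := by omega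
      · exact odd4 _ _ _ (by norm_num)
      · exact c4
      · exact a4 _ _ _ hl' zero_le_one le_rfl
    · have e := h.three_four l (m - 2) 0 hl (by omega) le_rfl
      rw [n3 _ _ (by omega) (by omega), zero_add, b4 _ _ (by omega) (by omega)] at e
      simpa using e
  have z4 := eq_zero_of_leading_one (fun l m k hl hm hk => (h.one_four l m k hl hm hk).trans
    (by rw [z5 l m k hl hm hk, mul_zero])) d4 b4
  -- the part `r3`
  have a3 : ∀ l m, 0 ≤ l → 0 ≤ m → r3 l m 1 = 0 := by
    intro l m hl hm
    by_cases hl2 : 2 ≤ l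
    · have e := h.three_five (l - 2) m 1 (by omega) hm zero_le_one
      rw [z5 _ _ _ (by omega) (by omega) (by omega), z5 _ _ _ (by omega) (by omega) (by omega)] at e
      simpa using e.symm
    by_cases hlm : 1 ≤ l ∧ 1 ≤ m
    · have e := h.three_four (l - 1) (m - 1) 1 (by omega) (by omega) zero_le_one
      rw [z4 _ _ _ (by omega) (by omega) (by omega), z4 _ _ _ (by omega) (by omega) (by omega)] at e
      simpa using e.symm
    rcases hm.eq_or_lt with rfl | hm'
    · obtain rfl | rfl : l = 0 ∨ l = 1 := by omega
      · exact odd3 _ _ _ (by norm_num)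
      · exact s3
    · obtain rfl : l = 0 := by omega
      have e := h.two_three 0 (m - 1) 0 le_rfl (by omega) le_rfl
      rw [n2 _ _ (by omega) (by omega), z5 _ _ _ (by omega) (by omega) (by omega)] at e
      have e' : r2 1 (m - 1) 1 = 0 := by
        rcases (show (1 : ℤ) ≤ m by omega).eq_or_lt with rfl | hm2
        · exact s2
        · have e := h.two_four 0 (m - 2) 1 le_rfl (by omega) zero_le_one
          rw [z4 _ _ _ (by omega) (by omega) (by omega),
            z4 _ _ _ (by omega) (by omega) (by omega)] at e
          rw [show m - 1 = m - 2 + 1 by ring]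
          simpa using e.symm
      simpa [e'] using e
  have z3 := eq_zero_of_leading_one (fun l m k hl hm hk => (h.one_three l m k hl hm hk).trans
    (by rw [z4 l m k hl hm hk, mul_zero])) n3 a3
  -- the part `r2`
  have b2 : ∀ l m, 0 ≤ l → 0 ≤ m → r2 l m 2 = 0 := by
    intro l m hl hm
    have e := h.one_two l m 0 hl hm le_rfl
    have e2 : (m : K) * r2 (l + 1) (m - 1) 0 = 0 := by
      rcases hm.eq_or_lt with rfl | hm'
      · simp
      · rw [n2 _ _ (by omega) (by omega), mul_zero]
    rw [z3 _ _ _ hl hm le_rfl, Int.cast_zero, zero_add] at e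
    linear_combination e - 6 * e2
  have a2 : ∀ l m, 0 ≤ l → 0 ≤ m → r2 l m 1 = 0 := by
    intro l m hl hm
    rcases hl.eq_or_lt with rfl | hl'
    · obtain rfl | rfl | hm' : m = 0 ∨ m = 1 ∨ 2 ≤ m := by omega
      · exact odd2 _ _ _ (by norm_num)
      · exact s2'
      · have e := h.two_three 0 (m - 2) 1 le_rfl (by omega) zero_le_one
        rw [z3 _ _ _ (by omega) (by omega) (by omega), z3 _ _ _ (by omega) (by omega) (by omega),
          z5 _ _ _ (by omega) (by omega) (by omega), one_add_one_eq_two,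
          b2 _ _ (by omega) (by omega)] at e
        simpa using e.symm
    · have e := h.two_three (l - 1) m 0 (by omega) hm le_rfl
      rw [z3 _ _ _ (by omega) (by omega) (by omega), n2 _ _ (by omega) (by omega),
        z5 _ _ _ (by omega) (by omega) (by omega)] at e
      simpa using e.symm
  have z2 := eq_zero_of_leading_one (fun l m k hl hm hk => (h.one_two l m k hl hm hk).trans
    (by rw [z3 l m k hl hm hk, mul_zero])) n2 a2
  exact fun l m k hl hm hk => ⟨z2 l m k hl hm hk, z3 l m k hl hm hk, z4 l m k hl hm hk,
    z5 l m k hl hm hk⟩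

/-- The coefficients of `ψ` at the monomials of `μ`-weight less than `w` vanish. -/
def VanishesBelow (w : ℤ) (ψ : Series K) : Prop :=
  ∀ l m k n4 n6 n8 n10 n12 n14 : ℤ, 4 * n4 + 6 * n6 + 8 * n8 + 10 * n10 + 12 * n12 + 14 * n14 < w →
    hc ψ l m k n4 n6 n8 n10 n12 n14 = 0

section leading

variable [CharZero K] {ψ : Series K} {l m k n4 n6 n8 n10 n12 n14 : ℤ}

/-- If the coefficients of `ψ` of lower weight vanish, then only the part of `H₂` with constant
coefficients contributes. The same holds for the other operators. -/
theorem hc_heat_one_leading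
    (h : VanishesBelow (4 * n4 + 6 * n6 + 8 * n8 + 10 * n10 + 12 * n12 + 14 * n14) ψ)
    (hl : 0 ≤ l) (hm : 0 ≤ m) (hk : 0 ≤ k) :
    hc (heat 1 ψ) l m k n4 n6 n8 n10 n12 n14 =
    -((1 / 2) * (hc ψ l m (k + 2) n4 n6 n8 n10 n12 n14
      + 2 * k * hc ψ l (m + 1) (k - 1) n4 n6 n8 n10 n12 n14
      + 6 * m * hc ψ (l + 1) (m - 1) k n4 n6 n8 n10 n12 n14)) := by
  rw [hc_heat_one ψ hl hm hk]
  simp (disch := omega) only [h _ _ _ _ _ _ _ _ _, mul_zero, add_zero, sub_zero]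

theorem hc_heat_two_leading
    (h : VanishesBelow (4 * n4 + 6 * n6 + 8 * n8 + 10 * n10 + 12 * n12 + 14 * n14) ψ)
    (hl : 0 ≤ l) (hm : 0 ≤ m) (hk : 0 ≤ k) :
    hc (heat 2 ψ) l m k n4 n6 n8 n10 n12 n14 =
    -(hc ψ l (m + 1) (k + 1) n4 n6 n8 n10 n12 n14
      + k * hc ψ (l + 1) m (k - 1) n4 n6 n8 n10 n12 n14) := by
  rw [hc_heat_two ψ hl hm hk]
  simp (disch := omega) only [h _ _ _ _ _ _ _ _ _, mul_zero, add_zero, sub_zero]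

theorem hc_heat_three_leading
    (h : VanishesBelow (4 * n4 + 6 * n6 + 8 * n8 + 10 * n10 + 12 * n12 + 14 * n14) ψ)
    (hl : 0 ≤ l) (hm : 0 ≤ m) (hk : 0 ≤ k) :
    hc (heat 3 ψ) l m k n4 n6 n8 n10 n12 n14 =
    -((1 / 2) * (hc ψ l (m + 2) k n4 n6 n8 n10 n12 n14
      + 2 * hc ψ (l + 1) m (k + 1) n4 n6 n8 n10 n12 n14)) := by
  rw [hc_heat_three ψ hl hm hk]
  simp (disch := omega) only [h _ _ _ _ _ _ _ _ _, mul_zero, add_zero, sub_zero, neg_zero]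

theorem hc_heat_four_leading
    (h : VanishesBelow (4 * n4 + 6 * n6 + 8 * n8 + 10 * n10 + 12 * n12 + 14 * n14) ψ)
    (hl : 0 ≤ l) (hm : 0 ≤ m) (hk : 0 ≤ k) :
    hc (heat 4 ψ) l m k n4 n6 n8 n10 n12 n14 =
    -hc ψ (l + 1) (m + 1) k n4 n6 n8 n10 n12 n14 := by
  rw [hc_heat_four ψ hl hm hk]
  simp (disch := omega) only [h _ _ _ _ _ _ _ _ _, mul_zero, add_zero, sub_zero]

theorem hc_heat_five_leading
    (h : VanishesBelow (4 * n4 + 6 * n6 + 8 * n8 + 10 * n10 + 12 * n12 + 14 * n14) ψ)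
    (hl : 0 ≤ l) (hm : 0 ≤ m) (hk : 0 ≤ k) :
    hc (heat 5 ψ) l m k n4 n6 n8 n10 n12 n14 =
    -((1 / 2) * hc ψ (l + 2) m k n4 n6 n8 n10 n12 n14) := by
  rw [hc_heat_five ψ hl hm hk]
  simp (disch := omega) only [h _ _ _ _ _ _ _ _ _, mul_zero, add_zero, sub_zero]

end leading

/-- The commutation relations of the operators `L_{2j} - H_{2j}`, applied to `φ`, yield the
conditions on the leading parts of the defects. -/
theorem leadingConditions [CharZero K] {φ : Series K} (h0 : heat 0 φ = 0) (h1 : heat 1 φ = 0)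
    {n4 n6 n8 n10 n12 n14 : ℤ} (h : ∀ j,
      VanishesBelow (4 * n4 + 6 * n6 + 8 * n8 + 10 * n10 + 12 * n12 + 14 * n14) (heat j φ)) :
    LeadingConditions (fun l m k => hc (heat 2 φ) l m k n4 n6 n8 n10 n12 n14)
      (fun l m k => hc (heat 3 φ) l m k n4 n6 n8 n10 n12 n14)
      (fun l m k => hc (heat 4 φ) l m k n4 n6 n8 n10 n12 n14)
      (fun l m k => hc (heat 5 φ) l m k n4 n6 n8 n10 n12 n14) := by
  have c : ∀ i j : Fin 6, 0 < i → i < j → ∀ l m k : ℤ,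
      hc (heat i (heat j φ)) l m k n4 n6 n8 n10 n12 n14
        - hc (heat j (heat i φ)) l m k n4 n6 n8 n10 n12 n14 =
      hc (∑ s, MvPowerSeries.C (structureCoeff i j s) * heat s φ) l m k n4 n6 n8 n10 n12 n14 :=
    fun i j hi hij l m k => by rw [← hc_sub, heat_commutator i j hi hij]
  constructor <;> intro l m k hl hm hk
  case' one_two =>
    have e := c 1 2 (by decide) (by decide) l m k
    rw [hc_heat_one_leading (h 2) hl hm hk, h1, map_zero, hc_zero] at e
  case' one_three =>
    have e := c 1 3 (by decide) (by decide) l m k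
    rw [hc_heat_one_leading (h 3) hl hm hk, h1, map_zero, hc_zero] at e
  case' one_four =>
    have e := c 1 4 (by decide) (by decide) l m k
    rw [hc_heat_one_leading (h 4) hl hm hk, h1, map_zero, hc_zero] at e
  case' one_five =>
    have e := c 1 5 (by decide) (by decide) l m k
    rw [hc_heat_one_leading (h 5) hl hm hk, h1, map_zero, hc_zero] at e
  case' two_three =>
    have e := c 2 3 (by decide) (by decide) l m k
    rw [hc_heat_two_leading (h 3) hl hm hk, hc_heat_three_leading (h 2) hl hm hk] at e
  case' two_four =>
    have e := c 2 4 (by decide) (by decide) l m k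
    rw [hc_heat_two_leading (h 4) hl hm hk, hc_heat_four_leading (h 2) hl hm hk] at e
  case' two_five =>
    have e := c 2 5 (by decide) (by decide) l m k
    rw [hc_heat_two_leading (h 5) hl hm hk, hc_heat_five_leading (h 2) hl hm hk] at e
  case' three_four =>
    have e := c 3 4 (by decide) (by decide) l m k
    rw [hc_heat_three_leading (h 4) hl hm hk, hc_heat_four_leading (h 3) hl hm hk] at e
  case' three_five =>
    have e := c 3 5 (by decide) (by decide) l m k
    rw [hc_heat_three_leading (h 5) hl hm hk, hc_heat_five_leading (h 3) hl hm hk] at e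
  case' four_five =>
    have e := c 4 5 (by decide) (by decide) l m k
    rw [hc_heat_four_leading (h 5) hl hm hk, hc_heat_five_leading (h 4) hl hm hk] at e
  -- on the right hand sides only the constants among the structure coefficients contribute: the
  -- others multiply a defect by a parameter, so that its values at smaller weights enter
  all_goals
    simp (disch := omega) only [Fin.sum_univ_six, structureCoeff, Matrix.cons_val, h0, h1,
      hc_add, hc_neg, mul_zero, map_zero, zero_mul, hc_zero, hc_ofNat_mul, C_mul_mul, C_neg_mul,
      hc_C_mul, hc_param_mul_0, hc_param_mul_1, hc_param_mul_2, hc_param_mul_3, hc_param_mul_4,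
      hc_param_mul_5, h _ _ _ _ _ _ _ _ _ _, add_zero, zero_add, neg_zero] at e
  all_goals first
    | linear_combination -2 * e
    | linear_combination -1 * e

/-! ### The existence of a solution -/

/-- The values of a solution of the first scheme that enter the four coefficients of the defects
which the leading parts of the compatibility conditions leave free. -/
theorem initial_values [CharZero K] {b : Idx → K} (hb : ∀ I : Idx, ¬ I.Nonneg → b I = 0)
    (hstart : b Idx.start = 1) (hr : ∀ I : Idx, I.Nonneg → I ≠ Idx.start → b I = rule1 b I) :
    b ⟨0, 2, 0, 0, 0, 0, 0, 0⟩ = -2 ∧ b ⟨2, 0, 1, 0, 0, 0, 0, 0⟩ = 0 ∧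
      b ⟨1, 1, 1, 0, 0, 0, 0, 0⟩ = 0 ∧ b ⟨1, 2, 0, 1, 0, 0, 0, 0⟩ = 0 ∧
      b ⟨2, 0, 0, 1, 0, 0, 0, 0⟩ = 0 ∧ b ⟨1, 3, 0, 0, 1, 0, 0, 0⟩ = -2 ∧
      b ⟨1, 3, 2, 0, 0, 0, 0, 0⟩ = 0 := by
  rw [Idx.start] at hstart
  have hn : ∀ l m n4 n6 n8 n10 n12 n14 : ℤ, ¬ Idx.Nonneg ⟨l, m, n4, n6, n8, n10, n12, n14⟩ →
    b ⟨l, m, n4, n6, n8, n10, n12, n14⟩ = 0 := fun _ _ _ _ _ _ _ _ => hb _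
  have v1 : b ⟨0, 2, 0, 0, 0, 0, 0, 0⟩ = -2 := by
    rw [hr _ (by norm_num [Idx.Nonneg, Idx.k, Idx.wt]) (by norm_num [Idx.start])]
    norm_num [rule1, rhs6a, low6, Idx.k, Idx.wt, Idx.shift, Idx.Nonneg, hn, hstart]
  have v2 : b ⟨2, 0, 1, 0, 0, 0, 0, 0⟩ = 0 := by
    rw [hr _ (by norm_num [Idx.Nonneg, Idx.k, Idx.wt]) (by norm_num [Idx.start])]
    norm_num [rule1, rhs10, low10, Idx.k, Idx.wt, Idx.shift, Idx.Nonneg, hn]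
  have v3 : b ⟨1, 1, 1, 0, 0, 0, 0, 0⟩ = 0 := by
    rw [hr _ (by norm_num [Idx.Nonneg, Idx.k, Idx.wt]) (by norm_num [Idx.start])]
    norm_num [rule1, rhs2, low2, Idx.k, Idx.wt, Idx.shift, Idx.Nonneg, hn, hstart, v1, v2]
  have v4 : b ⟨1, 2, 0, 1, 0, 0, 0, 0⟩ = 0 := by
    rw [hr _ (by norm_num [Idx.Nonneg, Idx.k, Idx.wt]) (by norm_num [Idx.start])]
    norm_num [rule1, rhs4, low4, Idx.k, Idx.wt, Idx.shift, Idx.Nonneg, hn, hstart, v1]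
  have v5 : b ⟨2, 0, 0, 1, 0, 0, 0, 0⟩ = 0 := by
    rw [hr _ (by norm_num [Idx.Nonneg, Idx.k, Idx.wt]) (by norm_num [Idx.start])]
    norm_num [rule1, rhs2, low2, Idx.k, Idx.wt, Idx.shift, Idx.Nonneg, hn, v2]
  have v6 : b ⟨2, 1, 0, 0, 1, 0, 0, 0⟩ = 0 := by
    rw [hr _ (by norm_num [Idx.Nonneg, Idx.k, Idx.wt]) (by norm_num [Idx.start])]
    norm_num [rule1, rhs4, low4, Idx.k, Idx.wt, Idx.shift, Idx.Nonneg, hn, v2]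
  have v7 : b ⟨2, 1, 2, 0, 0, 0, 0, 0⟩ = 0 := by
    rw [hr _ (by norm_num [Idx.Nonneg, Idx.k, Idx.wt]) (by norm_num [Idx.start])]
    norm_num [rule1, rhs4, low4, Idx.k, Idx.wt, Idx.shift, Idx.Nonneg, hn, v2]
  refine ⟨v1, v2, v3, v4, v5, ?_, ?_⟩
  · rw [hr _ (by norm_num [Idx.Nonneg, Idx.k, Idx.wt]) (by norm_num [Idx.start])]
    norm_num [rule1, rhs6a, low6, Idx.k, Idx.wt, Idx.shift, Idx.Nonneg, hn, hstart, v1, v6]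
  · rw [hr _ (by norm_num [Idx.Nonneg, Idx.k, Idx.wt]) (by norm_num [Idx.start])]
    norm_num [rule1, rhs6a, low6, Idx.k, Idx.wt, Idx.shift, Idx.Nonneg, hn, v2, v7]

section scheme

variable {b : Idx → K}

/-- The first scheme imposes `P₂` everywhere, and `P₄`, `P₆`, `P₈`, `P₁₀` for the least values of
`k` (and of `m`, in the last two cases). -/
theorem P2_of_rule1 (hr : ∀ I : Idx, I.Nonneg → I ≠ Idx.start → b I = rule1 b I) {I : Idx}
    (hI : I.Nonneg) (hk : 2 ≤ I.k) : P2 b I := by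
  have h0 : I ≠ Idx.start := by
    rintro rfl
    norm_num [Idx.start, Idx.k, Idx.wt] at hk
  have := hr I hI h0
  rwa [rule1, if_pos (by omega)] at this

theorem P4_of_rule1 (hr : ∀ I : Idx, I.Nonneg → I ≠ Idx.start → b I = rule1 b I) {I : Idx}
    (hI : I.Nonneg) (hk : I.k = 4) : P4 b I := by
  have h1 := k_shift I 0 1
  have hm : (I.shift 0 1).m = I.m + 1 := rfl
  have h2 := hI.2.1
  have h3 := hI.2.2.1
  have e := hr (I.shift 0 1) (hI.shift (by omega) (by omega) (by omega))
    (fun h => by rw [h, Idx.start] at hm; simp only at hm; omega)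
  rw [rule1, if_neg (by omega), if_pos (by omega), rhs4, shift_shift, shift_shift] at e
  simpa [P4, shift_zero] using e

theorem P6_of_rule1 (hr : ∀ I : Idx, I.Nonneg → I ≠ Idx.start → b I = rule1 b I) {I : Idx}
    (hI : I.Nonneg) (hk : I.k = 6) : P6 b I := by
  have h1 := k_shift I 0 2
  have hm : (I.shift 0 2).m = I.m + 2 := rfl
  have h2 := hI.2.1
  have h3 := hI.2.2.1
  have e := hr (I.shift 0 2) (hI.shift (by omega) (by omega) (by omega))
    (fun h => by rw [h, Idx.start] at hm; simp only at hm; omega)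
  rw [rule1, if_neg (by omega), if_neg (by omega), if_pos (by omega), rhs6a, shift_shift,
    shift_shift] at e
  rw [P6, e]
  simp [shift_zero]

theorem P8_of_rule1 (hr : ∀ I : Idx, I.Nonneg → I ≠ Idx.start → b I = rule1 b I) {I : Idx}
    (hI : I.Nonneg) (hk : I.k = 8) (hm0 : I.m = 0) : P8 b I := by
  have h1 := k_shift I 1 1
  have hm : (I.shift 1 1).m = I.m + 1 := rfl
  have h2 := hI.2.1
  have e := hr (I.shift 1 1) (hI.shift (by omega) (by omega) (by omega))
    (fun h => by rw [h, Idx.start] at hm; simp only at hm; omega)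
  rw [rule1, if_neg (by omega), if_neg (by omega), if_neg (by omega), if_pos (by omega), rhs8,
    shift_shift] at e
  simpa [P8, shift_zero] using e

theorem P10_of_rule1 (hr : ∀ I : Idx, I.Nonneg → I ≠ Idx.start → b I = rule1 b I) {I : Idx}
    (hI : I.Nonneg) (hk : I.k = 10 ∨ I.k = 11) (hm0 : I.m = 0) : P10 b I := by
  have h1 := k_shift I 2 0
  have hm : (I.shift 2 0).m = I.m + 0 := rfl
  have hl : (I.shift 2 0).l = I.l + 2 := rfl
  have h2 := hI.2.1
  have e := hr (I.shift 2 0) (hI.shift (by omega) (by omega) (by omega))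
    (fun h => by rw [h, Idx.start] at hl; simp only at hl; omega)
  rw [rule1, if_neg (by omega), if_neg (by omega), if_neg (by omega), if_neg (by omega), rhs10,
    shift_shift] at e
  simpa [P10, shift_zero] using e

/-- A solution of the first scheme satisfies all of the recurrences: by induction on the
`μ`-weight, the leading parts of the defects vanish. -/
theorem recurrences_of_rule1 [CharZero K] (hb : ∀ I : Idx, ¬ I.Nonneg → b I = 0)
    (hstart : b Idx.start = 1)
    (hr : ∀ I : Idx, I.Nonneg → I ≠ Idx.start → b I = rule1 b I) : Recurrences b := by
  have h0 : heat 0 (hurwitz b) = 0 := heat_zero_hurwitz hb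
  have h1 : heat 1 (hurwitz b) = 0 :=
    (heat_one_hurwitz_eq_zero_iff hb).mpr fun I hI hk => P2_of_rule1 hr hI hk
  obtain ⟨v1, v2, v3, v4, v5, v6, v7⟩ := initial_values hb hstart hr
  have hneg : ∀ (j : Fin 6) {l m k n4 n6 n8 n10 n12 n14 : ℤ}, ¬ (0 ≤ l ∧ 0 ≤ m ∧ 0 ≤ k ∧ 0 ≤ n4 ∧
      0 ≤ n6 ∧ 0 ≤ n8 ∧ 0 ≤ n10 ∧ 0 ≤ n12 ∧ 0 ≤ n14) →
      hc (heat j (hurwitz b)) l m k n4 n6 n8 n10 n12 n14 = 0 := fun j _ _ _ _ _ _ _ _ _ =>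
    hc_of_not_nonneg _
  have main : ∀ (w : ℕ) (j : Fin 6), VanishesBelow w (heat j (hurwitz b)) := by
    intro w
    induction w with
    | zero =>
      intro j l m k n4 n6 n8 n10 n12 n14 hw
      exact hneg j (by push_cast at hw; omega)
    | succ w ih =>
      intro j l m k n4 n6 n8 n10 n12 n14 hw
      by_cases hw' : 4 * n4 + 6 * n6 + 8 * n8 + 10 * n10 + 12 * n12 + 14 * n14 < (w : ℤ)
      · exact ih j _ _ _ _ _ _ _ _ _ hw'
      have hww : (w : ℤ) = 4 * n4 + 6 * n6 + 8 * n8 + 10 * n10 + 12 * n12 + 14 * n14 := by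
        push_cast at hw; omega
      rw [hww] at ih
      by_cases hn : 0 ≤ n4 ∧ 0 ≤ n6 ∧ 0 ≤ n8 ∧ 0 ≤ n10 ∧ 0 ≤ n12 ∧ 0 ≤ n14
      swap
      · exact hneg j fun h => hn h.2.2.2
      by_cases hlmk : 0 ≤ l ∧ 0 ≤ m ∧ 0 ≤ k
      swap
      · exact hneg j fun h => hlmk ⟨h.1, h.2.1, h.2.2.1⟩
      clear hw hw' hww
      have hI : ∀ l m : ℤ, 0 ≤ l → 0 ≤ m → 0 ≤ Idx.k ⟨l, m, n4, n6, n8, n10, n12, n14⟩ →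
        Idx.Nonneg ⟨l, m, n4, n6, n8, n10, n12, n14⟩ := fun l m hl hm hk => ⟨hk, hl, hm, hn⟩
      have hkdef : ∀ l m : ℤ, Idx.k ⟨l, m, n4, n6, n8, n10, n12, n14⟩ = 6 - 5 * l - 3 * m +
        (4 * n4 + 6 * n6 + 8 * n8 + 10 * n10 + 12 * n12 + 14 * n14) := fun _ _ => rfl
      have odd2 : ∀ l m k : ℤ, (5 * l + 3 * m + k) % 2 = 1 →
          hc (heat 2 (hurwitz b)) l m k n4 n6 n8 n10 n12 n14 = 0 := by
        intro l m k h
        by_cases h' : 0 ≤ l ∧ 0 ≤ m ∧ 0 ≤ k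
        · exact hc_heat_two_hurwitz_of_ne hb h'.1 h'.2.1 h'.2.2 (by rw [hkdef]; omega)
        · exact hneg _ fun h => h' ⟨h.1, h.2.1, h.2.2.1⟩
      have odd3 : ∀ l m k : ℤ, (5 * l + 3 * m + k) % 2 = 1 →
          hc (heat 3 (hurwitz b)) l m k n4 n6 n8 n10 n12 n14 = 0 := by
        intro l m k h
        by_cases h' : 0 ≤ l ∧ 0 ≤ m ∧ 0 ≤ k
        · exact hc_heat_three_hurwitz_of_ne hb h'.1 h'.2.1 h'.2.2 (by rw [hkdef]; omega)
        · exact hneg _ fun h => h' ⟨h.1, h.2.1, h.2.2.1⟩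
      have odd4 : ∀ l m k : ℤ, (5 * l + 3 * m + k) % 2 = 1 →
          hc (heat 4 (hurwitz b)) l m k n4 n6 n8 n10 n12 n14 = 0 := by
        intro l m k h
        by_cases h' : 0 ≤ l ∧ 0 ≤ m ∧ 0 ≤ k
        · exact hc_heat_four_hurwitz_of_ne hb h'.1 h'.2.1 h'.2.2 (by rw [hkdef]; omega)
        · exact hneg _ fun h => h' ⟨h.1, h.2.1, h.2.2.1⟩
      have odd5 : ∀ l m k : ℤ, (5 * l + 3 * m + k) % 2 = 1 →
          hc (heat 5 (hurwitz b)) l m k n4 n6 n8 n10 n12 n14 = 0 := by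
        intro l m k h
        by_cases h' : 0 ≤ l ∧ 0 ≤ m ∧ 0 ≤ k
        · exact hc_heat_five_hurwitz_of_ne hb h'.1 h'.2.1 h'.2.2 (by rw [hkdef]; omega)
        · exact hneg _ fun h => h' ⟨h.1, h.2.1, h.2.2.1⟩
      have z := (leadingConditions h0 h1 ih).eq_zero odd2 odd3 odd4 odd5 ?_ ?_ ?_ ?_ ?_ ?_ ?_ ?_ ?_
        l m k hlmk.1 hlmk.2.1 hlmk.2.2
      · fin_cases j
        · change hc (heat 0 _) _ _ _ _ _ _ _ _ _ = 0
          rw [h0, hc_zero]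
        · change hc (heat 1 _) _ _ _ _ _ _ _ _ _ = 0
          rw [h1, hc_zero]
        · exact z.1
        · exact z.2.1
        · exact z.2.2.1
        · exact z.2.2.2
      · intro l m hl hm
        by_cases hk : Idx.k ⟨l, m, n4, n6, n8, n10, n12, n14⟩ = 0 + 4
        · have e : b _ = _ := P4_of_rule1 hr (hI l m hl hm (by omega)) (by omega)
          rw [hc_heat_two_hurwitz hb hl hm le_rfl rfl hk, e]
          ring
        · exact hc_heat_two_hurwitz_of_ne hb hl hm le_rfl hk
      · intro l m hl hm
        by_cases hk : Idx.k ⟨l, m, n4, n6, n8, n10, n12, n14⟩ = 0 + 6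
        · have e : _ = _ := P6_of_rule1 hr (hI l m hl hm (by omega)) (by omega)
          rw [hc_heat_three_hurwitz hb hl hm le_rfl rfl hk, e]
          ring
        · exact hc_heat_three_hurwitz_of_ne hb hl hm le_rfl hk
      · intro l hl
        by_cases hk : Idx.k ⟨l, 0, n4, n6, n8, n10, n12, n14⟩ = 0 + 8
        · have e : b _ = _ := P8_of_rule1 hr (hI l 0 hl le_rfl (by omega)) (by omega) rfl
          rw [hc_heat_four_hurwitz hb hl le_rfl le_rfl rfl hk, e]
          ring
        · exact hc_heat_four_hurwitz_of_ne hb hl le_rfl le_rfl hk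
      · intro l hl
        by_cases hk : Idx.k ⟨l, 0, n4, n6, n8, n10, n12, n14⟩ = 0 + 10
        · have e : b _ = _ := P10_of_rule1 hr (hI l 0 hl le_rfl (by omega)) (by omega) rfl
          rw [hc_heat_five_hurwitz hb hl le_rfl le_rfl rfl hk, e]
          ring
        · exact hc_heat_five_hurwitz_of_ne hb hl le_rfl le_rfl hk
      · intro l hl
        by_cases hk : Idx.k ⟨l, 0, n4, n6, n8, n10, n12, n14⟩ = 1 + 10
        · have e : b _ = _ := P10_of_rule1 hr (hI l 0 hl le_rfl (by omega)) (by omega) rfl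
          rw [hc_heat_five_hurwitz hb hl le_rfl zero_le_one rfl hk, e]
          ring
        · exact hc_heat_five_hurwitz_of_ne hb hl le_rfl zero_le_one hk
      -- The four coefficients that the leading conditions leave free: by homogeneity each of them
      -- occurs at a single weight, and the defects there are computed from `initial_values`.
      · -- weight `4`
        by_cases hk : Idx.k ⟨1, 0, n4, n6, n8, n10, n12, n14⟩ = 1 + 4
        · rw [hc_heat_two_hurwitz hb zero_le_one le_rfl zero_le_one rfl hk]
          rw [hkdef] at hk
          obtain ⟨rfl, rfl, rfl, rfl, rfl, rfl⟩ : n4 = 1 ∧ n6 = 0 ∧ n8 = 0 ∧ n10 = 0 ∧ n12 = 0 ∧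
            n14 = 0 := by omega
          norm_num [Idx.shift, Idx.k, Idx.wt, low4, v2, v3, hb, Idx.Nonneg]
        · exact hc_heat_two_hurwitz_of_ne hb zero_le_one le_rfl zero_le_one hk
      · -- weight `2`, where there is no monomial
        exact hc_heat_two_hurwitz_of_ne hb le_rfl zero_le_one zero_le_one (by rw [hkdef]; omega)
      · -- weight `6`
        by_cases hk : Idx.k ⟨1, 0, n4, n6, n8, n10, n12, n14⟩ = 1 + 6
        · rw [hc_heat_three_hurwitz hb zero_le_one le_rfl zero_le_one rfl hk]
          rw [hkdef] at hk
          obtain ⟨rfl, rfl, rfl, rfl, rfl, rfl⟩ : n4 = 0 ∧ n6 = 1 ∧ n8 = 0 ∧ n10 = 0 ∧ n12 = 0 ∧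
              n14 = 0 := by
            have h8 : n8 = 0 := by omega
            have h10 : n10 = 0 := by omega
            have h12 : n12 = 0 := by omega
            have h14 : n14 = 0 := by omega
            have h4 : n4 = 0 ∨ n4 = 1 := by omega
            rcases h4 with h4 | h4 <;> omega
          norm_num [Idx.shift, Idx.k, Idx.wt, low6, v4, v5, hb, Idx.Nonneg]
        · exact hc_heat_three_hurwitz_of_ne hb zero_le_one le_rfl zero_le_one hk
      · -- weight `8`
        by_cases hk : Idx.k ⟨0, 2, n4, n6, n8, n10, n12, n14⟩ = 0 + 8
        · rw [hc_heat_four_hurwitz hb le_rfl zero_le_two le_rfl rfl hk]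
          rw [hkdef] at hk
          obtain ⟨rfl, rfl, rfl, rfl, rfl, rfl⟩ | ⟨rfl, rfl, rfl, rfl, rfl, rfl⟩ :
              (n4 = 0 ∧ n6 = 0 ∧ n8 = 1 ∧ n10 = 0 ∧ n12 = 0 ∧ n14 = 0) ∨
              (n4 = 2 ∧ n6 = 0 ∧ n8 = 0 ∧ n10 = 0 ∧ n12 = 0 ∧ n14 = 0) := by
            have h8 : n8 = 0 ∨ n8 = 1 := by omega
            have h10 : n10 = 0 := by omega
            have h12 : n12 = 0 := by omega
            have h14 : n14 = 0 := by omega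
            rcases h8 with h8 | h8 <;> omega
          · norm_num [Idx.shift, Idx.k, Idx.wt, low8, v1, v6, hb, Idx.Nonneg]
          · norm_num [Idx.shift, Idx.k, Idx.wt, low8, v7, hb, Idx.Nonneg]
        · exact hc_heat_four_hurwitz_of_ne hb le_rfl zero_le_two le_rfl hk
  rw [← hurwitz_mem_solutionSpace hb, mem_solutionSpace]
  intro j
  refine eq_zero_of_hc fun l m k n4 n6 n8 n10 n12 n14 _ _ _ => ?_
  exact main ((4 * n4 + 6 * n6 + 8 * n8 + 10 * n10 + 12 * n12 + 14 * n14).toNat + 1) j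
    _ _ _ _ _ _ _ _ _ (by omega)

end scheme

end

end HyperellipticSigma

theorem mainTheorem3 (K : Type*) [Field K] [CharZero K] :
    -- the operators `L_{2j}` and the matrices `Γ_{2j}`
    (∀ j, IsTangent K j ∧ IsGaussManin K j) ∧
    -- the solutions of the first equation are the Hurwitz series
    (∀ φ : Series K, heat 0 φ = 0 ↔
      ∃! b : Idx → K, (∀ I : Idx, ¬ I.Nonneg → b I = 0) ∧ φ = hurwitz b) ∧
    -- the other equations amount to the recurrences
    (∀ b : Idx → K, (∀ I : Idx, ¬ I.Nonneg → b I = 0) →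
      (heat 1 (hurwitz b) = 0 ↔ ∀ I : Idx, I.Nonneg → 2 ≤ I.k → P2 b I) ∧
      (heat 2 (hurwitz b) = 0 ↔ ∀ I : Idx, I.Nonneg → 4 ≤ I.k → P4 b I) ∧
      (heat 3 (hurwitz b) = 0 ↔ ∀ I : Idx, I.Nonneg → 6 ≤ I.k → P6 b I) ∧
      (heat 4 (hurwitz b) = 0 ↔ ∀ I : Idx, I.Nonneg → 8 ≤ I.k → P8 b I) ∧
      (heat 5 (hurwitz b) = 0 ↔ ∀ I : Idx, I.Nonneg → 10 ≤ I.k → P10 b I)) ∧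
    -- the lower weight terms of the recurrences have lower weight
    (∀ I J : Idx, coeffAt (K := K) low2 I J ≠ 0 → I.wt - 12 ≤ J.wt ∧ J.wt ≤ I.wt - 2) ∧
    (∀ F ∈ ({low4, low6, low8, low10} : Set ((Idx → K) → Idx → K)), ∀ I J : Idx,
      coeffAt F I J ≠ 0 → J.wt < I.wt) ∧
    -- along the recursion schemes the weight never increases, and it drops after boundedly many
    -- steps
    (∀ (t : ℕ) (s : ℕ → Idx), (∀ i < t, Step (K := K) rule1 (s i) (s (i + 1))) →
      (s t).wt ≤ (s 0).wt ∧ (max (s 0).k 1 < t → (s t).wt < (s 0).wt)) ∧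
    (∀ (t : ℕ) (s : ℕ → Idx), (∀ i < t, Step (K := K) rule2 (s i) (s (i + 1))) →
      (s t).wt ≤ (s 0).wt ∧ (5 ≤ t → (s t).wt < (s 0).wt)) ∧
    -- each of the schemes has exactly one solution, it is the same for both, and the Hurwitz
    -- series with these coefficients spans the space of solutions
    (∃ b : Idx → K,
      (∀ b' : Idx → K, Scheme rule1 b' ↔ b' = b) ∧
      (∀ b' : Idx → K, Scheme rule2 b' ↔ b' = b) ∧
      solutionSpace K = Submodule.span K {hurwitz b}) ∧
    Module.finrank K (solutionSpace K) = 1 := by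
  have ⟨b, h⟩ := exists_scheme (K := K) wellFounded_rule1 FiniteForm.rule1
  obtain ⟨hb, hs, hr⟩ := scheme_iff.mp h
  have hschemes := schemes_of_recurrences hb hs (recurrences_of_rule1 hb hs hr)
  refine ⟨fun j => ⟨isTangent j, isGaussManin j⟩, heat_zero_eq_zero_iff,
    fun b hb => ⟨heat_one_hurwitz_eq_zero_iff hb, heat_two_hurwitz_eq_zero_iff hb,
      heat_three_hurwitz_eq_zero_iff hb, heat_four_hurwitz_eq_zero_iff hb,
      heat_five_hurwitz_eq_zero_iff hb⟩,
    fun I J => wt_of_coeffAt_low2, ?_, chain_rule1, chain_rule2, ⟨b, hschemes⟩, ?_⟩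
  · rintro F (rfl | rfl | rfl | rfl) I J hF
    · exact wt_lt_of_coeffAt_low4 hF
    · exact wt_lt_of_coeffAt_low6 hF
    · exact wt_lt_of_coeffAt_low8 hF
    · exact wt_lt_of_coeffAt_low10 hF
  · rw [hschemes.2.2]
    exact finrank_span_singleton (hurwitz_ne_zero hb hs)
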